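/- For a positive integer $k$ let $\mathcal F^k_{\mathbb R}$ be the singular foliation of $\mathbb R$ singly generated by $x^k\frac{d}{dx}$, i.e. the $C^\infty(\mathbb R)$-module of all vector fields $g(x)x^k\frac{d}{dx}$ with $g\in C_c^\infty(\mathbb R)$. Let $X$ be any complete smooth vector field generating $\mathcal F^k_{\mathbb R}$ (that is, $\{gX : g\in C_c^\infty(\mathbb R)\}=\mathcal F^k_{\mathbb R}$), and let $\phi$ be its flow, a smooth action of $\mathbb R$ on $\mathbb R$ fixing $0$. The C*-algebra of the foliation is the (maximal) crossed product $C^*(\mathcal F^k_{\mathbb R})=C_0(\mathbb R)\rtimes_\phi\mathbb R$ for the action $(\phi_tf)(x)=f(\phi_{-t}(x))$, i.e. the completion of $C_c(\mathbb R,C_0(\mathbb R))$ in the norm $\|F\|=\sup\bigl\|\int_{\mathbb R}\rho(F(t))V_t\,dt\bigr\|$, the supremum being over all covariant pairs $(\rho,V)$ on Hilbert spaces. Put $\mathbb R_-=(-\infty,0)$ and $\mathbb R_+=(0,\infty)$. The canonical representation $\pi_k$ of $C^*(\mathcal F^k_{\mathbb R})$ on $L^2(\mathbb R_-)\oplus L^2(\mathbb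 R_+)$ is the one determined by the covariant pair $(M,U)$, where $M$ is the representation of $C_0(\mathbb R)$ by multiplication operators and $(U_t\xi)(x)=(\phi_{-t}'(x))^{1/2}\,\xi(\phi_{-t}(x))$; thus $\pi_k(F)=\int_{\mathbb R}M(F(t))U_t\,dt$ for $F\in C_c(\mathbb R,C_0(\mathbb R))$. Let $A_k$ denote the image of $\pi_k$, a C*-algebra of operators on $L^2(\mathbb R_-)\oplus L^2(\mathbb R_+)$. **Theorem.** Let $k$ and $\ell$ be distinct positive integers. Then, for any choice of complete vector fields generating $\mathcal F^k_{\mathbb R}$ and $\mathcal F^\ell_{\mathbb R}$, one has $A_k\neq A_\ell$. In fact $$A_k\cap A_\ell=\mathcal K(L^2(\mathbb R_-))\oplus\mathcal K(L^2(\mathbb R_+)),$$ where $\mathcal K(H)$ denotes the compact operators on $H$. -/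

import Mathlib

open MeasureTheory Set Filter Topology
open scoped ENNReal ContDiff ZeroAtInfty CompactlySupported

noncomputable section

namespace OrderFoliation

/-- The `C^∞(ℝ)`-module of compactly supported vector fields on `ℝ` generated by the smooth vector
field `X d/dx`: all `g X d/dx` with `g` smooth and compactly supported. A vector field on `ℝ` is
written through its coefficient function. -/
def moduleGeneratedBy (X : ℝ → ℝ) : Set (ℝ → ℝ) :=
  {Y | ∃ g : ℝ → ℝ, ContDiff ℝ ∞ g ∧ HasCompactSupport g ∧ Y = fun x => g x * X x}

/-- The singular foliation `F^k` of `ℝ`, singly generated by `x^k d/dx`. -/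
def foliation (k : ℕ) : Set (ℝ → ℝ) := moduleGeneratedBy fun x => x ^ k

/-- The smooth vector field `X d/dx` (not necessarily compactly supported) generates `F^k`. -/
def IsGenerator (k : ℕ) (X : ℝ → ℝ) : Prop :=
  ContDiff ℝ ∞ X ∧ moduleGeneratedBy X = foliation k

/-- A smooth action of `ℝ` on `ℝ` that fixes the origin. -/
structure OriginFlow extends Flow ℝ ℝ where
  smooth : ContDiff ℝ ∞ fun p : ℝ × ℝ => toFlow p.1 p.2
  fixes_zero : ∀ t, toFlow t 0 = 0

instance : CoeFun OriginFlow fun _ => ℝ → ℝ → ℝ := ⟨fun φ => φ.toFlow⟩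

/-- The action is the flow of the vector field `X d/dx`, which is then complete. -/
def OriginFlow.IsFlowOf (φ : OriginFlow) (X : ℝ → ℝ) : Prop :=
  ∀ x, HasDerivAt (fun t => φ t x) (X x) 0

/-- The action of `ℝ` on `C₀(ℝ)` induced by the flow: `(φ_t f)(x) = f(φ_{-t}(x))`. -/
def OriginFlow.act (φ : OriginFlow) (t : ℝ) (f : C₀(ℝ, ℂ)) : C₀(ℝ, ℂ) :=
  f.comp (φ.toFlow.toHomeomorph (-t)).toCocompactMap

theorem OriginFlow.act_apply (φ : OriginFlow) (t : ℝ) (f : C₀(ℝ, ℂ)) (x : ℝ) :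
    φ.act t f x = f (φ (-t) x) := rfl

/-- A covariant pair for the action of `ℝ` on `C₀(ℝ)`, on the Hilbert space `H`: a
`*`-representation of `C₀(ℝ)` and a strongly continuous unitary representation of `ℝ` with
`U_t rep(f) U_t⁻¹ = rep(φ_t f)`. -/
structure CovariantPair (φ : OriginFlow) (H : Type) [NormedAddCommGroup H]
    [InnerProductSpace ℂ H] [CompleteSpace H] where
  rep : C₀(ℝ, ℂ) →⋆ₙₐ[ℂ] (H →L[ℂ] H)
  U : ℝ → (H ≃ₗᵢ[ℂ] H)
  U_add : ∀ s t ξ, U (s + t) ξ = U s (U t ξ)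
  U_cont : ∀ ξ, Continuous fun t => U t ξ
  covariant : ∀ t f ξ, U t (rep f ((U t).symm ξ)) = rep (φ.act t f) ξ

variable {φ : OriginFlow}

section Integrated

variable {H : Type} [NormedAddCommGroup H] [InnerProductSpace ℂ H] [CompleteSpace H]

theorem CovariantPair.norm_integrand_le (π : CovariantPair φ H) (F : C_c(ℝ, C₀(ℝ, ℂ))) (t : ℝ)
    (ξ : H) : ‖π.rep (F t) (π.U t ξ)‖ ≤ ‖F t‖ * ‖ξ‖ := by
  calc ‖π.rep (F t) (π.U t ξ)‖ ≤ ‖π.rep (F t)‖ * ‖π.U t ξ‖ := ContinuousLinearMap.le_opNorm _ _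
    _ ≤ ‖F t‖ * ‖ξ‖ := by
      rw [LinearIsometryEquiv.norm_map]
      gcongr
      exact NonUnitalStarAlgHom.norm_apply_le _ _

theorem CovariantPair.integrable_norm (F : C_c(ℝ, C₀(ℝ, ℂ))) : Integrable fun t => ‖F t‖ :=
  (F.continuous.integrable_of_hasCompactSupport F.hasCompactSupport).norm

theorem CovariantPair.integrable (π : CovariantPair φ H) (F : C_c(ℝ, C₀(ℝ, ℂ))) (ξ : H) :
    Integrable fun t => π.rep (F t) (π.U t ξ) := by
  have hc : Continuous fun t => π.rep (F t) (π.U t ξ) := by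
    have h1 : Continuous fun a => π.rep a := by
      refine AddMonoidHomClass.continuous_of_bound π.rep 1 fun a => ?_
      rw [one_mul]
      exact NonUnitalStarAlgHom.norm_apply_le _ _
    exact (h1.comp F.continuous).clm_apply (π.U_cont ξ)
  refine hc.integrable_of_hasCompactSupport (F.hasCompactSupport.mono ?_)
  intro t ht h
  exact ht (by simp [show F t = 0 from h])

/-- The integrated form of a covariant pair on `C_c(ℝ, C₀(ℝ))`:
`F ↦ ∫ rep(F(t)) U_t dt`, a strong integral. -/
def CovariantPair.integratedForm (π : CovariantPair φ H) (F : C_c(ℝ, C₀(ℝ, ℂ))) : H →L[ℂ] H :=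
  LinearMap.mkContinuous
    { toFun := fun ξ => ∫ t, π.rep (F t) (π.U t ξ)
      map_add' := fun ξ η => by
        simp only [map_add]
        exact integral_add (π.integrable F ξ) (π.integrable F η)
      map_smul' := fun c ξ => by
        simp only [map_smul, RingHom.id_apply]
        exact integral_smul c _ }
    (∫ t, ‖F t‖)
    (fun ξ => by
      change ‖∫ t, π.rep (F t) (π.U t ξ)‖ ≤ _
      rw [← integral_mul_const]
      exact norm_integral_le_of_norm_le ((CovariantPair.integrable_norm F).mul_const _)
        (ae_of_all _ fun t => π.norm_integrand_le F t ξ))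

theorem CovariantPair.integratedForm_apply (π : CovariantPair φ H) (F : C_c(ℝ, C₀(ℝ, ℂ))) (ξ : H) :
    π.integratedForm F ξ = ∫ t, π.rep (F t) (π.U t ξ) := rfl

theorem CovariantPair.norm_integratedForm_le (π : CovariantPair φ H) (F : C_c(ℝ, C₀(ℝ, ℂ))) :
    ‖π.integratedForm F‖ ≤ ∫ t, ‖F t‖ :=
  LinearMap.mkContinuous_norm_le _ (integral_nonneg fun _ => norm_nonneg _) _

end Integrated

/-- A Hilbert space with a covariant pair on it. -/
structure CovariantRep (φ : OriginFlow) : Type 1 where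
  H : Type
  [normedAddCommGroup : NormedAddCommGroup H]
  [innerProductSpace : InnerProductSpace ℂ H]
  [completeSpace : CompleteSpace H]
  pair : CovariantPair φ H

attribute [instance] CovariantRep.normedAddCommGroup CovariantRep.innerProductSpace
  CovariantRep.completeSpace

/-- The `ℓ^∞`-product of the algebras `B(H)` over all covariant pairs. -/
def ProductAlgebra (φ : OriginFlow) : Type 1 :=
  lp (fun π : CovariantRep φ => π.H →L[ℂ] π.H) ∞

instance (φ : OriginFlow) : NonUnitalCStarAlgebra (ProductAlgebra φ) where
  __ := (inferInstance : NonUnitalNormedRing (lp (fun π : CovariantRep φ => π.H →L[ℂ] π.H) ∞))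
  __ := (inferInstance : StarRing (lp (fun π : CovariantRep φ => π.H →L[ℂ] π.H) ∞))
  __ := (inferInstance : NormedSpace ℂ (lp (fun π : CovariantRep φ => π.H →L[ℂ] π.H) ∞))
  __ := (inferInstance : CompleteSpace (lp (fun π : CovariantRep φ => π.H →L[ℂ] π.H) ∞))
  __ := (inferInstance : CStarRing (lp (fun π : CovariantRep φ => π.H →L[ℂ] π.H) ∞))
  __ := (inferInstance : StarModule ℂ (lp (fun π : CovariantRep φ => π.H →L[ℂ] π.H) ∞))
  smul_assoc := (inferInstance : IsScalarTower ℂ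
    (lp (fun π : CovariantRep φ => π.H →L[ℂ] π.H) ∞)
    (lp (fun π : CovariantRep φ => π.H →L[ℂ] π.H) ∞)).smul_assoc
  smul_comm := (inferInstance : SMulCommClass ℂ
    (lp (fun π : CovariantRep φ => π.H →L[ℂ] π.H) ∞)
    (lp (fun π : CovariantRep φ => π.H →L[ℂ] π.H) ∞)).smul_comm

/-- The family of all integrated forms of `F`. Its norm is the universal norm
`sup ‖∫ rep(F(t)) U_t dt‖` of `F`, the supremum being over all covariant pairs. -/
def universalForm (φ : OriginFlow) (F : C_c(ℝ, C₀(ℝ, ℂ))) : ProductAlgebra φ :=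
  ⟨fun π => π.pair.integratedForm F, memℓp_infty ⟨∫ t, ‖F t‖, by
    rintro _ ⟨π, rfl⟩
    exact π.pair.norm_integratedForm_le F⟩⟩

/-- The crossed product `C₀(ℝ) ⋊_φ ℝ`, that is the completion of the convolution `*`-algebra
`C_c(ℝ, C₀(ℝ))` in the universal norm, realized as the closed `*`-subalgebra generated by the image
of `C_c(ℝ, C₀(ℝ))` in the universal representation. When `φ` is the flow of a complete generator
of `F^k`, it is the C*-algebra of the foliation `F^k`. -/
def crossedProduct (φ : OriginFlow) : NonUnitalStarSubalgebra ℂ (ProductAlgebra φ) :=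
  (NonUnitalStarAlgebra.adjoin ℂ (Set.range (universalForm φ))).topologicalClosure

instance (φ : OriginFlow) : IsClosed (crossedProduct φ : Set (ProductAlgebra φ)) :=
  isClosed_closure

def CovariantRep.eval (π : CovariantRep φ) : ProductAlgebra φ →⋆ₙₐ[ℂ] (π.H →L[ℂ] π.H) where
  toFun a := a.1 π
  map_smul' _ _ := rfl
  map_zero' := rfl
  map_add' _ _ := rfl
  map_mul' _ _ := rfl
  map_star' _ := rfl

/-- The representation of the crossed product determined by a covariant pair. -/
def CovariantPair.toHom {H : Type} [NormedAddCommGroup H] [InnerProductSpace ℂ H]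
    [CompleteSpace H] (π : CovariantPair φ H) : crossedProduct φ →⋆ₙₐ[ℂ] (H →L[ℂ] H) :=
  (CovariantRep.eval ⟨H, π⟩).comp (NonUnitalStarSubalgebraClass.subtype (crossedProduct φ))

theorem CovariantPair.toHom_apply {H : Type} [NormedAddCommGroup H] [InnerProductSpace ℂ H]
    [CompleteSpace H] (π : CovariantPair φ H) (F : C_c(ℝ, C₀(ℝ, ℂ)))
    (h : universalForm φ F ∈ crossedProduct φ) :
    π.toHom ⟨universalForm φ F, h⟩ = π.integratedForm F := rfl

section DirectSum

variable {H₁ H₂ : Type} [NormedAddCommGroup H₁] [InnerProductSpace ℂ H₁]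
  [NormedAddCommGroup H₂] [InnerProductSpace ℂ H₂]

/-- The operator `S ⊕ T` on the Hilbert space `H₁ ⊕ H₂`. -/
def opSum (S : H₁ →L[ℂ] H₁) (T : H₂ →L[ℂ] H₂) : WithLp 2 (H₁ × H₂) →L[ℂ] WithLp 2 (H₁ × H₂) :=
  ((WithLp.prodContinuousLinearEquiv 2 ℂ H₁ H₂).symm : _ →L[ℂ] _) ∘L (S.prodMap T) ∘L
    (WithLp.prodContinuousLinearEquiv 2 ℂ H₁ H₂ : _ →L[ℂ] _)

theorem opSum_apply (S : H₁ →L[ℂ] H₁) (T : H₂ →L[ℂ] H₂) (ξ : WithLp 2 (H₁ × H₂)) :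
    opSum S T ξ = WithLp.toLp 2 (S ξ.fst, T ξ.snd) := rfl

/-- The direct sum of two covariant pairs. -/
def CovariantPair.directSum [CompleteSpace H₁] [CompleteSpace H₂]
    (π₁ : CovariantPair φ H₁) (π₂ : CovariantPair φ H₂) :
    CovariantPair φ (WithLp 2 (H₁ × H₂)) where
  rep :=
    { toFun := fun f => opSum (π₁.rep f) (π₂.rep f)
      map_smul' := fun c f => by
        ext ξ
        simp only [map_smul, opSum_apply]
        rfl
      map_zero' := by
        ext1 ξ
        simp only [map_zero, opSum_apply, _root_.zero_apply]
        rfl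
      map_add' := fun f g => by
        ext ξ
        simp only [map_add, opSum_apply]
        rfl
      map_mul' := fun f g => by
        ext1 ξ
        simp only [map_mul, opSum_apply, _root_.mul_apply_eq_comp]
        rfl
      map_star' := fun f => by
        rw [ContinuousLinearMap.star_eq_adjoint, ContinuousLinearMap.eq_adjoint_iff]
        intro ξ η
        simp [opSum_apply, map_star, ContinuousLinearMap.star_eq_adjoint,
          ContinuousLinearMap.adjoint_inner_left] }
  U t := LinearIsometryEquiv.withLpProdCongr 2 (π₁.U t) (π₂.U t)
  U_add s t ξ := by
    apply WithLp.ofLp_injective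
    apply Prod.ext
    · exact π₁.U_add s t ξ.fst
    · exact π₂.U_add s t ξ.snd
  U_cont ξ := by
    exact (WithLp.prod_continuous_toLp 2 H₁ H₂).comp
      ((π₁.U_cont ξ.fst).prodMk (π₂.U_cont ξ.snd))
  covariant t f ξ := by
    apply WithLp.ofLp_injective
    apply Prod.ext
    · exact π₁.covariant t f ξ.fst
    · exact π₂.covariant t f ξ.snd

end DirectSum

namespace OriginFlow

variable (φ)

theorem apply_neg_apply (t x : ℝ) : φ t (φ (-t) x) = x := by
  rw [← φ.toFlow.map_add, add_neg_cancel, φ.toFlow.map_zero_apply]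

theorem neg_apply_apply (t x : ℝ) : φ (-t) (φ t x) = x := by
  rw [← φ.toFlow.map_add, neg_add_cancel, φ.toFlow.map_zero_apply]

theorem continuous_uncurry : Continuous fun p : ℝ × ℝ => φ p.1 p.2 := φ.smooth.continuous

theorem continuous_apply (t : ℝ) : Continuous (φ t) :=
  φ.continuous_uncurry.comp (by fun_prop : Continuous fun x : ℝ => (t, x))

theorem hasDerivAt_fderiv (t x : ℝ) :
    HasDerivAt (φ t) (fderiv ℝ (fun p : ℝ × ℝ => φ p.1 p.2) (t, x) (0, 1)) x := by
  have h1 : HasFDerivAt (fun p : ℝ × ℝ => φ p.1 p.2)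
      (fderiv ℝ (fun p : ℝ × ℝ => φ p.1 p.2) (t, x)) (t, x) :=
    (φ.smooth.differentiable (by simp) _).hasFDerivAt
  exact h1.comp_hasDerivAt x ((hasDerivAt_const x t).prodMk (hasDerivAt_id x))

theorem hasDerivAt (t x : ℝ) : HasDerivAt (φ t) (deriv (φ t) x) x :=
  (φ.hasDerivAt_fderiv t x).differentiableAt.hasDerivAt

theorem continuous_deriv : Continuous fun p : ℝ × ℝ => deriv (φ p.1) p.2 := by
  have h : (fun p : ℝ × ℝ => deriv (φ p.1) p.2) =
      fun p => fderiv ℝ (fun p : ℝ × ℝ => φ p.1 p.2) p (0, 1) := by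
    ext p
    exact (φ.hasDerivAt_fderiv p.1 p.2).deriv
  rw [h]
  exact (φ.smooth.continuous_fderiv (by simp)).clm_apply continuous_const

theorem deriv_add (s t x : ℝ) :
    deriv (φ (s + t)) x = deriv (φ s) (φ t x) * deriv (φ t) x := by
  have h : φ (s + t) = fun y => φ s (φ t y) := funext fun y => φ.toFlow.map_add s t y
  rw [h]
  exact ((φ.hasDerivAt s (φ t x)).comp x (φ.hasDerivAt t x)).deriv

theorem deriv_zero (x : ℝ) : deriv (φ 0) x = 1 := by
  have h : φ 0 = id := φ.toFlow.map_zero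
  rw [h, deriv_id]

theorem deriv_pos (t x : ℝ) : 0 < deriv (φ t) x := by
  have hne : ∀ s, deriv (φ s) x ≠ 0 := fun s h0 => by
    have h := φ.deriv_add (-s) s x
    rw [neg_add_cancel, φ.deriv_zero, h0, mul_zero] at h
    exact one_ne_zero h
  have hc : Continuous fun s => deriv (φ s) x :=
    φ.continuous_deriv.comp (by fun_prop : Continuous fun s : ℝ => (s, x))
  by_contra! hle
  obtain ⟨s, hs⟩ := mem_range_of_exists_le_of_exists_ge hc ⟨t, hle⟩
    ⟨0, by rw [φ.deriv_zero]; exact zero_le_one⟩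
  exact hne s hs

theorem strictMono (t : ℝ) : StrictMono (φ t) := strictMono_of_deriv_pos (φ.deriv_pos t)

theorem mapsTo_Ioi (t : ℝ) : MapsTo (φ t) (Ioi 0) (Ioi 0) := fun x hx => by
  have h := φ.strictMono t (mem_Ioi.1 hx)
  rwa [φ.fixes_zero] at h

theorem mapsTo_Iio (t : ℝ) : MapsTo (φ t) (Iio 0) (Iio 0) := fun x hx => by
  have h := φ.strictMono t (mem_Iio.1 hx)
  rwa [φ.fixes_zero] at h

variable {φ} {S : Set ℝ}

theorem image_eq (hinv : ∀ t, MapsTo (φ t) S S) (t : ℝ) : φ t '' S = S :=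
  (hinv t).image_subset.antisymm fun x hx =>
    ⟨φ (-t) x, hinv (-t) hx, φ.apply_neg_apply t x⟩

theorem lintegral_comp (hS : MeasurableSet S) (hinv : ∀ t, MapsTo (φ t) S S) (t : ℝ)
    (g : ℝ → ℝ≥0∞) :
    ∫⁻ x in S, ENNReal.ofReal (deriv (φ t) x) * g (φ t x) = ∫⁻ x in S, g x := by
  conv_rhs => rw [← image_eq hinv t]
  rw [lintegral_image_eq_lintegral_abs_deriv_mul hS
    (fun x _ => (φ.hasDerivAt t x).hasDerivWithinAt) (φ.strictMono t).injective.injOn g]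
  simp_rw [abs_of_pos (φ.deriv_pos t _)]

theorem quasiMeasurePreserving (hS : MeasurableSet S) (hinv : ∀ t, MapsTo (φ t) S S) (t : ℝ) :
    Measure.QuasiMeasurePreserving (φ t) (volume.restrict S) (volume.restrict S) := by
  refine ⟨(φ.continuous_apply t).measurable, Measure.AbsolutelyContinuous.mk fun N hN hN0 => ?_⟩
  have h1 := lintegral_comp hS hinv t (N.indicator 1)
  have hm : Measurable fun x => ENNReal.ofReal (deriv (φ t) x) * N.indicator (1 : ℝ → ℝ≥0∞) (φ t x) :=
    (measurable_deriv _).ennreal_ofReal.mul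
      ((measurable_one.indicator hN).comp (φ.continuous_apply t).measurable)
  rw [lintegral_indicator_one hN, hN0, lintegral_eq_zero_iff hm] at h1
  rw [Measure.map_apply (φ.continuous_apply t).measurable hN, measure_eq_zero_iff_ae_notMem]
  filter_upwards [h1] with x hx hxN
  have hxN' : φ t x ∈ N := hxN
  simp [indicator_of_mem hxN', not_le.2 (φ.deriv_pos t x)] at hx

/-- The function with value `φ_t'(x)^{1/2} g(φ_t(x))` at `x`. -/
def transport (φ : OriginFlow) (t : ℝ) (g : ℝ → ℂ) (x : ℝ) : ℂ :=
  (Real.sqrt (deriv (φ t) x) : ℂ) * g (φ t x)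

theorem eLpNorm_transport (hS : MeasurableSet S) (hinv : ∀ t, MapsTo (φ t) S S) (t : ℝ)
    (g : ℝ → ℂ) :
    eLpNorm (φ.transport t g) 2 (volume.restrict S) = eLpNorm g 2 (volume.restrict S) := by
  rw [eLpNorm_eq_lintegral_rpow_enorm_toReal (by simp) (by simp),
    eLpNorm_eq_lintegral_rpow_enorm_toReal (by simp) (by simp)]
  congr 1
  rw [← lintegral_comp hS hinv t fun x => ‖g x‖ₑ ^ (2 : ℝ≥0∞).toReal]
  refine lintegral_congr fun x => ?_
  simp only [transport, enorm_mul, ENNReal.toReal_ofNat, ENNReal.rpow_ofNat, mul_pow]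
  congr 1
  rw [← ofReal_norm, Complex.norm_real, Real.norm_of_nonneg (Real.sqrt_nonneg _),
    ← ENNReal.ofReal_pow (Real.sqrt_nonneg _), Real.sq_sqrt (φ.deriv_pos t x).le]

theorem transport_add (s t : ℝ) (g : ℝ → ℂ) :
    φ.transport (s + t) g = φ.transport t (φ.transport s g) := by
  ext x
  simp only [transport]
  rw [φ.deriv_add, φ.toFlow.map_add, Real.sqrt_mul (φ.deriv_pos _ _).le]
  push_cast
  ring

theorem transport_zero (g : ℝ → ℂ) : φ.transport 0 g = g := by
  ext x
  simp only [transport]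
  rw [φ.deriv_zero, φ.toFlow.map_zero_apply]
  simp

theorem continuous_transport {g : ℝ → ℂ} (hg : Continuous g) :
    Continuous fun p : ℝ × ℝ => φ.transport p.1 g p.2 :=
  (Complex.continuous_ofReal.comp (Real.continuous_sqrt.comp φ.continuous_deriv)).mul
    (hg.comp φ.continuous_uncurry)

theorem aestronglyMeasurable_transport (hS : MeasurableSet S) (hinv : ∀ t, MapsTo (φ t) S S)
    (t : ℝ) {g : ℝ → ℂ} (hg : AEStronglyMeasurable g (volume.restrict S)) :
    AEStronglyMeasurable (φ.transport t g) (volume.restrict S) := by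
  refine AEStronglyMeasurable.mul ?_ (hg.comp_quasiMeasurePreserving (quasiMeasurePreserving hS hinv t))
  refine Continuous.aestronglyMeasurable ?_
  exact Complex.continuous_ofReal.comp (Real.continuous_sqrt.comp
    (φ.continuous_deriv.comp (by fun_prop : Continuous fun x : ℝ => (t, x))))

theorem transport_ae_congr (hS : MeasurableSet S) (hinv : ∀ t, MapsTo (φ t) S S)
    (t : ℝ) {g h : ℝ → ℂ} (hgh : g =ᵐ[volume.restrict S] h) :
    φ.transport t g =ᵐ[volume.restrict S] φ.transport t h := by
  filter_upwards [(quasiMeasurePreserving hS hinv t).ae_eq_comp hgh] with x hx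
  simp only [transport]
  congr 1

theorem memLp_transport (hS : MeasurableSet S) (hinv : ∀ t, MapsTo (φ t) S S)
    (t : ℝ) {g : ℝ → ℂ} (hg : MemLp g 2 (volume.restrict S)) :
    MemLp (φ.transport t g) 2 (volume.restrict S) :=
  ⟨aestronglyMeasurable_transport hS hinv t hg.1, by
    rw [eLpNorm_transport hS hinv]
    exact hg.2⟩

def transportLp (hS : MeasurableSet S) (hinv : ∀ t, MapsTo (φ t) S S) (t : ℝ)
    (ξ : Lp ℂ 2 (volume.restrict S)) : Lp ℂ 2 (volume.restrict S) :=
  (memLp_transport hS hinv t (Lp.memLp ξ)).toLp _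

theorem coeFn_transportLp (hS : MeasurableSet S) (hinv : ∀ t, MapsTo (φ t) S S) (t : ℝ)
    (ξ : Lp ℂ 2 (volume.restrict S)) :
    transportLp hS hinv t ξ =ᵐ[volume.restrict S] φ.transport t ξ :=
  MemLp.coeFn_toLp _

theorem transportLp_add (hS : MeasurableSet S) (hinv : ∀ t, MapsTo (φ t) S S) (s t : ℝ)
    (ξ : Lp ℂ 2 (volume.restrict S)) :
    transportLp hS hinv (s + t) ξ = transportLp hS hinv t (transportLp hS hinv s ξ) := by
  apply Lp.ext
  refine (coeFn_transportLp hS hinv _ ξ).trans ?_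
  rw [transport_add]
  exact (transport_ae_congr hS hinv t (coeFn_transportLp hS hinv s ξ).symm).trans
    (coeFn_transportLp hS hinv t _).symm

theorem transportLp_zero (hS : MeasurableSet S) (hinv : ∀ t, MapsTo (φ t) S S)
    (ξ : Lp ℂ 2 (volume.restrict S)) : transportLp hS hinv 0 ξ = ξ := by
  apply Lp.ext
  refine (coeFn_transportLp hS hinv _ ξ).trans ?_
  rw [transport_zero]

/-- The unitary `(U_t ξ)(x) = φ_{-t}'(x)^{1/2} ξ(φ_{-t}(x))` on `L²(S)`, for `S` an invariant set. -/
def leafU (hS : MeasurableSet S) (hinv : ∀ t, MapsTo (φ t) S S) (t : ℝ) :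
    Lp ℂ 2 (volume.restrict S) ≃ₗᵢ[ℂ] Lp ℂ 2 (volume.restrict S) where
  toFun := transportLp hS hinv (-t)
  invFun := transportLp hS hinv t
  left_inv ξ := by rw [← transportLp_add, neg_add_cancel, transportLp_zero]
  right_inv ξ := by rw [← transportLp_add, add_neg_cancel, transportLp_zero]
  map_add' ξ η := by
    apply Lp.ext
    filter_upwards [coeFn_transportLp hS hinv (-t) (ξ + η), coeFn_transportLp hS hinv (-t) ξ,
      coeFn_transportLp hS hinv (-t) η, transport_ae_congr hS hinv (-t) (Lp.coeFn_add ξ η),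
      Lp.coeFn_add (transportLp hS hinv (-t) ξ) (transportLp hS hinv (-t) η)] with x h1 h2 h3 h4 h5
    rw [h1, h4, h5, Pi.add_apply, h2, h3]
    simp only [transport, Pi.add_apply, mul_add]
  map_smul' c ξ := by
    apply Lp.ext
    filter_upwards [coeFn_transportLp hS hinv (-t) (c • ξ), coeFn_transportLp hS hinv (-t) ξ,
      transport_ae_congr hS hinv (-t) (Lp.coeFn_smul c ξ),
      Lp.coeFn_smul c (transportLp hS hinv (-t) ξ)] with x h1 h2 h3 h4
    rw [h1, h3, RingHom.id_apply, h4, Pi.smul_apply, h2]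
    simp only [transport, Pi.smul_apply, smul_eq_mul]
    ring
  norm_map' ξ := by
    change ‖transportLp hS hinv (-t) ξ‖ = ‖ξ‖
    rw [transportLp, Lp.norm_toLp, eLpNorm_transport hS hinv, Lp.norm_def]

theorem coeFn_leafU (hS : MeasurableSet S) (hinv : ∀ t, MapsTo (φ t) S S) (t : ℝ)
    (ξ : Lp ℂ 2 (volume.restrict S)) :
    leafU hS hinv t ξ =ᵐ[volume.restrict S]
      fun x => (Real.sqrt (deriv (φ (-t)) x) : ℂ) * ξ (φ (-t) x) :=
  coeFn_transportLp hS hinv (-t) ξ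

theorem coeFn_leafU_symm (hS : MeasurableSet S) (hinv : ∀ t, MapsTo (φ t) S S) (t : ℝ)
    (ξ : Lp ℂ 2 (volume.restrict S)) :
    (leafU hS hinv t).symm ξ =ᵐ[volume.restrict S] φ.transport t ξ :=
  coeFn_transportLp hS hinv t ξ

end OriginFlow

theorem aestronglyMeasurable_mul {S : Set ℝ} (f : C₀(ℝ, ℂ)) (ξ : Lp ℂ 2 (volume.restrict S)) :
    AEStronglyMeasurable (fun x => f x * ξ x) (volume.restrict S) :=
  f.continuous.aestronglyMeasurable.mul (Lp.aestronglyMeasurable ξ)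

theorem norm_apply_le (f : C₀(ℝ, ℂ)) (x : ℝ) : ‖f x‖ ≤ ‖f‖ := by
  rw [← ZeroAtInftyContinuousMap.norm_toBCF_eq_norm]
  exact f.toBCF.norm_coe_le_norm x

theorem memLp_mul {S : Set ℝ} (f : C₀(ℝ, ℂ)) (ξ : Lp ℂ 2 (volume.restrict S)) :
    MemLp (fun x => f x * ξ x) 2 (volume.restrict S) :=
  (Lp.memLp ξ).of_le_mul (aestronglyMeasurable_mul f ξ) (ae_of_all _ fun x => by
    rw [norm_mul]
    exact mul_le_mul_of_nonneg_right (norm_apply_le f x) (norm_nonneg _))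

/-- Multiplication by `f` on `L²(S)`. -/
def mulOp (S : Set ℝ) (f : C₀(ℝ, ℂ)) :
    Lp ℂ 2 (volume.restrict S) →L[ℂ] Lp ℂ 2 (volume.restrict S) :=
  LinearMap.mkContinuous
    { toFun := fun ξ => (memLp_mul f ξ).toLp _
      map_add' := fun ξ η => by
        apply Lp.ext
        filter_upwards [(memLp_mul f (ξ + η)).coeFn_toLp, (memLp_mul f ξ).coeFn_toLp,
          (memLp_mul f η).coeFn_toLp, Lp.coeFn_add ξ η,
          Lp.coeFn_add ((memLp_mul f ξ).toLp _) ((memLp_mul f η).toLp _)] with x h1 h2 h3 h4 h5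
        rw [h1, h5, Pi.add_apply, h2, h3, h4, Pi.add_apply, mul_add]
      map_smul' := fun c ξ => by
        apply Lp.ext
        filter_upwards [(memLp_mul f (c • ξ)).coeFn_toLp, (memLp_mul f ξ).coeFn_toLp,
          Lp.coeFn_smul c ξ, Lp.coeFn_smul c ((memLp_mul f ξ).toLp _)] with x h1 h2 h3 h4
        rw [h1, RingHom.id_apply, h4, Pi.smul_apply, h2, h3, Pi.smul_apply, smul_eq_mul,
          smul_eq_mul]
        ring }
    ‖f‖
    (fun ξ => by
      change ‖(memLp_mul f ξ).toLp _‖ ≤ _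
      refine Lp.norm_le_mul_norm_of_ae_le_mul ?_
      filter_upwards [(memLp_mul f ξ).coeFn_toLp] with x hx
      rw [hx, norm_mul]
      exact mul_le_mul_of_nonneg_right (norm_apply_le f x) (norm_nonneg _))

theorem coeFn_mulOp (S : Set ℝ) (f : C₀(ℝ, ℂ)) (ξ : Lp ℂ 2 (volume.restrict S)) :
    mulOp S f ξ =ᵐ[volume.restrict S] fun x => f x * ξ x :=
  (memLp_mul f ξ).coeFn_toLp

/-- The multiplication representation of `C₀(ℝ)` on `L²(S)`. -/
def mulRep (S : Set ℝ) : C₀(ℝ, ℂ) →⋆ₙₐ[ℂ]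
    (Lp ℂ 2 (volume.restrict S) →L[ℂ] Lp ℂ 2 (volume.restrict S)) where
  toFun := mulOp S
  map_smul' c f := by
    ext1 ξ
    apply Lp.ext
    filter_upwards [coeFn_mulOp S (c • f) ξ, coeFn_mulOp S f ξ, Lp.coeFn_smul c (mulOp S f ξ)]
      with x h1 h2 h3
    simp only [MonoidHom.id_apply, _root_.smul_apply]
    rw [h1, h3, Pi.smul_apply, h2, ZeroAtInftyContinuousMap.smul_apply, smul_eq_mul, smul_eq_mul,
      mul_assoc]
  map_zero' := by
    ext1 ξ
    apply Lp.ext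
    filter_upwards [coeFn_mulOp S 0 ξ, Lp.coeFn_zero ℂ 2 (volume.restrict S)] with x h1 h2
    rw [_root_.zero_apply, h1, h2]
    simp
  map_add' f g := by
    ext1 ξ
    apply Lp.ext
    filter_upwards [coeFn_mulOp S (f + g) ξ, coeFn_mulOp S f ξ, coeFn_mulOp S g ξ,
      Lp.coeFn_add (mulOp S f ξ) (mulOp S g ξ)] with x h1 h2 h3 h4
    rw [_root_.add_apply, h1, h4, Pi.add_apply, h2, h3,
      ZeroAtInftyContinuousMap.add_apply, add_mul]
  map_mul' f g := by
    ext1 ξ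
    apply Lp.ext
    filter_upwards [coeFn_mulOp S (f * g) ξ, coeFn_mulOp S f (mulOp S g ξ), coeFn_mulOp S g ξ]
      with x h1 h2 h3
    rw [_root_.mul_apply_eq_comp, h1, h2, h3, ZeroAtInftyContinuousMap.mul_apply, mul_assoc]
  map_star' f := by
    rw [ContinuousLinearMap.star_eq_adjoint, ContinuousLinearMap.eq_adjoint_iff]
    intro ξ η
    rw [L2.inner_def, L2.inner_def]
    refine integral_congr_ae ?_
    filter_upwards [coeFn_mulOp S (star f) ξ, coeFn_mulOp S f η] with x h1 h2
    rw [h1, h2]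
    simp [mul_comm, mul_left_comm]

namespace OriginFlow

variable {S : Set ℝ}

theorem tendsto_transport (t₀ : ℝ) {g : ℝ → ℂ} (hg : Continuous g) (hgc : HasCompactSupport g) :
    Tendsto (fun t => eLpNorm (φ.transport (-t) g - φ.transport (-t₀) g) 2 (volume.restrict S))
      (𝓝 t₀) (𝓝 0) := by
  have hc : Continuous fun p : ℝ × ℝ => φ.transport (-p.1) g p.2 :=
    (continuous_transport (φ := φ) hg).comp
      (by fun_prop : Continuous fun p : ℝ × ℝ => (-p.1, p.2))
  set K : Set ℝ := (fun p : ℝ × ℝ => φ p.1 p.2) '' (Icc (t₀ - 1) (t₀ + 1) ×ˢ tsupport g) with hK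
  have hKc : IsCompact K := (isCompact_Icc.prod hgc.isCompact).image φ.continuous_uncurry
  have hout : ∀ t ∈ Icc (t₀ - 1) (t₀ + 1), ∀ x ∉ K, φ.transport (-t) g x = 0 := by
    intro t ht x hx
    have hx' : φ (-t) x ∉ tsupport g := fun h =>
      hx ⟨(t, φ (-t) x), ⟨ht, h⟩, φ.apply_neg_apply t x⟩
    simp [transport, image_eq_zero_of_notMem_tsupport hx']
  have ht₀ : t₀ ∈ Icc (t₀ - 1) (t₀ + 1) := by constructor <;> linarith
  obtain ⟨C, hC⟩ := ((isCompact_Icc (a := t₀ - 1) (b := t₀ + 1)).prod hKc).exists_bound_of_continuousOn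
    hc.continuousOn
  have hnhds : ∀ᶠ t in 𝓝 t₀, t ∈ Icc (t₀ - 1) (t₀ + 1) :=
    Icc_mem_nhds (by linarith) (by linarith)
  have hmain : Tendsto (fun t => ∫⁻ x in S, ‖φ.transport (-t) g x - φ.transport (-t₀) g x‖ₑ ^ (2 : ℝ))
      (𝓝 t₀) (𝓝 (∫⁻ _ in S, 0)) := by
    refine tendsto_lintegral_filter_of_dominated_convergence
      (K.indicator fun _ => ENNReal.ofReal (C + C) ^ (2 : ℝ)) ?_ ?_ ?_ ?_
    · refine Eventually.of_forall fun t => ?_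
      have h1 : ∀ s, Continuous (φ.transport (-s) g) := fun s =>
        hc.comp (by fun_prop : Continuous fun x : ℝ => (s, x))
      exact (((h1 t).sub (h1 t₀)).measurable.enorm).pow_const _
    · filter_upwards [hnhds] with t ht
      refine ae_of_all _ fun x => ?_
      by_cases hx : x ∈ K
      · rw [indicator_of_mem hx]
        refine ENNReal.rpow_le_rpow ?_ (by norm_num)
        rw [← ofReal_norm]
        exact ENNReal.ofReal_le_ofReal ((norm_sub_le _ _).trans
          (add_le_add (hC (t, x) ⟨ht, hx⟩) (hC (t₀, x) ⟨ht₀, hx⟩)))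
      · simp [hout t ht x hx, hout t₀ ht₀ x hx]
    · rw [lintegral_indicator_const hKc.measurableSet]
      exact ENNReal.mul_ne_top (ENNReal.rpow_ne_top_of_nonneg (by norm_num) ENNReal.ofReal_ne_top)
        ((Measure.restrict_apply_le _ _).trans_lt hKc.measure_lt_top).ne
    · refine ae_of_all _ fun x => ?_
      have h1 : Continuous fun t => ‖φ.transport (-t) g x - φ.transport (-t₀) g x‖ₑ ^ (2 : ℝ) :=
        ENNReal.continuous_rpow_const.comp ((((hc.comp
          (by fun_prop : Continuous fun t : ℝ => (t, x)))).sub continuous_const).enorm)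
      have h2 := h1.tendsto t₀
      simpa using h2
  have hroot := (ENNReal.continuous_rpow_const (y := 1 / 2)).tendsto _ |>.comp hmain
  simp only [lintegral_zero] at hroot
  rw [ENNReal.zero_rpow_of_pos (by norm_num)] at hroot
  refine hroot.congr fun t => ?_
  rw [eLpNorm_eq_lintegral_rpow_enorm_toReal (by simp) (by simp)]
  simp

theorem continuous_leafU (hS : MeasurableSet S) (hinv : ∀ t, MapsTo (φ t) S S)
    (ξ : Lp ℂ 2 (volume.restrict S)) : Continuous fun t => leafU hS hinv t ξ := by
  refine continuous_of_uniform_approx_of_continuous fun u hu => ?_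
  obtain ⟨ε, hε, hεu⟩ := Metric.mem_uniformity_dist.1 hu
  obtain ⟨g, hgc, hgε, hg, hgL⟩ := (Lp.memLp ξ).exists_hasCompactSupport_eLpNorm_sub_le
    (by simp) (ε := ENNReal.ofReal (ε / 2)) (by simpa using hε)
  refine ⟨fun t => leafU hS hinv t (hgL.toLp g), ?_, fun t => hεu ?_⟩
  · refine continuous_iff_continuousAt.2 fun t₀ => ?_
    rw [ContinuousAt, Lp.tendsto_Lp_iff_tendsto_eLpNorm']
    refine (tendsto_transport (S := S) (φ := φ) t₀ hg hgc).congr fun t => ?_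
    refine eLpNorm_congr_ae ?_
    have h : ∀ s, leafU hS hinv s (hgL.toLp g) =ᵐ[volume.restrict S] φ.transport (-s) g := fun s =>
      (coeFn_leafU hS hinv s _).trans (transport_ae_congr hS hinv (-s) hgL.coeFn_toLp)
    exact ((h t).sub (h t₀)).symm
  · rw [LinearIsometryEquiv.dist_map, dist_eq_norm]
    have h1 : ‖ξ - hgL.toLp g‖ ≤ ε / 2 := by
      rw [Lp.norm_def]
      refine ENNReal.toReal_le_of_le_ofReal (by linarith) (le_trans (le_of_eq ?_) hgε)
      refine eLpNorm_congr_ae ((Lp.coeFn_sub _ _).trans ?_)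
      exact (EventuallyEq.refl _ _).sub hgL.coeFn_toLp
    linarith

theorem leafU_covariant (hS : MeasurableSet S) (hinv : ∀ t, MapsTo (φ t) S S) (t : ℝ)
    (f : C₀(ℝ, ℂ)) (ξ : Lp ℂ 2 (volume.restrict S)) :
    leafU hS hinv t (mulRep S f ((leafU hS hinv t).symm ξ)) = mulRep S (φ.act t f) ξ := by
  have key : mulRep S f ((leafU hS hinv t).symm ξ) =
      (leafU hS hinv t).symm (mulRep S (φ.act t f) ξ) := by
    apply Lp.ext
    filter_upwards [coeFn_mulOp S f ((leafU hS hinv t).symm ξ), coeFn_leafU_symm hS hinv t ξ,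
      coeFn_leafU_symm hS hinv t (mulRep S (φ.act t f) ξ),
      transport_ae_congr hS hinv t (coeFn_mulOp S (φ.act t f) ξ)] with x h1 h2 h3 h4
    change mulOp S f _ x = _
    rw [h1, h2, h3]
    change _ = φ.transport t (mulOp S (φ.act t f) ξ) x
    rw [h4]
    simp only [transport, act_apply, neg_apply_apply]
    ring
  rw [key, LinearIsometryEquiv.apply_symm_apply]

/-- The covariant pair `(M, U)` on `L²(S)`, for `S` an invariant set. -/
def leafPair (hS : MeasurableSet S) (hinv : ∀ t, MapsTo (φ t) S S) :
    CovariantPair φ (Lp ℂ 2 (volume.restrict S)) where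
  rep := mulRep S
  U := leafU hS hinv
  U_add s t ξ := by
    change transportLp hS hinv (-(s + t)) ξ =
      transportLp hS hinv (-s) (transportLp hS hinv (-t) ξ)
    rw [← transportLp_add]
    congr 1
    ring
  U_cont := continuous_leafU hS hinv
  covariant := leafU_covariant hS hinv

end OriginFlow

/-- The Hilbert space `L²(ℝ₋) ⊕ L²(ℝ₊)`, where `ℝ₋ = (-∞, 0)` and `ℝ₊ = (0, ∞)`. -/
abbrev HalfLines : Type :=
  WithLp 2 (Lp ℂ 2 (volume.restrict (Iio (0 : ℝ))) × Lp ℂ 2 (volume.restrict (Ioi (0 : ℝ))))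

/-- The covariant pair `(M, U)` on `L²(ℝ₋) ⊕ L²(ℝ₊)`. -/
def canonicalPair (φ : OriginFlow) : CovariantPair φ HalfLines :=
  (OriginFlow.leafPair measurableSet_Iio φ.mapsTo_Iio).directSum
    (OriginFlow.leafPair measurableSet_Ioi φ.mapsTo_Ioi)

/-- The canonical representation on `L²(ℝ₋) ⊕ L²(ℝ₊)`. -/
def canonicalRep (φ : OriginFlow) : crossedProduct φ →⋆ₙₐ[ℂ] (HalfLines →L[ℂ] HalfLines) :=
  (canonicalPair φ).toHom

/-- The image of the canonical representation. -/
def imageAlgebra (φ : OriginFlow) : NonUnitalStarSubalgebra ℂ (HalfLines →L[ℂ] HalfLines) :=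
  NonUnitalStarAlgHom.range (canonicalRep φ)

/-- `K(L²(ℝ₋)) ⊕ K(L²(ℝ₊))`, as operators on `L²(ℝ₋) ⊕ L²(ℝ₊)`. -/
def compactSum : Set (HalfLines →L[ℂ] HalfLines) :=
  {R | ∃ (S : Lp ℂ 2 (volume.restrict (Iio (0 : ℝ))) →L[ℂ] Lp ℂ 2 (volume.restrict (Iio (0 : ℝ))))
      (T : Lp ℂ 2 (volume.restrict (Ioi (0 : ℝ))) →L[ℂ] Lp ℂ 2 (volume.restrict (Ioi (0 : ℝ)))),
    IsCompactOperator S ∧ IsCompactOperator T ∧ R = opSum S T}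

end OrderFoliation
end

open OrderFoliation

/-! On each open half line a generator does not vanish, so the half line is a single free orbit of
its flow. In the crossed product, functions vanishing at the origin therefore contribute compact
operators, and all of `compactSum` arises this way. What remains of an element `F` is its
restriction `t ↦ F t 0` to the fixed point, which acts as the operator `∫ F t 0 • U t`. The orders
`k` and `l` have to be told apart through these operators.

Let `k < l`, with `φ` the flow of order `k` and `ψ` that of order `l`. Conjugate by the unitaries of
`φ` along times that push the half line into the origin. The coefficient functions become constants,
equal to their values at `0`. The unitaries of `φ` are unchanged, since they commute with each
other. The unitaries of `ψ` tend strongly to the identity: in the time coordinate of `φ` the field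
`Y` has speed `Y / X`, which tends to `0` at the origin. So an integrated form for `φ` tends to its
translation operator, one for `ψ` tends to a scalar, and the distance between the limits is at most
the distance between the original operators (`norm_translation_sub_le`).

A translation operator can be close to a scalar only if both are small. It is almost unchanged by `U
s` for small `s`, whereas `U s` carries some nonzero vector to an orthogonal one
(`norm_le_of_translation_sub_le`). Together these give `norm_translation_le`, the estimate that
carries the theorem: the operator of `F` at the origin is bounded by three times the distance from
the form of `F` to any form for `ψ`.

Elements of the intersection are thus approximated by forms with small part at the origin;
subtracting that part leaves an element of `compactSum` (`isCompactOperator_integratedForm`), which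
is closed. For the reverse inclusion, rank one operators are written as integrated forms
(`integratedForm_rankOneKernel`). The algebras differ because some translation operator is nonzero.
All of this works with norm limits of integrated forms, which is legitimate because the range of a
`*`-homomorphism is closed (`coe_imageAlgebra`). -/

noncomputable section

namespace OrderFoliation

/-! ### Closed range of `*`-homomorphisms of C*-algebras -/

section ClosedRange

variable {A B : Type*} [NonUnitalCStarAlgebra A] [NonUnitalCStarAlgebra B]

/-- Self-adjoint elements of the range of a `*`-homomorphism of C*-algebras lift without increasing
the norm. -/
theorem exists_lift_of_isSelfAdjoint (f : A →⋆ₙₐ[ℂ] B) {a : A} (h : IsSelfAdjoint (f a)) :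
    ∃ a', f a' = f a ∧ ‖a'‖ ≤ ‖f a‖ := by
  set r := ‖f a‖ with hr
  have hr0 : 0 ≤ r := norm_nonneg _
  -- Clamping to `[-r, r]` bounds the norm of the lift, and it is the identity on the quasispectrum
  -- of `f a`, so the image does not change.
  let c : ℝ → ℝ := fun x => max (-r) (min r x)
  have hc : Continuous c := by fun_prop
  have hc0 : c 0 = 0 := by simp [c, hr0]
  set a₀ : A := (1 / 2 : ℂ) • (a + star a) with ha₀
  have hsa : IsSelfAdjoint a₀ := by
    rw [IsSelfAdjoint, ha₀, star_smul, star_add, star_star, add_comm]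
    simp
  have hfa : f a₀ = f a := by
    rw [ha₀, map_smul, map_add, map_star, h.star_eq, ← two_smul ℂ (f a), smul_smul]
    norm_num
  refine ⟨cfcₙ c a₀, ?_, ?_⟩
  · have hf : Continuous f := AddMonoidHomClass.continuous_of_bound f 1 fun a => by
      rw [one_mul]
      exact NonUnitalStarAlgHom.norm_apply_le f a
    have hsa' : IsSelfAdjoint (f a₀) := hfa ▸ h
    rw [NonUnitalStarAlgHom.map_cfcₙ f c a₀ hc.continuousOn hc0 hf hsa hsa', hfa]
    conv_rhs => rw [← cfcₙ_id ℝ (f a) h]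
    refine cfcₙ_congr fun x hx => ?_
    have hx' : |x| ≤ r := by
      simpa using NonUnitalIsometricContinuousFunctionalCalculus.norm_quasispectrum_le (f a) hx h
    rw [abs_le] at hx'
    simp [c, hx'.1, hx'.2]
  · refine norm_cfcₙ_le fun x _ => ?_
    rw [Real.norm_eq_abs, abs_le]
    exact ⟨le_max_left _ _, max_le (by linarith) (min_le_left _ _)⟩

/-- The real and imaginary parts of `f a` have norm at most `‖f a‖` and are lifted separately; this
costs the factor `2`. Any uniform constant suffices for closedness of the range. -/
theorem exists_lift_norm_le (f : A →⋆ₙₐ[ℂ] B) (a : A) : ∃ a', f a' = f a ∧ ‖a'‖ ≤ 2 * ‖f a‖ := by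
  have key : ∀ c : A, ‖f c‖ ≤ ‖f a‖ → IsSelfAdjoint (f c) → ∃ c', f c' = f c ∧ ‖c'‖ ≤ ‖f a‖ :=
    fun c hc hs => by
      obtain ⟨c', h1, h2⟩ := exists_lift_of_isSelfAdjoint f hs
      exact ⟨c', h1, h2.trans hc⟩
  have hre := realPart_add_I_smul_imaginaryPart (f a)
  have h1 : f ((1 / 2 : ℂ) • (a + star a)) = (1 / 2 : ℂ) • (f a + star (f a)) := by
    simp [map_smul, map_star]
  have h2 : f ((1 / 2 : ℂ) • (-Complex.I) • (a - star a)) =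
      (1 / 2 : ℂ) • (-Complex.I) • (f a - star (f a)) := by
    rw [map_smul, map_smul, map_sub, map_star]
  obtain ⟨u, hu, hun⟩ := key ((1 / 2 : ℂ) • (a + star a)) (by
      rw [h1, norm_smul]
      have := norm_add_le (f a) (star (f a))
      rw [norm_star] at this
      norm_num
      linarith) (by
      rw [h1, IsSelfAdjoint, star_smul, star_add, star_star, add_comm]
      simp)
  obtain ⟨v, hv, hvn⟩ := key ((1 / 2 : ℂ) • (-Complex.I) • (a - star a)) (by
      rw [h2, norm_smul, norm_smul]
      have := norm_sub_le (f a) (star (f a))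
      rw [norm_star] at this
      norm_num
      linarith) (by
      rw [h2, IsSelfAdjoint, star_smul, star_smul, star_sub, star_star]
      simp only [RCLike.star_def, map_neg, Complex.conj_I, neg_neg, map_div₀, map_one, map_ofNat]
      rw [← neg_sub (f a), smul_neg, neg_smul])
  refine ⟨u + Complex.I • v, ?_, ?_⟩
  · rw [map_add, map_smul, hu, hv, h1, h2, smul_comm Complex.I, smul_smul Complex.I, mul_neg,
      Complex.I_mul_I, neg_neg, one_smul, ← smul_add, add_add_sub_cancel, ← two_smul ℂ (f a),
      smul_smul]
    norm_num
  · refine (norm_add_le _ _).trans ?_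
    rw [norm_smul, Complex.norm_I, one_mul]
    linarith

/-- The range of a `*`-homomorphism of C*-algebras is closed. -/
theorem isClosed_range_starHom (f : A →⋆ₙₐ[ℂ] B) : IsClosed (Set.range f) := by
  let g : NormedAddGroupHom A B :=
    { toFun := f
      map_add' := map_add f
      bound' := ⟨1, fun a => by
        rw [one_mul]
        exact NonUnitalStarAlgHom.norm_apply_le f a⟩ }
  have hs : g.SurjectiveOnWith g.range 2 := by
    rintro _ ⟨a, rfl⟩
    exact exists_lift_norm_le f a
  have h2 := controlled_closure_of_complete two_pos one_pos hs
  refine isClosed_of_closure_subset fun b hb => ?_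
  obtain ⟨a, ha, -⟩ := h2 b hb
  exact ⟨a, ha⟩

end ClosedRange

/-! ### Compact operators as limits of finite rank operators -/

section Compact

variable {H : Type*} [NormedAddCommGroup H] [InnerProductSpace ℂ H] [CompleteSpace H]

open InnerProductSpace in
/-- A closed subspace of operators that contains the rank one operators given by a total set of
vectors contains all compact operators. -/
theorem mem_of_isCompactOperator {D : Set H} (hD : Dense (Submodule.span ℂ D : Set H))
    (M : Submodule ℂ (H →L[ℂ] H))
    (hM : IsClosed (M : Set (H →L[ℂ] H))) (hR : ∀ ξ ∈ D, ∀ η ∈ D, rankOne ℂ ξ η ∈ M)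
    {T : H →L[ℂ] H} (hT : IsCompactOperator T) : T ∈ M := by
  have hall : ∀ ξ η : H, rankOne ℂ ξ η ∈ M := by
    have hc : Continuous fun p : H × H => (rankOne ℂ p.1 p.2 : H →L[ℂ] H) :=
      ((ContinuousLinearMap.smulRightL ℂ H H).continuous.comp
        ((innerSL ℂ).continuous.comp continuous_snd)).clm_apply continuous_fst
    have h1 : ∀ ξ ∈ Submodule.span ℂ D, ∀ η ∈ D, rankOne ℂ ξ η ∈ M := by
      intro ξ hξ η hη
      induction hξ using Submodule.span_induction with
      | mem x hx => exact hR x hx η hη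
      | zero => simp
      | add x y _ _ hx hy => simpa using M.add_mem hx hy
      | smul c x _ hx => simpa using M.smul_mem c hx
    have h2 : ∀ ξ ∈ Submodule.span ℂ D, ∀ η ∈ Submodule.span ℂ D, rankOne ℂ ξ η ∈ M := by
      intro ξ hξ η hη
      induction hη using Submodule.span_induction with
      | mem x hx => exact h1 ξ hξ x hx
      | zero => simp
      | add x y _ _ hx hy => simpa using M.add_mem hx hy
      | smul c x _ hx => simpa using M.smul_mem (starRingEnd ℂ c) hx
    have hcl := (hM.preimage hc).closure_subset_iff.2
      (show (Submodule.span ℂ D : Set H) ×ˢ (Submodule.span ℂ D : Set H) ⊆ _ from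
        fun p hp => h2 p.1 hp.1 p.2 hp.2)
    intro ξ η
    exact hcl (by rw [(hD.prod hD).closure_eq]; trivial : (ξ, η) ∈ closure
      ((Submodule.span ℂ D : Set H) ×ˢ (Submodule.span ℂ D : Set H)))
  rw [← SetLike.mem_coe, ← hM.closure_eq, Metric.mem_closure_iff]
  intro ε hε
  obtain ⟨K, hK, hKs⟩ := hT.image_closedBall_subset_compact (𝕜₁ := ℂ) (f := (T : H →ₗ[ℂ] H)) 1
  obtain ⟨t, -, htf, ht⟩ := hK.finite_cover_balls (half_pos hε)
  let V : Submodule ℂ H := Submodule.span ℂ t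
  have : FiniteDimensional ℂ V := FiniteDimensional.span_of_finite ℂ htf
  let b := stdOrthonormalBasis ℂ V
  -- The orthogonal projection onto the span of a finite `ε / 2`-net of a compact set containing the
  -- image of the unit ball. Then `P ∘L T` has finite rank, and on unit vectors it is within `ε / 2`
  -- of `T`, since the projection is the nearest point of `V`.
  let P : H →L[ℂ] H := ∑ i, rankOne ℂ (b i : H) (b i : H)
  have hP : ∀ x, P x = V.starProjection x := fun x => by
    rw [b.starProjection_eq_sum_rankOne]
  refine ⟨P ∘L T, ?_, ?_⟩
  · have : P ∘L T = ∑ i, rankOne ℂ (b i : H) (ContinuousLinearMap.adjoint T (b i : H)) := by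
      ext x
      simp [P, ContinuousLinearMap.adjoint_inner_left]
    rw [this]
    exact M.sum_mem fun i _ => hall _ _
  · rw [dist_eq_norm]
    refine lt_of_le_of_lt (ContinuousLinearMap.opNorm_le_of_unit_norm (half_pos hε).le ?_)
      (half_lt_self hε)
    intro x hx
    have hTx : T x ∈ K := hKs ⟨x, by simp [hx], rfl⟩
    obtain ⟨y, hy, hyT⟩ := mem_iUnion₂.1 (ht hTx)
    rw [_root_.sub_apply, ContinuousLinearMap.comp_apply, hP, V.starProjection_minimal]
    refine (ciInf_le ⟨0, ?_⟩ (⟨y, Submodule.subset_span hy⟩ : V)).trans ?_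
    · rintro _ ⟨v, rfl⟩
      exact norm_nonneg _
    · rw [← dist_eq_norm]
      exact (Metric.mem_ball.1 hyT).le

end Compact

theorem isCompactOperator_rankOne {H : Type*} [NormedAddCommGroup H] [InnerProductSpace ℂ H]
    (ξ η : H) :
    IsCompactOperator (InnerProductSpace.rankOne ℂ ξ η) := by
  have h : IsCompactOperator (ContinuousLinearMap.toSpanSingleton ℂ ξ) :=
    isCompactOperator_of_locallyCompactSpace_rng _
  exact h.comp_clm (innerSL ℂ η)

/-! ### Block diagonal operators -/

section DirectSumOperators

variable {H₁ H₂ : Type} [NormedAddCommGroup H₁] [NormedAddCommGroup H₂]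

theorem norm_toLp_fst (u : H₁) : ‖(WithLp.toLp 2 (u, 0) : WithLp 2 (H₁ × H₂))‖ = ‖u‖ := by
  simp

theorem norm_toLp_snd (v : H₂) : ‖(WithLp.toLp 2 (0, v) : WithLp 2 (H₁ × H₂))‖ = ‖v‖ := by
  simp

theorem norm_fst_le_withLp (ξ : WithLp 2 (H₁ × H₂)) : ‖ξ.fst‖ ≤ ‖ξ‖ := by
  rw [WithLp.prod_norm_eq_of_L2]
  exact Real.le_sqrt_of_sq_le (by nlinarith [sq_nonneg ‖ξ.snd‖])

theorem norm_snd_le_withLp (ξ : WithLp 2 (H₁ × H₂)) : ‖ξ.snd‖ ≤ ‖ξ‖ := by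
  rw [WithLp.prod_norm_eq_of_L2]
  exact Real.le_sqrt_of_sq_le (by nlinarith [sq_nonneg ‖ξ.fst‖])

variable [InnerProductSpace ℂ H₁] [InnerProductSpace ℂ H₂]

theorem norm_le_opSum_left (S : H₁ →L[ℂ] H₁) (T : H₂ →L[ℂ] H₂) : ‖S‖ ≤ ‖opSum S T‖ := by
  refine S.opNorm_le_bound (opSum S T).opNorm_nonneg fun u => ?_
  have h := (opSum S T).le_opNorm (WithLp.toLp 2 (u, 0))
  rw [norm_toLp_fst] at h
  exact (norm_fst_le_withLp (opSum S T (WithLp.toLp 2 (u, 0)))).trans h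

theorem norm_le_opSum_right (S : H₁ →L[ℂ] H₁) (T : H₂ →L[ℂ] H₂) : ‖T‖ ≤ ‖opSum S T‖ := by
  refine T.opNorm_le_bound (opSum S T).opNorm_nonneg fun v => ?_
  have h := (opSum S T).le_opNorm (WithLp.toLp 2 (0, v))
  rw [norm_toLp_snd] at h
  exact (norm_snd_le_withLp (opSum S T (WithLp.toLp 2 (0, v)))).trans h

theorem norm_opSum_le (S : H₁ →L[ℂ] H₁) (T : H₂ →L[ℂ] H₂) : ‖opSum S T‖ ≤ ‖S‖ + ‖T‖ := by
  refine ContinuousLinearMap.opNorm_le_bound _ (by positivity) fun ξ => ?_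
  have h : opSum S T ξ = WithLp.toLp 2 (S ξ.fst, 0) + WithLp.toLp 2 (0, T ξ.snd) := by
    rw [opSum_apply, ← WithLp.toLp_add]
    simp
  rw [h]
  refine (norm_add_le _ _).trans ?_
  rw [norm_toLp_fst, norm_toLp_snd, add_mul]
  gcongr
  · exact (S.le_opNorm _).trans (by gcongr; exact norm_fst_le_withLp ξ)
  · exact (T.le_opNorm _).trans (by gcongr; exact norm_snd_le_withLp ξ)

theorem opSum_sub_opSum (S S' : H₁ →L[ℂ] H₁) (T T' : H₂ →L[ℂ] H₂) :
    opSum S T - opSum S' T' = opSum (S - S') (T - T') :=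
  ContinuousLinearMap.ext fun _ => rfl

/-- The map `(S, T) ↦ S ⊕ T`. -/
def opSumL (H₁ H₂ : Type) [NormedAddCommGroup H₁] [InnerProductSpace ℂ H₁]
    [NormedAddCommGroup H₂] [InnerProductSpace ℂ H₂] :
    (H₁ →L[ℂ] H₁) × (H₂ →L[ℂ] H₂) →L[ℂ] (WithLp 2 (H₁ × H₂) →L[ℂ] WithLp 2 (H₁ × H₂)) :=
  LinearMap.mkContinuous (E := (H₁ →L[ℂ] H₁) × (H₂ →L[ℂ] H₂))
    (F := WithLp 2 (H₁ × H₂) →L[ℂ] WithLp 2 (H₁ × H₂)) (σ := RingHom.id ℂ)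
    { toFun := fun p => opSum p.1 p.2
      map_add' := fun p q => ContinuousLinearMap.ext fun ξ => rfl
      map_smul' := fun c p => ContinuousLinearMap.ext fun ξ => rfl }
    2 (fun p => by
      refine (norm_opSum_le p.1 p.2).trans ?_
      linarith [norm_fst_le p, norm_snd_le p])

theorem opSumL_apply (p : (H₁ →L[ℂ] H₁) × (H₂ →L[ℂ] H₂)) :
    opSumL H₁ H₂ p = opSum p.1 p.2 := rfl

theorem isClosedEmbedding_opSumL [CompleteSpace H₁] [CompleteSpace H₂] :
    IsClosedEmbedding (opSumL H₁ H₂) := by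
  refine AntilipschitzWith.isClosedEmbedding (K := 1) ?_ (opSumL H₁ H₂).uniformContinuous
  refine (opSumL H₁ H₂).antilipschitz_of_bound fun p => ?_
  rw [NNReal.coe_one, one_mul, Prod.norm_def]
  exact max_le (norm_le_opSum_left p.1 p.2) (norm_le_opSum_right p.1 p.2)

theorem isClosed_compactSum : IsClosed compactSum := by
  have h : compactSum = opSumL _ _ '' {p | IsCompactOperator p.1 ∧ IsCompactOperator p.2} := by
    ext R
    constructor
    · rintro ⟨S, T, hS, hT, rfl⟩
      exact ⟨(S, T), ⟨hS, hT⟩, rfl⟩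
    · rintro ⟨⟨S, T⟩, ⟨hS, hT⟩, rfl⟩
      exact ⟨S, T, hS, hT, rfl⟩
  rw [h]
  refine isClosedEmbedding_opSumL.isClosedMap _ ?_
  exact (isClosed_setOfPred_isCompactOperator.preimage continuous_fst).inter
    (isClosed_setOfPred_isCompactOperator.preimage continuous_snd)

end DirectSumOperators

/-! ### From pointwise to norm convergence in `L²` -/

/-- A sequence in `L²` that converges pointwise to a function of the same norm converges in norm. -/
theorem tendsto_of_ae_tendsto_of_norm_eq {α : Type*} [MeasurableSpace α] {μ : Measure α}
    {f : ℕ → Lp ℂ 2 μ} {g : Lp ℂ 2 μ}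
    (h : ∀ᵐ x ∂μ, Tendsto (fun n => f n x) atTop (𝓝 (g x))) (hn : ∀ n, ‖f n‖ = ‖g‖) :
    Tendsto f atTop (𝓝 g) := by
  have hL : ∀ u : Lp ℂ 2 μ, ∫⁻ x, ENNReal.ofReal (‖u x‖ ^ 2) ∂μ = ENNReal.ofReal (‖u‖ ^ 2) := by
    intro u
    have h1 := eLpNorm_nnreal_pow_eq_lintegral (f := u) (μ := μ) (p := 2) (by norm_num)
    rw [Lp.norm_def, ENNReal.ofReal_pow ENNReal.toReal_nonneg,
      ENNReal.ofReal_toReal (Lp.eLpNorm_ne_top u)]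
    simp only [NNReal.coe_ofNat, ENNReal.rpow_ofNat, ENNReal.coe_ofNat] at h1
    rw [h1]
    refine lintegral_congr fun x => ?_
    rw [ENNReal.ofReal_pow (norm_nonneg _), ofReal_norm]
  have hm : ∀ u : Lp ℂ 2 μ, Measurable fun x => ENNReal.ofReal (‖u x‖ ^ 2) := fun u =>
    ((Lp.stronglyMeasurable u).measurable.norm.pow_const 2).ennreal_ofReal
  -- By the parallelogram inequality the real expression is nonnegative, so `ENNReal.ofReal` loses
  -- nothing. Fatou's lemma applied to `b n`, whose integral is `4 * ‖g‖ ^ 2 - ‖f n - g‖ ^ 2`,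
  -- forces `‖f n - g‖` to `0`.
  set b : ℕ → α → ℝ≥0∞ := fun n x =>
    ENNReal.ofReal (2 * ‖f n x‖ ^ 2 + 2 * ‖g x‖ ^ 2 - ‖f n x - g x‖ ^ 2) with hb
  have hbm : ∀ n, Measurable (b n) := fun n => by
    have h1 := (Lp.stronglyMeasurable (f n)).measurable
    have h2 := (Lp.stronglyMeasurable g).measurable
    fun_prop
  have hsum : ∀ n, (∫⁻ x, b n x ∂μ) + ENNReal.ofReal (‖f n - g‖ ^ 2) =
      ENNReal.ofReal (4 * ‖g‖ ^ 2) := by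
    intro n
    rw [← hL, ← lintegral_add_left (hbm n)]
    have h4 : ENNReal.ofReal (4 * ‖g‖ ^ 2) =
        ∫⁻ x, (2 * ENNReal.ofReal (‖f n x‖ ^ 2) + 2 * ENNReal.ofReal (‖g x‖ ^ 2)) ∂μ := by
      rw [lintegral_add_left ((hm _).const_mul 2), lintegral_const_mul _ (hm _),
        lintegral_const_mul _ (hm _), hL, hL, hn n, ← two_mul, ← mul_assoc,
        ENNReal.ofReal_mul (by norm_num)]
      norm_num
    rw [h4]
    refine lintegral_congr_ae ?_
    filter_upwards [Lp.coeFn_sub (f n) g] with x hx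
    have hle : ‖f n x - g x‖ ^ 2 ≤ 2 * ‖f n x‖ ^ 2 + 2 * ‖g x‖ ^ 2 := by
      have := norm_sub_le (f n x) (g x)
      nlinarith [norm_nonneg (f n x - g x), sq_nonneg (‖f n x‖ - ‖g x‖)]
    rw [hx, Pi.sub_apply, hb, ← ENNReal.ofReal_add (by linarith) (by positivity), sub_add_cancel,
      ENNReal.ofReal_add (by positivity) (by positivity), ENNReal.ofReal_mul (by norm_num),
      ENNReal.ofReal_mul (by norm_num)]
    norm_num
  have hfatou : ENNReal.ofReal (4 * ‖g‖ ^ 2) ≤ liminf (fun n => ∫⁻ x, b n x ∂μ) atTop := by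
    refine le_trans (le_of_eq ?_) (lintegral_liminf_le hbm)
    rw [ENNReal.ofReal_mul (by norm_num), ← hL, ← lintegral_const_mul _ (hm _)]
    refine lintegral_congr_ae ?_
    filter_upwards [h] with x hx
    have h1 : Tendsto (fun n => b n x) atTop
        (𝓝 (ENNReal.ofReal (2 * ‖g x‖ ^ 2 + 2 * ‖g x‖ ^ 2 - ‖g x - g x‖ ^ 2))) :=
      ENNReal.tendsto_ofReal ((((hx.norm.pow 2).const_mul 2).add_const _).sub
        ((hx.sub_const _).norm.pow 2))
    rw [h1.liminf_eq, ← ENNReal.ofReal_mul (by norm_num)]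
    congr 1
    simp
    ring
  rw [Metric.tendsto_atTop]
  intro ε hε
  -- The strict inequality for truncated subtraction below needs `4 * ‖g‖ ^ 2` to be positive.
  by_cases hg : ‖g‖ = 0
  · refine ⟨0, fun n _ => ?_⟩
    have h1 : ‖f n‖ = 0 := (hn n).trans hg
    rw [norm_eq_zero.1 h1, norm_eq_zero.1 hg, dist_self]
    exact hε
  have hlt : ENNReal.ofReal (4 * ‖g‖ ^ 2) - ENNReal.ofReal (ε ^ 2) <
      liminf (fun n => ∫⁻ x, b n x ∂μ) atTop := by
    refine lt_of_lt_of_le (ENNReal.sub_lt_self ENNReal.ofReal_ne_top ?_ ?_) hfatou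
    · exact (ENNReal.ofReal_pos.2 (by positivity)).ne'
    · exact (ENNReal.ofReal_pos.2 (by positivity)).ne'
  obtain ⟨N, hN⟩ := eventually_atTop.1 (eventually_lt_of_lt_liminf hlt)
  refine ⟨N, fun n hnN => ?_⟩
  have h1 := hN n hnN
  rw [← hsum n] at h1
  have h2 : ENNReal.ofReal (‖f n - g‖ ^ 2) < ENNReal.ofReal (ε ^ 2) := by
    by_contra! hle
    refine absurd h1 (not_lt.2 ?_)
    refine ENNReal.le_sub_of_add_le_right ENNReal.ofReal_ne_top ?_
    gcongr
  rw [dist_eq_norm]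
  rw [ENNReal.ofReal_lt_ofReal_iff (by positivity)] at h2
  exact lt_of_pow_lt_pow_left₀ 2 hε.le h2

section

/-! ### Functions of time with values in `C₀(ℝ)` -/

section ZeroAtInfty

theorem zeroAtInfty_norm_le {g : C₀(ℝ, ℂ)} {c : ℝ} (hc : 0 ≤ c) (h : ∀ x, ‖g x‖ ≤ c) : ‖g‖ ≤ c := by
  rw [← ZeroAtInftyContinuousMap.norm_toBCF_eq_norm]
  exact (BoundedContinuousFunction.norm_le hc).2 h

theorem exists_compact_norm_le (g : C₀(ℝ, ℂ)) {ε : ℝ} (hε : 0 < ε) :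
    ∃ K : Set ℝ, IsCompact K ∧ ∀ x ∉ K, ‖g x‖ ≤ ε := by
  have h := (zero_at_infty g).eventually (Metric.closedBall_mem_nhds (0 : ℂ) hε)
  obtain ⟨K, hK, hKs⟩ := mem_cocompact.1 h
  exact ⟨K, hK, fun x hx => by simpa using hKs hx⟩

/-- On the compact set `K`, joint continuity gives uniform closeness for `t` near `t₀`; off `K` both
functions are already small. -/
theorem continuous_of_uniform_decay {f : ℝ → C₀(ℝ, ℂ)} (hc : Continuous fun p : ℝ × ℝ => f p.1 p.2)
    (hd : ∀ t₀, ∀ ε > 0, ∃ K : Set ℝ, IsCompact K ∧ ∀ᶠ t in 𝓝 t₀, ∀ x ∉ K, ‖f t x‖ ≤ ε) :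
    Continuous f := by
  rw [continuous_iff_continuousAt]
  intro t₀
  rw [ContinuousAt, Metric.tendsto_nhds]
  intro ε hε
  obtain ⟨K, hK, hKe⟩ := hd t₀ (ε / 4) (by positivity)
  have h1 : ∀ᶠ t in 𝓝 t₀, ∀ x ∈ K, ‖f t x - f t₀ x‖ < ε / 2 := by
    refine hK.eventually_forall_of_forall_eventually fun x _ => ?_
    have h2 : Continuous fun z : ℝ × ℝ => ‖f z.1 z.2 - f t₀ z.2‖ :=
      (hc.sub (hc.comp (by fun_prop : Continuous fun z : ℝ × ℝ => (t₀, z.2)))).norm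
    exact h2.tendsto (t₀, x) |>.eventually_lt_const (by simpa using half_pos hε)
  filter_upwards [h1, hKe] with t ht1 ht2
  rw [dist_eq_norm]
  refine lt_of_le_of_lt (zeroAtInfty_norm_le (half_pos hε).le fun x => ?_) (half_lt_self hε)
  by_cases hx : x ∈ K
  · exact (ht1 x hx).le
  · refine (norm_sub_le (f t x) (f t₀ x)).trans ?_
    linarith [ht2 x hx, hKe.self_of_nhds x hx]

/-- A jointly continuous function of compact support on the plane, as a function of the first
variable with values in `C₀(ℝ)`. -/
def ofKernel (f : ℝ → ℝ → ℂ) (hf : Continuous fun p : ℝ × ℝ => f p.1 p.2)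
    (hs : HasCompactSupport fun p : ℝ × ℝ => f p.1 p.2) : C_c(ℝ, C₀(ℝ, ℂ)) :=
  have hout : ∀ t x, x ∉ Prod.snd '' tsupport (fun p : ℝ × ℝ => f p.1 p.2) → f t x = 0 :=
    fun t x hx => by
      by_contra h
      exact hx ⟨(t, x), subset_tsupport _ h, rfl⟩
  have hK := hs.isCompact.image continuous_snd
  { toFun := fun t =>
      { toFun := f t
        continuous_toFun := hf.comp (by fun_prop : Continuous fun x : ℝ => (t, x))
        zero_at_infty' := by
          refine (HasCompactSupport.intro hK (hout t)).is_zero_at_infty }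
    continuous_toFun := by
      refine continuous_of_uniform_decay hf fun t₀ ε hε => ⟨_, hK, ?_⟩
      refine Eventually.of_forall fun t x hx => ?_
      change ‖f t x‖ ≤ ε
      rw [hout t x hx, norm_zero]
      exact le_of_lt hε
    hasCompactSupport' := by
      refine HasCompactSupport.intro (hs.isCompact.image continuous_fst) fun t ht => ?_
      ext x
      change f t x = 0
      by_contra h
      exact ht ⟨(t, x), subset_tsupport _ h, rfl⟩ }

theorem continuous_uncurry_apply (F : C_c(ℝ, C₀(ℝ, ℂ))) :
    Continuous fun p : ℝ × ℝ => F p.1 p.2 := by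
  rw [continuous_iff_continuousAt]
  rintro ⟨t, x⟩
  rw [ContinuousAt, Metric.tendsto_nhds]
  intro ε hε
  have h1 := (F.continuous.continuousAt (x := t)).tendsto.eventually (Metric.ball_mem_nhds _ (half_pos hε))
  have h2 := ((F t).continuous.tendsto x).eventually (Metric.ball_mem_nhds _ (half_pos hε))
  rw [nhds_prod_eq]
  filter_upwards [h1.prod_mk h2] with p hp
  have h3 : dist (F p.1 p.2) (F t p.2) < ε / 2 := by
    rw [dist_eq_norm]
    refine lt_of_le_of_lt (norm_apply_le (F p.1 - F t) p.2) ?_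
    rw [← dist_eq_norm]
    exact hp.1
  have h4 : dist (F t p.2) (F t x) < ε / 2 := hp.2
  linarith [dist_triangle (F p.1 p.2) (F t p.2) (F t x)]

/-- The elementary tensor `h ⊗ f`, that is `t ↦ h(t) f`. -/
def tensor (h : C_c(ℝ, ℂ)) (f : C₀(ℝ, ℂ)) : C_c(ℝ, C₀(ℝ, ℂ)) where
  toFun t := h t • f
  continuous_toFun := h.continuous.smul continuous_const
  hasCompactSupport' := h.hasCompactSupport.smul_right

/-- The value of `F ∈ C_c(ℝ, C₀(ℝ))` at a point of the space. -/
def evalAt (F : C_c(ℝ, C₀(ℝ, ℂ))) (x : ℝ) : C_c(ℝ, ℂ) where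
  toFun t := F t x
  continuous_toFun := (continuous_uncurry_apply F).comp
    (by fun_prop : Continuous fun t : ℝ => (t, x))
  hasCompactSupport' := F.hasCompactSupport.mono fun t ht h => ht (by
    change F t x = 0
    rw [show F t = 0 from h]
    rfl)

end ZeroAtInfty

variable (φ : OriginFlow)

/-! ### Continuity of the action on `C₀(ℝ)` -/

namespace OriginFlow

theorem norm_act_le (t : ℝ) (f : C₀(ℝ, ℂ)) : ‖φ.act t f‖ ≤ ‖f‖ :=
  zeroAtInfty_norm_le (norm_nonneg _) fun _ => norm_apply_le f _

theorem act_sub (t : ℝ) (f g : C₀(ℝ, ℂ)) : φ.act t (f - g) = φ.act t f - φ.act t g := rfl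

theorem continuous_act_left (f : C₀(ℝ, ℂ)) : Continuous fun t => φ.act t f := by
  refine continuous_of_uniform_decay ?_ fun t₀ ε hε => ?_
  · exact f.continuous.comp (φ.continuous_uncurry.comp
      (by fun_prop : Continuous fun p : ℝ × ℝ => (-p.1, p.2)))
  · obtain ⟨K, hK, hKe⟩ := exists_compact_norm_le f hε
    -- The part of the line swept out by `K` during all times within `1` of `t₀`; outside it `φ (-t)
    -- x` is never in `K`.
    refine ⟨(fun p : ℝ × ℝ => φ p.1 p.2) '' (Icc (t₀ - 1) (t₀ + 1) ×ˢ K),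
      (isCompact_Icc.prod hK).image φ.continuous_uncurry, ?_⟩
    filter_upwards [Icc_mem_nhds (by linarith : t₀ - 1 < t₀) (by linarith : t₀ < t₀ + 1)]
      with t ht x hx
    exact hKe _ fun h => hx ⟨(t, φ (-t) x), ⟨ht, h⟩, φ.apply_neg_apply t x⟩

theorem continuous_act : Continuous fun p : ℝ × C₀(ℝ, ℂ) => φ.act p.1 p.2 := by
  rw [continuous_iff_continuousAt]
  rintro ⟨t₀, f₀⟩
  rw [ContinuousAt, tendsto_iff_norm_sub_tendsto_zero]
  have h1 : Tendsto (fun p : ℝ × C₀(ℝ, ℂ) => ‖p.2 - f₀‖ + ‖φ.act p.1 f₀ - φ.act t₀ f₀‖)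
      (𝓝 (t₀, f₀)) (𝓝 0) := by
    have h2 : Continuous fun p : ℝ × C₀(ℝ, ℂ) => ‖p.2 - f₀‖ + ‖φ.act p.1 f₀ - φ.act t₀ f₀‖ :=
      (continuous_snd.sub continuous_const).norm.add
        (((φ.continuous_act_left f₀).comp continuous_fst).sub continuous_const).norm
    simpa using h2.tendsto (t₀, f₀)
  refine squeeze_zero (fun _ => norm_nonneg _) (fun p => ?_) h1
  have h3 : φ.act p.1 p.2 - φ.act t₀ f₀ =
      φ.act p.1 (p.2 - f₀) + (φ.act p.1 f₀ - φ.act t₀ f₀) := by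
    rw [act_sub]
    abel
  rw [h3]
  exact (norm_add_le _ _).trans (by gcongr; exact φ.norm_act_le _ _)

end OriginFlow

/-! ### The convolution `*`-algebra and its integrated forms -/

section Convolution

variable {φ}

/-- In the coordinates `(s, r - s)` the support lies in the product of the supports of `F` and `G`.
This gives the compact support of the convolution and permits Fubini. -/
theorem hasCompactSupport_shear {E : Type*} [Zero E] {F G : C_c(ℝ, C₀(ℝ, ℂ))} {k : ℝ → ℝ → E}
    (h1 : ∀ s r, F s = 0 → k r s = 0) (h2 : ∀ s r, G (r - s) = 0 → k r s = 0) :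
    HasCompactSupport fun p : ℝ × ℝ => k p.1 p.2 := by
  refine HasCompactSupport.intro ((F.hasCompactSupport.isCompact.prod
    G.hasCompactSupport.isCompact).image
      (by fun_prop : Continuous fun p : ℝ × ℝ => (p.1 + p.2, p.1))) fun p hp => ?_
  by_contra h
  refine hp ⟨(p.2, p.1 - p.2), ⟨subset_tsupport _ fun h0 => h (h1 _ _ h0),
    subset_tsupport _ fun h0 => h (h2 _ _ h0)⟩, by simp⟩

theorem continuous_conv_integrand (F G : C_c(ℝ, C₀(ℝ, ℂ))) :
    Continuous fun p : ℝ × ℝ => F p.2 * φ.act p.2 (G (p.1 - p.2)) :=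
  (F.continuous.comp continuous_snd).mul (φ.continuous_act.comp
    (continuous_snd.prodMk (G.continuous.comp (continuous_fst.sub continuous_snd))))

/-- The convolution product of `C_c(ℝ, C₀(ℝ))`. -/
def conv (φ : OriginFlow) (F G : C_c(ℝ, C₀(ℝ, ℂ))) : C_c(ℝ, C₀(ℝ, ℂ)) :=
  -- Integrating only over the compact support of `F` lets continuity of parametric integrals over
  -- compact sets apply; the integrand vanishes elsewhere.
  { toFun := fun r => ∫ s in tsupport F, F s * φ.act s (G (r - s))
    continuous_toFun :=
      continuous_parametric_integral_of_continuous (continuous_conv_integrand F G)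
        F.hasCompactSupport.isCompact
    hasCompactSupport' := by
      have hs := hasCompactSupport_shear (F := F) (G := G)
        (k := fun r s => F s * φ.act s (G (r - s))) (fun s r h => by rw [h, zero_mul])
        (fun s r h => by rw [h]; exact mul_zero _)
      refine HasCompactSupport.intro (hs.isCompact.image continuous_fst) fun r hr => ?_
      rw [setIntegral_eq_zero_of_forall_eq_zero]
      intro s _
      by_contra h
      exact hr ⟨(r, s), subset_tsupport _ h, rfl⟩ }

theorem conv_apply (F G : C_c(ℝ, C₀(ℝ, ℂ))) (r : ℝ) :
    conv φ F G r = ∫ s, F s * φ.act s (G (r - s)) :=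
  setIntegral_eq_integral_of_forall_compl_eq_zero fun s hs => by
    rw [image_eq_zero_of_notMem_tsupport hs, zero_mul]

/-- The involution of `C_c(ℝ, C₀(ℝ))`. -/
def invol (φ : OriginFlow) (F : C_c(ℝ, C₀(ℝ, ℂ))) : C_c(ℝ, C₀(ℝ, ℂ)) where
  toFun t := φ.act t (star (F (-t)))
  continuous_toFun := φ.continuous_act.comp
    (continuous_id.prodMk ((F.continuous.comp continuous_neg).star))
  hasCompactSupport' := by
    refine (F.hasCompactSupport.comp_homeomorph (Homeomorph.neg ℝ)).mono fun t ht h => ht ?_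
    change φ.act t (star (F (-t))) = 0
    rw [show F (-t) = 0 from h, star_zero]
    rfl

variable {H : Type} [NormedAddCommGroup H] [InnerProductSpace ℂ H] [CompleteSpace H]

theorem CovariantPair.continuous_rep (π : CovariantPair φ H) : Continuous fun a => π.rep a :=
  AddMonoidHomClass.continuous_of_bound π.rep 1 fun a => by
    rw [one_mul]
    exact NonUnitalStarAlgHom.norm_apply_le _ _

/-- The representation of `C₀(ℝ)`, as a continuous linear map. -/
def CovariantPair.repL (π : CovariantPair φ H) : C₀(ℝ, ℂ) →L[ℂ] (H →L[ℂ] H) where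
  toFun := π.rep
  map_add' := map_add π.rep
  map_smul' := map_smul π.rep
  cont := π.continuous_rep

theorem CovariantPair.U_rep (π : CovariantPair φ H) (t : ℝ) (f : C₀(ℝ, ℂ)) (ξ : H) :
    π.U t (π.rep f ξ) = π.rep (φ.act t f) (π.U t ξ) := by
  rw [← π.covariant, LinearIsometryEquiv.symm_apply_apply]

theorem CovariantPair.U_zero (π : CovariantPair φ H) (ξ : H) : π.U 0 ξ = ξ := by
  apply (π.U 0).injective
  rw [← π.U_add, add_zero]

theorem CovariantPair.U_neg (π : CovariantPair φ H) (t : ℝ) (ξ : H) :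
    π.U (-t) ξ = (π.U t).symm ξ := by
  rw [LinearIsometryEquiv.eq_symm_apply, ← π.U_add, add_neg_cancel, π.U_zero]

theorem CovariantPair.rep_conv (π : CovariantPair φ H) (F G : C_c(ℝ, C₀(ℝ, ℂ))) (r : ℝ) (ξ : H) :
    π.rep (conv φ F G r) ξ = ∫ s, π.rep (F s * φ.act s (G (r - s))) ξ := by
  have hint : Integrable fun s => F s * φ.act s (G (r - s)) := by
    refine Continuous.integrable_of_hasCompactSupport
      ((continuous_conv_integrand F G).comp (by fun_prop : Continuous fun s : ℝ => (r, s))) ?_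
    refine F.hasCompactSupport.mono fun s hs h => hs ?_
    change F s * _ = 0
    rw [show F s = 0 from h, zero_mul]
  rw [conv_apply]
  exact (((ContinuousLinearMap.apply ℂ H ξ).comp π.repL).integral_comp_comm hint).symm

/-- After the substitution `r ↦ r + s`, covariance moves `U s` to the left of the represented
coefficient, and `rep f` and `U s` come out of the integral. This is the inner integral in the
multiplicativity of the integrated form. -/
theorem CovariantPair.integral_rep_conv (π : CovariantPair φ H) (f : C₀(ℝ, ℂ))
    (G : C_c(ℝ, C₀(ℝ, ℂ))) (s : ℝ) (ξ : H) :
    ∫ r, π.rep (f * φ.act s (G (r - s))) (π.U r ξ) =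
      π.rep f (π.U s (π.integratedForm G ξ)) := by
  rw [← integral_add_right_eq_self _ s, CovariantPair.integratedForm_apply]
  have h1 := ((π.rep f).comp
    (π.U s).toContinuousLinearEquiv.toContinuousLinearMap).integral_comp_comm (π.integrable G ξ)
  have h2 : ∀ t, π.rep (f * φ.act s (G (t + s - s))) (π.U (t + s) ξ) =
      ((π.rep f).comp (π.U s).toContinuousLinearEquiv.toContinuousLinearMap)
        (π.rep (G t) (π.U t ξ)) := fun t => by
    rw [add_sub_cancel_right, map_mul, add_comm t s, π.U_add]
    change π.rep f (π.rep (φ.act s (G t)) _) = π.rep f (π.U s _)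
    rw [π.U_rep]
  simp only [h2]
  exact h1

theorem CovariantPair.integratedForm_conv (π : CovariantPair φ H) (F G : C_c(ℝ, C₀(ℝ, ℂ))) :
    π.integratedForm (conv φ F G) = π.integratedForm F * π.integratedForm G := by
  ext ξ
  have hcont : Continuous fun p : ℝ × ℝ =>
      π.rep (F p.2 * φ.act p.2 (G (p.1 - p.2))) (π.U p.1 ξ) :=
    (π.continuous_rep.comp (continuous_conv_integrand F G)).clm_apply
      ((π.U_cont ξ).comp continuous_fst)
  have hsupp := hasCompactSupport_shear (F := F) (G := G)
    (k := fun r s => π.rep (F s * φ.act s (G (r - s))) (π.U r ξ))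
    (fun s r h => by rw [h, zero_mul, map_zero, _root_.zero_apply])
    (fun s r h => by
      rw [h, show φ.act s (0 : C₀(ℝ, ℂ)) = 0 from rfl, mul_zero, map_zero, _root_.zero_apply])
  have hswap : ∫ r, ∫ s, π.rep (F s * φ.act s (G (r - s))) (π.U r ξ) =
      ∫ s, ∫ r, π.rep (F s * φ.act s (G (r - s))) (π.U r ξ) :=
    integral_integral_swap_of_hasCompactSupport
      (f := fun r s => π.rep (F s * φ.act s (G (r - s))) (π.U r ξ)) hcont hsupp
  have h1 : ∀ r, π.rep (conv φ F G r) (π.U r ξ) =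
      ∫ s, π.rep (F s * φ.act s (G (r - s))) (π.U r ξ) := fun r => π.rep_conv F G r _
  have h2 : ∀ s, ∫ r, π.rep (F s * φ.act s (G (r - s))) (π.U r ξ) =
      π.rep (F s) (π.U s (π.integratedForm G ξ)) := fun s => π.integral_rep_conv _ G s ξ
  rw [integral_congr_ae (ae_of_all _ h2), ← integral_congr_ae (ae_of_all _ h1)] at hswap
  exact hswap

theorem CovariantPair.integratedForm_invol (π : CovariantPair φ H) (F : C_c(ℝ, C₀(ℝ, ℂ))) :
    π.integratedForm (invol φ F) = star (π.integratedForm F) := by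
  rw [ContinuousLinearMap.star_eq_adjoint, ContinuousLinearMap.eq_adjoint_iff]
  intro ξ η
  rw [CovariantPair.integratedForm_apply, CovariantPair.integratedForm_apply,
    ← integral_inner (π.integrable F η), ← inner_conj_symm,
    ← integral_inner (π.integrable (invol φ F) ξ), ← integral_conj,
    ← integral_neg_eq_self (fun t => inner ℂ ξ _)]
  refine integral_congr_ae (ae_of_all _ fun t => ?_)
  simp only [inner_conj_symm]
  change inner ℂ (π.rep (φ.act t (star (F (-t)))) (π.U t ξ)) η = inner ℂ ξ (π.rep (F (-t)) (π.U (-t) η))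
  rw [← π.U_rep, π.U_neg, map_star, ContinuousLinearMap.star_eq_adjoint,
    ← ContinuousLinearMap.adjoint_inner_left]
  conv_lhs => rw [← (π.U t).apply_symm_apply η]
  rw [LinearIsometryEquiv.inner_map_map]

theorem CovariantPair.integratedForm_add (π : CovariantPair φ H) (F G : C_c(ℝ, C₀(ℝ, ℂ))) :
    π.integratedForm (F + G) = π.integratedForm F + π.integratedForm G := by
  ext ξ
  rw [_root_.add_apply]
  simp only [CovariantPair.integratedForm_apply]
  rw [← integral_add (π.integrable F ξ) (π.integrable G ξ)]
  refine integral_congr_ae (ae_of_all _ fun t => ?_)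
  change π.rep (F t + G t) _ = _
  rw [map_add]
  rfl

theorem CovariantPair.integratedForm_smul (π : CovariantPair φ H) (c : ℂ) (F : C_c(ℝ, C₀(ℝ, ℂ))) :
    π.integratedForm (c • F) = c • π.integratedForm F := by
  ext ξ
  rw [_root_.smul_apply]
  simp only [CovariantPair.integratedForm_apply]
  rw [← integral_smul]
  refine integral_congr_ae (ae_of_all _ fun t => ?_)
  change π.rep (c • F t) _ = _
  rw [map_smul]
  rfl

theorem CovariantPair.integratedForm_sub (π : CovariantPair φ H) (F G : C_c(ℝ, C₀(ℝ, ℂ))) :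
    π.integratedForm (F - G) = π.integratedForm F - π.integratedForm G := by
  have h : F - G + G = F := by
    ext t x
    simp
  rw [eq_sub_iff_add_eq, ← CovariantPair.integratedForm_add, h]

end Convolution

variable {φ}

/-! ### The image algebra as a norm closure of integrated forms -/

/-- The image of `C_c(ℝ, C₀(ℝ))` in the universal representation is a `*`-algebra. -/
def universalRange (φ : OriginFlow) : NonUnitalStarSubalgebra ℂ (ProductAlgebra φ) where
  carrier := Set.range (universalForm φ)
  add_mem' := by
    rintro _ _ ⟨F, rfl⟩ ⟨G, rfl⟩
    exact ⟨F + G, Subtype.ext (funext fun π => π.pair.integratedForm_add F G)⟩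
  zero_mem' := ⟨0, Subtype.ext (funext fun π => by
    have h := π.pair.integratedForm_sub 0 0
    rw [sub_self] at h
    refine Eq.trans ?_ h
    change π.pair.integratedForm 0 = _
    congr 1
    ext t x
    simp)⟩
  mul_mem' := by
    rintro _ _ ⟨F, rfl⟩ ⟨G, rfl⟩
    exact ⟨conv φ F G, Subtype.ext (funext fun π => π.pair.integratedForm_conv F G)⟩
  smul_mem' := by
    rintro c _ ⟨F, rfl⟩
    exact ⟨c • F, Subtype.ext (funext fun π => π.pair.integratedForm_smul c F)⟩
  star_mem' := by
    rintro _ ⟨F, rfl⟩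
    exact ⟨invol φ F, Subtype.ext (funext fun π => π.pair.integratedForm_invol F)⟩

theorem coe_crossedProduct (φ : OriginFlow) :
    (crossedProduct φ : Set (ProductAlgebra φ)) = closure (Set.range (universalForm φ)) := by
  change closure (NonUnitalStarAlgebra.adjoin ℂ (Set.range (universalForm φ)) :
    Set (ProductAlgebra φ)) = _
  congr 1
  refine Subset.antisymm ?_ (NonUnitalStarAlgebra.subset_adjoin ℂ _)
  exact NonUnitalStarAlgebra.adjoin_le (S := universalRange φ) Subset.rfl

/-- The image of the canonical representation is the norm closure of the operators
`∫ M(F(t)) U_t dt`. -/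
theorem coe_imageAlgebra (φ : OriginFlow) : (imageAlgebra φ : Set (HalfLines →L[ℂ] HalfLines)) =
    closure (Set.range (canonicalPair φ).integratedForm) := by
  have hmem : ∀ F, universalForm φ F ∈ crossedProduct φ := fun F => by
    rw [← SetLike.mem_coe, coe_crossedProduct]
    exact subset_closure ⟨F, rfl⟩
  have hr : (imageAlgebra φ : Set (HalfLines →L[ℂ] HalfLines)) = Set.range (canonicalRep φ) := by
    ext T
    simp [imageAlgebra]
  rw [hr]
  refine Subset.antisymm ?_ (closure_minimal ?_ (isClosed_range_starHom _))
  · rintro _ ⟨a, rfl⟩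
    have hc : Continuous (CovariantRep.eval (φ := φ) ⟨HalfLines, canonicalPair φ⟩) :=
      AddMonoidHomClass.continuous_of_bound _ 1 fun a => by
        rw [one_mul]
        exact NonUnitalStarAlgHom.norm_apply_le _ a
    have ha : (a : ProductAlgebra φ) ∈ closure (Set.range (universalForm φ)) := by
      rw [← coe_crossedProduct]
      exact a.2
    refine map_mem_closure (f := CovariantRep.eval (φ := φ) ⟨HalfLines, canonicalPair φ⟩)
      hc ha ?_
    rintro _ ⟨F, rfl⟩
    exact ⟨F, rfl⟩
  · rintro _ ⟨F, rfl⟩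
    exact ⟨⟨universalForm φ F, hmem F⟩, rfl⟩

end

/-! ### Half lines -/

section

/-- `S` is one of the two open half lines `(-∞, 0)` and `(0, ∞)`. -/
def IsHalfLine (S : Set ℝ) : Prop := S = Iio 0 ∨ S = Ioi 0

namespace IsHalfLine

variable {S : Set ℝ}

theorem measurableSet (hS : IsHalfLine S) : MeasurableSet S := by
  rcases hS with rfl | rfl
  exacts [measurableSet_Iio, measurableSet_Ioi]

theorem isOpen (hS : IsHalfLine S) : IsOpen S := by
  rcases hS with rfl | rfl
  exacts [isOpen_Iio, isOpen_Ioi]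

theorem ordConnected (hS : IsHalfLine S) : OrdConnected S := by
  rcases hS with rfl | rfl
  exacts [ordConnected_Iio, ordConnected_Ioi]

theorem ne_zero (hS : IsHalfLine S) {x : ℝ} (hx : x ∈ S) : x ≠ 0 := by
  rcases hS with rfl | rfl
  exacts [(mem_Iio.1 hx).ne, (mem_Ioi.1 hx).ne']

theorem nonempty (hS : IsHalfLine S) : S.Nonempty := by
  rcases hS with rfl | rfl
  exacts [⟨-1, by simp⟩, ⟨1, by simp⟩]

theorem mul_mem (hS : IsHalfLine S) {x c : ℝ} (hx : x ∈ S) (hc : 0 < c) : c * x ∈ S := by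
  rcases hS with rfl | rfl
  exacts [mul_neg_of_pos_of_neg hc hx, mul_pos hc hx]

theorem mapsTo (hS : IsHalfLine S) (φ : OriginFlow) (t : ℝ) : MapsTo (φ t) S S := by
  rcases hS with rfl | rfl
  exacts [φ.mapsTo_Iio t, φ.mapsTo_Ioi t]

end IsHalfLine

/-! ### Order of vanishing of a generator -/

section Generator

variable {k : ℕ} {X : ℝ → ℝ}

theorem exists_bound_of_module_subset {X Y : ℝ → ℝ} (h : moduleGeneratedBy Y ⊆ moduleGeneratedBy X)
    (R : ℝ) : ∃ C > 0, ∀ x, |x| ≤ R → |Y x| ≤ C * |X x| := by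
  -- A cut-off equal to `1` on `[-R, R]` turns `Y` into a member of its module without changing it
  -- there; the coefficient expressing it through `X` is bounded.
  let b : ContDiffBump (0 : ℝ) := ⟨|R| + 1, |R| + 2, by positivity, by linarith⟩
  obtain ⟨g, hg, hgc, hgY⟩ := h ⟨b, b.contDiff, b.hasCompactSupport, rfl⟩
  obtain ⟨C, hC⟩ := hgc.exists_bound_of_continuous hg.continuous
  refine ⟨|C| + 1, by positivity, fun x hx => ?_⟩
  have h1 : b x = 1 := b.one_of_mem_closedBall (by
    simp only [mem_closedBall_zero_iff, Real.norm_eq_abs, b]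
    linarith [le_abs_self R])
  have h2 := congrFun hgY x
  simp only [h1, one_mul] at h2
  rw [h2, abs_mul]
  gcongr
  have := hC x
  rw [Real.norm_eq_abs] at this
  linarith [le_abs_self C]

/-- Both inclusions between the modules are used. Apart from smoothness, everything needed about a
generator follows from this comparison: where it vanishes and to which order. -/
theorem IsGenerator.exists_bound (hX : IsGenerator k X) (R : ℝ) :
    ∃ C > 0, ∀ x, |x| ≤ R → |X x| ≤ C * |x| ^ k ∧ |x| ^ k ≤ C * |X x| := by
  obtain ⟨C₁, hC₁, h₁⟩ := exists_bound_of_module_subset hX.2.le R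
  obtain ⟨C₂, hC₂, h₂⟩ := exists_bound_of_module_subset hX.2.ge R
  refine ⟨max C₁ C₂, lt_max_of_lt_left hC₁, fun x hx => ⟨?_, ?_⟩⟩
  · rw [← abs_pow]
    exact (h₁ x hx).trans (by gcongr; exact le_max_left _ _)
  · rw [← abs_pow]
    exact (h₂ x hx).trans (by gcongr; exact le_max_right _ _)

theorem IsGenerator.ne_zero (hX : IsGenerator k X) {x : ℝ} (hx : x ≠ 0) : X x ≠ 0 := fun h => by
  obtain ⟨C, -, hb⟩ := hX.exists_bound |x|
  have h2 := (hb x le_rfl).2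
  rw [h, abs_zero, mul_zero] at h2
  have : 0 < |x| ^ k := by positivity
  linarith

theorem IsGenerator.zero (hX : IsGenerator k X) (hk : 0 < k) : X 0 = 0 := by
  obtain ⟨C, -, hb⟩ := hX.exists_bound 0
  have h := (hb 0 (by simp)).1
  rw [abs_zero, zero_pow hk.ne', mul_zero] at h
  exact abs_eq_zero.1 (le_antisymm h (abs_nonneg _))

theorem IsGenerator.hasDerivAt (hX : IsGenerator k X) (x : ℝ) : HasDerivAt X (deriv X x) x :=
  (hX.1.differentiable (by simp) x).hasDerivAt

theorem IsGenerator.continuous_deriv (hX : IsGenerator k X) : Continuous (deriv X) :=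
  hX.1.continuous_deriv (by simp)

theorem IsGenerator.tendsto_div {l : ℕ} {Y : ℝ → ℝ} (hX : IsGenerator k X) (hY : IsGenerator l Y)
    (hkl : k < l) : Tendsto (fun x => Y x / X x) (𝓝[≠] 0) (𝓝 0) := by
  obtain ⟨C, hC, hb⟩ := hX.exists_bound 1
  obtain ⟨D, hD, hd⟩ := hY.exists_bound 1
  have h1 : Tendsto (fun x : ℝ => D * C * |x| ^ (l - k)) (𝓝[≠] 0) (𝓝 0) := by
    have h2 : Continuous fun x : ℝ => D * C * |x| ^ (l - k) := by fun_prop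
    have h3 := h2.tendsto 0
    rw [abs_zero, zero_pow (by omega), mul_zero] at h3
    exact h3.mono_left nhdsWithin_le_nhds
  refine squeeze_zero_norm' ?_ h1
  have h4 : ∀ᶠ x : ℝ in 𝓝[≠] 0, x ∈ Metric.closedBall (0 : ℝ) 1 :=
    nhdsWithin_le_nhds (Metric.closedBall_mem_nhds _ one_pos)
  filter_upwards [self_mem_nhdsWithin, h4] with x hx hx1
  have hx1' : |x| ≤ 1 := by simpa using hx1
  have hXx : 0 < |X x| := abs_pos.2 (hX.ne_zero hx)
  rw [Real.norm_eq_abs, abs_div, div_le_iff₀ hXx]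
  calc |Y x| ≤ D * |x| ^ l := (hd x hx1').1
    _ = D * |x| ^ (l - k) * |x| ^ k := by
      rw [mul_assoc, ← pow_add]
      congr 2
      omega
    _ ≤ D * |x| ^ (l - k) * (C * |X x|) := by
      gcongr
      exact (hb x hx1').2
    _ = D * C * |x| ^ (l - k) * |X x| := by ring

theorem IsGenerator.deriv_zero (hX : IsGenerator k X) (hk : 2 ≤ k) : deriv X 0 = 0 := by
  obtain ⟨C, hC, hb⟩ := hX.exists_bound 1
  have h1 : (fun x => X (0 + x) - X 0 - x • (0 : ℝ)) =O[𝓝 0] fun x : ℝ => x ^ k := by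
    refine Asymptotics.IsBigO.of_bound C ?_
    filter_upwards [Metric.closedBall_mem_nhds (0 : ℝ) one_pos] with x hx
    have hx1' : |x| ≤ 1 := by simpa using hx
    rw [hX.zero (by omega), zero_add, smul_zero, sub_zero, sub_zero, norm_pow, Real.norm_eq_abs,
      Real.norm_eq_abs]
    exact (hb x hx1').1
  refine HasDerivAt.deriv ?_
  rw [hasDerivAt_iff_isLittleO_nhds_zero]
  refine h1.trans_isLittleO ?_
  have := Asymptotics.isLittleO_pow_pow (𝕜 := ℝ) (show 1 < k by omega)
  simpa using this

end Generator

/-! ### The flow of a generator and the time coordinate on a half line -/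

variable {φ ψ : OriginFlow} {X Y : ℝ → ℝ} {k l : ℕ} {S : Set ℝ}

namespace OriginFlow

theorem IsFlowOf.hasDerivAt_time (hφ : φ.IsFlowOf X) (t x : ℝ) :
    HasDerivAt (fun s => φ s x) (X (φ t x)) t := by
  have h1 : (fun s => φ s x) = fun s => φ (s - t) (φ t x) := by
    ext s
    rw [← φ.toFlow.map_add, sub_add_cancel]
  rw [h1]
  have h2 : HasDerivAt (fun s => φ s (φ t x)) (X (φ t x)) (t - t) := by
    rw [sub_self]
    exact hφ (φ t x)
  exact h2.comp_sub_const t t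

/-- A flow preserves its own vector field: differentiate `φ t (φ s x) = φ s (φ t x)` in `s` at `0`.
Jacobians of the flow thereby become quotients of values of `X`. -/
theorem IsFlowOf.deriv_mul (hφ : φ.IsFlowOf X) (t x : ℝ) :
    deriv (φ t) x * X x = X (φ t x) := by
  have h1 : HasDerivAt (fun s => φ t (φ s x)) (deriv (φ t) x * X x) 0 := by
    have h2 := φ.hasDerivAt t (φ 0 x)
    have h3 := h2.comp (0 : ℝ) (hφ x)
    rwa [φ.toFlow.map_zero_apply] at h3
  have h4 : (fun s => φ t (φ s x)) = fun s => φ s (φ t x) := by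
    ext s
    rw [← φ.toFlow.map_add, add_comm, φ.toFlow.map_add]
  rw [h4] at h1
  exact h1.unique (hφ (φ t x))

theorem IsFlowOf.deriv_eq (hφ : φ.IsFlowOf X) (t : ℝ) {x : ℝ} (hx : X x ≠ 0) :
    deriv (φ t) x = X (φ t x) / X x := by
  rw [eq_div_iff hx, hφ.deriv_mul]

end OriginFlow

/-- The time that the flow of `X d/dx` takes to move `x₀` to `x`. -/
def flowTime (X : ℝ → ℝ) (x₀ x : ℝ) : ℝ := ∫ y in x₀..x, (X y)⁻¹

theorem flowTime_self (X : ℝ → ℝ) (x₀ : ℝ) : flowTime X x₀ x₀ = 0 := intervalIntegral.integral_same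

theorem hasDerivAt_flowTime (hX : IsGenerator k X) (hS : IsHalfLine S) {x₀ x : ℝ} (hx₀ : x₀ ∈ S)
    (hx : x ∈ S) : HasDerivAt (flowTime X x₀) (X x)⁻¹ x := by
  have hc : ∀ y ∈ S, ContinuousAt (fun y => (X y)⁻¹) y := fun y hy =>
    (hX.1.continuous.continuousAt).inv₀ (hX.ne_zero (hS.ne_zero hy))
  have hcS : ContinuousOn (fun y => (X y)⁻¹) S := fun y hy => (hc y hy).continuousWithinAt
  have := hS.ordConnected
  refine intervalIntegral.integral_hasDerivAt_right ?_ ?_ (hc x hx)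
  · exact (hcS.mono (OrdConnected.uIcc_subset this hx₀ hx)).intervalIntegrable
  · exact hcS.stronglyMeasurableAtFilter hS.isOpen x hx

/-- Along an orbit the time coordinate has derivative `X⁻¹ * X = 1`, so in this coordinate the flow
is translation. -/
theorem flowTime_flow (hX : IsGenerator k X) (hφ : φ.IsFlowOf X) (hS : IsHalfLine S) {x₀ x : ℝ}
    (hx₀ : x₀ ∈ S) (hx : x ∈ S) (t : ℝ) : flowTime X x₀ (φ t x) = flowTime X x₀ x + t := by
  have hd : ∀ s, HasDerivAt (fun s => flowTime X x₀ (φ s x) - s) 0 s := fun s => by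
    have hm := hS.mapsTo φ s hx
    have h1 := ((hasDerivAt_flowTime hX hS hx₀ hm).comp s (hφ.hasDerivAt_time s x)).sub
      (hasDerivAt_id s)
    rwa [inv_mul_cancel₀ (hX.ne_zero (hS.ne_zero hm)), sub_self] at h1
  have h2 := is_const_of_deriv_eq_zero (fun s => (hd s).differentiableAt)
    (fun s => (hd s).deriv) t 0
  simp only [φ.toFlow.map_zero_apply, sub_zero] at h2
  linarith

theorem injOn_flowTime (hX : IsGenerator k X) (hS : IsHalfLine S) {x₀ : ℝ} (hx₀ : x₀ ∈ S) :
    InjOn (flowTime X x₀) S := by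
  have key : ∀ x ∈ S, ∀ y ∈ S, x < y → flowTime X x₀ x ≠ flowTime X x₀ y := by
    intro x hx y hy hxy h
    have hsub : Icc x y ⊆ S := hS.ordConnected.out hx hy
    obtain ⟨c, hc, hc0⟩ := exists_hasDerivAt_eq_zero hxy
      (fun z hz => (hasDerivAt_flowTime hX hS hx₀ (hsub hz)).continuousAt.continuousWithinAt) h
      (fun z hz => hasDerivAt_flowTime hX hS hx₀ (hsub (Ioo_subset_Icc_self hz)))
    exact inv_ne_zero (hX.ne_zero (hS.ne_zero (hsub (Ioo_subset_Icc_self hc)))) hc0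
  intro x hx y hy h
  rcases lt_trichotomy x y with hlt | heq | hgt
  · exact absurd h (key x hx y hy hlt)
  · exact heq
  · exact absurd h.symm (key y hy x hx hgt)

/-- Both points have the same time coordinate, and that coordinate is injective by Rolle's theorem.
Hence the flow is transitive on the half line. -/
theorem flow_flowTime (hX : IsGenerator k X) (hφ : φ.IsFlowOf X) (hS : IsHalfLine S) {x₀ x : ℝ}
    (hx₀ : x₀ ∈ S) (hx : x ∈ S) : φ (flowTime X x₀ x) x₀ = x := by
  refine injOn_flowTime hX hS hx₀ (hS.mapsTo φ _ hx₀) hx ?_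
  rw [flowTime_flow hX hφ hS hx₀ hx₀, flowTime_self, zero_add]

theorem flow_injective (hX : IsGenerator k X) (hφ : φ.IsFlowOf X) (hS : IsHalfLine S) {x : ℝ}
    (hx : x ∈ S) : Function.Injective fun t => φ t x := fun s t h => by
  have h1 := congrArg (flowTime X x) h
  simp only [flowTime_flow hX hφ hS hx hx] at h1
  linarith

/-- Choose times that move a base point `x₀` to `x₀ / (n + 1)`. The same times serve every `x`: it
is `φ a x₀` for some `a`, and `φ a` commutes with the flow, is continuous and fixes `0`. -/
theorem exists_seq_tendsto_zero (hX : IsGenerator k X) (hφ : φ.IsFlowOf X) (hS : IsHalfLine S) :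
    ∃ t : ℕ → ℝ, ∀ x ∈ S, Tendsto (fun n => φ (t n) x) atTop (𝓝 0) := by
  obtain ⟨x₀, hx₀⟩ := hS.nonempty
  have hpos : ∀ n : ℕ, (0 : ℝ) < 1 / ((n : ℝ) + 1) := fun n => by positivity
  refine ⟨fun n => flowTime X x₀ (1 / ((n : ℝ) + 1) * x₀), fun x hx => ?_⟩
  have h1 : ∀ n : ℕ, φ (flowTime X x₀ (1 / ((n : ℝ) + 1) * x₀)) x =
      φ (flowTime X x₀ x) (1 / ((n : ℝ) + 1) * x₀) := fun n => by
    conv_lhs => rw [← flow_flowTime hX hφ hS hx₀ hx]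
    rw [← φ.toFlow.map_add, add_comm, φ.toFlow.map_add,
      flow_flowTime hX hφ hS hx₀ (hS.mul_mem hx₀ (hpos n))]
  simp only [h1]
  have h2 : Tendsto (fun n : ℕ => 1 / ((n : ℝ) + 1) * x₀) atTop (𝓝 0) := by
    simpa using (tendsto_one_div_add_atTop_nhds_zero_nat (𝕜 := ℝ)).mul_const x₀
  have h3 := ((φ.continuous_apply (flowTime X x₀ x)).tendsto 0).comp h2
  rwa [φ.fixes_zero] at h3

/-- A function whose derivative along `Y d/dx` tends to `0` at the origin is asymptotically
invariant under the flow of `Y d/dx`. -/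
theorem tendsto_sub_flow (hψ : ψ.IsFlowOf Y) (hS : IsHalfLine S) {p q : ℝ → ℝ}
    (hq : ∀ x ∈ S, HasDerivAt q (p x) x) (hp : Tendsto (fun x => p x * Y x) (𝓝[≠] 0) (𝓝 0))
    {z : ℕ → ℝ} (hz : ∀ n, z n ∈ S) (hz0 : Tendsto z atTop (𝓝 0)) (s : ℝ) :
    Tendsto (fun n => q (ψ s (z n)) - q (z n)) atTop (𝓝 0) := by
  rw [Metric.tendsto_nhds]
  intro ε hε
  set δ := ε / (|s| + 1) with hδ
  have hδ0 : 0 < δ := by positivity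
  have h1 : ∀ᶠ x in 𝓝 0, x ∈ ({0}ᶜ : Set ℝ) → |p x * Y x| ≤ δ := by
    have := hp.eventually (Metric.closedBall_mem_nhds (0 : ℝ) hδ0)
    rw [eventually_nhdsWithin_iff] at this
    simpa using this
  -- Since `0` is fixed, compactness of the time interval keeps the whole orbit segment in the
  -- region where the derivative along `Y` is small; the mean value inequality then applies.
  have h2 : ∀ᶠ x in 𝓝 0, ∀ r ∈ uIcc 0 s, ψ r x ∈ ({0}ᶜ : Set ℝ) → |p (ψ r x) * Y (ψ r x)| ≤ δ := by
    refine isCompact_uIcc.eventually_forall_of_forall_eventually fun r _ => ?_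
    have hc : Continuous fun w : ℝ × ℝ => ψ w.2 w.1 :=
      ψ.continuous_uncurry.comp continuous_swap
    have h3 := hc.tendsto (0, r)
    rw [ψ.fixes_zero] at h3
    exact h3.eventually h1
  filter_upwards [hz0.eventually h2] with n hn
  have hder : ∀ r ∈ uIcc 0 s, HasDerivWithinAt (fun r => q (ψ r (z n)))
      (p (ψ r (z n)) * Y (ψ r (z n))) (uIcc 0 s) r := fun r _ =>
    ((hq _ (hS.mapsTo ψ r (hz n))).comp r (hψ.hasDerivAt_time r (z n))).hasDerivWithinAt
  have h4 := (convex_uIcc 0 s).norm_image_sub_le_of_norm_hasDerivWithin_le hder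
    (fun r hr => hn r hr (hS.ne_zero (hS.mapsTo ψ r (hz n)))) left_mem_uIcc right_mem_uIcc
  rw [ψ.toFlow.map_zero_apply, sub_zero, Real.norm_eq_abs, Real.norm_eq_abs] at h4
  rw [Real.dist_eq, sub_zero]
  refine lt_of_le_of_lt h4 ?_
  rw [hδ, div_mul_eq_mul_div, div_lt_iff₀ (by positivity)]
  nlinarith [abs_nonneg s]

/-! ### Comparison of two flows near the origin -/

section Rescaling

/-- In the time coordinate of `φ`, the conjugate displaces `x` by the change of that coordinate
along `ψ` near the origin. Its rate of change is `Y / X`, which tends to `0` because `k < l`. -/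
theorem tendsto_conjugate (hX : IsGenerator k X) (hφ : φ.IsFlowOf X) (hY : IsGenerator l Y)
    (hψ : ψ.IsFlowOf Y) (hkl : k < l) (hS : IsHalfLine S) {x : ℝ} (hx : x ∈ S) {t : ℕ → ℝ}
    (ht : Tendsto (fun n => φ (t n) x) atTop (𝓝 0)) (s : ℝ) :
    Tendsto (fun n => φ (-t n) (ψ s (φ (t n) x))) atTop (𝓝 x) := by
  have hz : ∀ n, φ (t n) x ∈ S := fun n => hS.mapsTo φ _ hx
  have hp : Tendsto (fun x => (X x)⁻¹ * Y x) (𝓝[≠] 0) (𝓝 0) := by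
    simpa [div_eq_inv_mul] using hX.tendsto_div hY hkl
  have h1 := tendsto_sub_flow hψ hS (fun y hy => hasDerivAt_flowTime hX hS hx hy) hp hz ht s
  have h2 : ∀ n, φ (-t n) (ψ s (φ (t n) x)) =
      φ (flowTime X x (ψ s (φ (t n) x)) - flowTime X x (φ (t n) x)) x := fun n => by
    have hw : ψ s (φ (t n) x) ∈ S := hS.mapsTo ψ s (hz n)
    conv_lhs => rw [← flow_flowTime hX hφ hS hx (hS.mapsTo φ (-t n) hw)]
    rw [flowTime_flow hX hφ hS hx hw, flowTime_flow hX hφ hS hx hx, flowTime_self]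
    ring_nf
  simp only [h2]
  have h3 : Continuous fun r => φ r x :=
    φ.continuous_uncurry.comp (by fun_prop : Continuous fun r : ℝ => (r, x))
  have h4 := (h3.tendsto 0).comp h1
  rwa [φ.toFlow.map_zero_apply] at h4

/-- The logarithm of `Y / X` changes along `Y` at the rate `Y' - X' * (Y / X)`, which tends to `Y' 0
= 0`, as `l ≥ 2`. This controls the part of the Jacobian of the conjugated flow that is taken near
the origin. -/
theorem tendsto_ratio (hX : IsGenerator k X) (hY : IsGenerator l Y) (hψ : ψ.IsFlowOf Y)
    (hk : 0 < k) (hkl : k < l) (hS : IsHalfLine S) {z : ℕ → ℝ} (hz : ∀ n, z n ∈ S)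
    (hz0 : Tendsto z atTop (𝓝 0)) (s : ℝ) :
    Tendsto (fun n => |Y (ψ s (z n)) / Y (z n) * (X (z n) / X (ψ s (z n)))|) atTop (𝓝 1) := by
  have hXne : ∀ x ∈ S, X x ≠ 0 := fun x hx => hX.ne_zero (hS.ne_zero hx)
  have hYne : ∀ x ∈ S, Y x ≠ 0 := fun x hx => hY.ne_zero (hS.ne_zero hx)
  have hq : ∀ x ∈ S, HasDerivAt (fun x => Real.log (Y x) - Real.log (X x))
      (deriv Y x / Y x - deriv X x / X x) x := fun x hx =>
    ((hY.hasDerivAt x).log (hYne x hx)).sub ((hX.hasDerivAt x).log (hXne x hx))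
  have hp : Tendsto (fun x => (deriv Y x / Y x - deriv X x / X x) * Y x) (𝓝[≠] 0) (𝓝 0) := by
    have h1 : Tendsto (fun x => deriv Y x - deriv X x * (Y x / X x)) (𝓝[≠] 0)
        (𝓝 (deriv Y 0 - deriv X 0 * 0)) :=
      ((hY.continuous_deriv.tendsto 0).mono_left nhdsWithin_le_nhds).sub
        (((hX.continuous_deriv.tendsto 0).mono_left nhdsWithin_le_nhds).mul
          (hX.tendsto_div hY hkl))
    rw [hY.deriv_zero (by omega), mul_zero, sub_zero] at h1
    refine h1.congr' ?_
    filter_upwards [self_mem_nhdsWithin] with x hx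
    have := hY.ne_zero hx
    have := hX.ne_zero hx
    field_simp
  have h2 := tendsto_sub_flow hψ hS hq hp hz hz0 s
  have h3 := (Real.continuous_exp.tendsto 0).comp h2
  rw [Real.exp_zero] at h3
  refine h3.congr fun n => ?_
  have hw : ψ s (z n) ∈ S := hS.mapsTo ψ s (hz n)
  have a1 := hXne _ (hz n)
  have a2 := hXne _ hw
  have a3 := hYne _ (hz n)
  have a4 := hYne _ hw
  rw [Function.comp_apply, ← Real.exp_log (abs_pos.2 (mul_ne_zero (div_ne_zero a4 a3)
    (div_ne_zero a1 a2))), Real.log_abs, Real.log_mul (div_ne_zero a4 a3) (div_ne_zero a1 a2),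
    Real.log_div a4 a3, Real.log_div a1 a2]
  congr 1
  ring

/-- If `Y d/dx` vanishes to higher order than `X d/dx`, then a bounded time of the flow of `Y d/dx`
becomes negligible in the coordinate of the flow of `X d/dx` near the origin. -/
theorem tendsto_transport_conjugate (hX : IsGenerator k X) (hφ : φ.IsFlowOf X)
    (hY : IsGenerator l Y) (hψ : ψ.IsFlowOf Y) (hk : 0 < k) (hkl : k < l) (hS : IsHalfLine S)
    {x : ℝ} (hx : x ∈ S) {t : ℕ → ℝ} (ht : Tendsto (fun n => φ (t n) x) atTop (𝓝 0)) (s : ℝ)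
    {η : ℝ → ℂ} (hη : Continuous η) :
    Tendsto (fun n => φ.transport (t n) (ψ.transport s (φ.transport (-t n) η)) x) atTop
      (𝓝 (η x)) := by
  have hz : ∀ n, φ (t n) x ∈ S := fun n => hS.mapsTo φ _ hx
  have hθ := tendsto_conjugate hX hφ hY hψ hkl hS hx ht s
  have hr := tendsto_ratio hX hY hψ hk hkl hS hz ht s
  have hXx : X x ≠ 0 := hX.ne_zero (hS.ne_zero hx)
  have h1 : Tendsto (fun n => |X (φ (-t n) (ψ s (φ (t n) x))) / X x| *
      |Y (ψ s (φ (t n) x)) / Y (φ (t n) x) * (X (φ (t n) x) / X (ψ s (φ (t n) x)))|) atTop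
      (𝓝 (|X x / X x| * 1)) :=
    ((((hX.1.continuous.tendsto x).comp hθ).div_const _).abs).mul hr
  rw [div_self hXx, abs_one, mul_one] at h1
  have h2 := (Real.continuous_sqrt.tendsto 1).comp h1
  rw [Real.sqrt_one] at h2
  have h3 := ((Complex.continuous_ofReal.tendsto 1).comp h2).mul ((hη.tendsto x).comp hθ)
  rw [Complex.ofReal_one, one_mul] at h3
  refine h3.congr fun n => ?_
  have hw : ψ s (φ (t n) x) ∈ S := hS.mapsTo ψ s (hz n)
  simp only [OriginFlow.transport, Function.comp_apply]
  rw [← mul_assoc, ← mul_assoc, ← Complex.ofReal_mul, ← Complex.ofReal_mul,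
    ← Real.sqrt_mul (φ.deriv_pos _ _).le,
    ← Real.sqrt_mul (mul_pos (φ.deriv_pos _ _) (ψ.deriv_pos _ _)).le, ← abs_mul]
  have a1 := hX.ne_zero (hS.ne_zero (hz n))
  have a2 := hX.ne_zero (hS.ne_zero hw)
  have a3 := hY.ne_zero (hS.ne_zero (hz n))
  -- The Jacobian of the conjugated map by the chain rule, with every factor expressed through `X`
  -- or `Y`. Being positive, it is unaffected by the absolute values above.
  have h4 : deriv (φ (t n)) x * deriv (ψ s) (φ (t n) x) * deriv (φ (-t n)) (ψ s (φ (t n) x)) =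
      X (φ (-t n) (ψ s (φ (t n) x))) / X x *
      (Y (ψ s (φ (t n) x)) / Y (φ (t n) x) * (X (φ (t n) x) / X (ψ s (φ (t n) x)))) := by
    rw [hφ.deriv_eq _ hXx, hψ.deriv_eq _ a3, hφ.deriv_eq _ a2]
    ring
  rw [← h4, abs_of_pos (mul_pos (mul_pos (φ.deriv_pos _ _) (ψ.deriv_pos _ _)) (φ.deriv_pos _ _))]

end Rescaling

end

/-! ### Test functions and their density in `L²` -/

section

/-- A continuous function whose support is a compact subset of `S`. -/
structure TestFunction (S : Set ℝ) where
  toFun : ℝ → ℂ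
  continuous : Continuous toFun
  hasCompactSupport : HasCompactSupport toFun
  tsupport_subset : tsupport toFun ⊆ S

namespace TestFunction

variable {S : Set ℝ}

instance : CoeFun (TestFunction S) fun _ => ℝ → ℂ := ⟨toFun⟩

theorem apply_eq_zero (u : TestFunction S) {x : ℝ} (hx : x ∉ S) : u x = 0 :=
  image_eq_zero_of_notMem_tsupport fun h => hx (u.tsupport_subset h)

theorem memLp (u : TestFunction S) : MemLp u 2 (volume.restrict S) :=
  u.continuous.memLp_of_hasCompactSupport u.hasCompactSupport

/-- The class in `L²(S)` of a test function. -/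
def toLp (u : TestFunction S) : Lp ℂ 2 (volume.restrict S) := u.memLp.toLp _

theorem coeFn_toLp (u : TestFunction S) : u.toLp =ᵐ[volume.restrict S] u := u.memLp.coeFn_toLp

/-- The complex conjugate of a test function. -/
def conj (u : TestFunction S) : TestFunction S where
  toFun x := starRingEnd ℂ (u x)
  continuous := Complex.continuous_conj.comp u.continuous
  hasCompactSupport := u.hasCompactSupport.comp_left (map_zero _)
  tsupport_subset := (tsupport_comp_subset (map_zero _) _).trans u.tsupport_subset

theorem conj_apply (u : TestFunction S) (x : ℝ) : u.conj x = starRingEnd ℂ (u x) := rfl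

/-- The product of a continuous function and a test function. -/
def mul (g : ℝ → ℂ) (hg : Continuous g) (u : TestFunction S) : TestFunction S where
  toFun x := g x * u x
  continuous := hg.mul u.continuous
  hasCompactSupport := u.hasCompactSupport.mul_left
  tsupport_subset := (tsupport_mul_subset_right).trans u.tsupport_subset

theorem inner_toLp (u : TestFunction S) (f : Lp ℂ 2 (volume.restrict S)) :
    inner ℂ u.toLp f = ∫ x in S, f x * starRingEnd ℂ (u x) := by
  rw [L2.inner_def]
  refine integral_congr_ae ?_
  filter_upwards [u.coeFn_toLp] with x hx
  rw [hx]
  simp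

theorem eq_zero_of_inner (hS : IsOpen S) {f : Lp ℂ 2 (volume.restrict S)}
    (h : ∀ u : TestFunction S, inner ℂ u.toLp f = 0) : f = 0 := by
  have hloc : LocallyIntegrable f (volume.restrict S) :=
    (Lp.memLp f).locallyIntegrable (by norm_num)
  have h1 := hS.ae_eq_zero_of_integral_contDiff_smul_eq_zero
    (hloc.locallyIntegrableOn S) fun g hg hgc hgS => by
      let u : TestFunction S :=
        { toFun := fun x => (g x : ℂ)
          continuous := Complex.continuous_ofReal.comp hg.continuous
          hasCompactSupport := hgc.comp_left Complex.ofReal_zero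
          tsupport_subset := (tsupport_comp_subset Complex.ofReal_zero _).trans hgS }
      have h2 := h u
      rw [inner_toLp] at h2
      rw [← h2]
      refine integral_congr_ae (ae_of_all _ fun x => ?_)
      change g x • f x = f x * starRingEnd ℂ (g x : ℂ)
      rw [Complex.conj_ofReal, Complex.real_smul, mul_comm]
  rw [Lp.eq_zero_iff_ae_eq_zero]
  filter_upwards [h1, ae_restrict_mem hS.measurableSet] with x hx hxS
  exact hx hxS

theorem eq_of_inner (hS : IsOpen S) {f g : Lp ℂ 2 (volume.restrict S)}
    (h : ∀ u : TestFunction S, inner ℂ u.toLp f = inner ℂ u.toLp g) : f = g := by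
  rw [← sub_eq_zero]
  exact eq_zero_of_inner hS fun u => by rw [inner_sub_right, h, sub_self]

theorem dense_span (hS : IsOpen S) :
    Dense (Submodule.span ℂ (Set.range (toLp (S := S))) : Set (Lp ℂ 2 (volume.restrict S))) := by
  rw [Submodule.dense_iff_topologicalClosure_eq_top, Submodule.topologicalClosure_eq_top_iff,
    Submodule.eq_bot_iff]
  intro f hf
  rw [Submodule.mem_orthogonal] at hf
  exact eq_zero_of_inner hS fun u => hf _ (Submodule.subset_span ⟨u, rfl⟩)

end TestFunction

/-! ### The covariant pair on a half line -/

variable {φ : OriginFlow} {X : ℝ → ℝ} {k : ℕ} {S : Set ℝ}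

/-- The covariant pair `(M, U)` on the `L²` space of a half line. -/
abbrev halfLinePair (φ : OriginFlow) {S : Set ℝ} (hS : IsHalfLine S) :
    CovariantPair φ (Lp ℂ 2 (volume.restrict S)) :=
  OriginFlow.leafPair hS.measurableSet (hS.mapsTo φ)

theorem halfLinePair_rep_congr (hS : IsHalfLine S) {f g : C₀(ℝ, ℂ)} (h : ∀ x ∈ S, f x = g x) :
    (halfLinePair φ hS).rep f = (halfLinePair φ hS).rep g := by
  ext1 ξ
  apply Lp.ext
  change mulOp S f ξ =ᵐ[_] mulOp S g ξ
  filter_upwards [coeFn_mulOp S f ξ, coeFn_mulOp S g ξ, ae_restrict_mem hS.measurableSet]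
    with x h1 h2 hx
  rw [h1, h2, h x hx]

theorem halfLinePair_integratedForm_congr (hS : IsHalfLine S) {F G : C_c(ℝ, C₀(ℝ, ℂ))}
    (h : ∀ t, ∀ x ∈ S, F t x = G t x) :
    (halfLinePair φ hS).integratedForm F = (halfLinePair φ hS).integratedForm G := by
  ext1 ξ
  simp only [CovariantPair.integratedForm_apply]
  refine integral_congr_ae (ae_of_all _ fun t => ?_)
  change (halfLinePair φ hS).rep (F t) _ = (halfLinePair φ hS).rep (G t) _
  rw [halfLinePair_rep_congr hS (h t)]

theorem halfLinePair_integratedForm_eq_zero (hS : IsHalfLine S) {F : C_c(ℝ, C₀(ℝ, ℂ))}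
    (h : ∀ t, ∀ x ∈ S, F t x = 0) : (halfLinePair φ hS).integratedForm F = 0 := by
  have h1 := (halfLinePair φ hS).integratedForm_sub F F
  have h2 : F - F = F - F + 0 := by
    ext
    simp
  rw [sub_self] at h1
  rw [← h1]
  refine halfLinePair_integratedForm_congr hS fun t x hx => ?_
  rw [h t x hx]
  simp

theorem coeFn_halfLinePair (hS : IsHalfLine S) (f : C₀(ℝ, ℂ)) (t : ℝ)
    (ξ : Lp ℂ 2 (volume.restrict S)) :
    (halfLinePair φ hS).rep f ((halfLinePair φ hS).U t ξ) =ᵐ[volume.restrict S]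
      fun x => f x * φ.transport (-t) ξ x := by
  change mulOp S f (OriginFlow.leafU _ _ t ξ) =ᵐ[_] _
  filter_upwards [coeFn_mulOp S f (OriginFlow.leafU hS.measurableSet (hS.mapsTo φ) t ξ),
    OriginFlow.coeFn_leafU hS.measurableSet (hS.mapsTo φ) t ξ] with x h1 h2
  rw [h1, h2]
  rfl

/-! ### Rank one operators as integrated forms -/

section RankOne

/-- The weight by which the operator with kernel `1` in the coordinate `x` differs from the
integrated form in the variable `t`. -/
def weight (φ : OriginFlow) (X : ℝ → ℝ) (t x : ℝ) : ℝ :=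
  |X (φ (-t) x)| / Real.sqrt (deriv (φ (-t)) x)

theorem continuous_flow_neg (φ : OriginFlow) : Continuous fun p : ℝ × ℝ => φ (-p.1) p.2 :=
  φ.continuous_uncurry.comp (by fun_prop : Continuous fun p : ℝ × ℝ => (-p.1, p.2))

theorem continuous_weight (hX : IsGenerator k X) :
    Continuous fun p : ℝ × ℝ => weight φ X p.1 p.2 := by
  refine Continuous.div ?_ ?_ fun p => (Real.sqrt_pos.2 (φ.deriv_pos _ _)).ne'
  · exact (hX.1.continuous.comp (continuous_flow_neg φ)).abs
  · exact Real.continuous_sqrt.comp (φ.continuous_deriv.comp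
      (by fun_prop : Continuous fun p : ℝ × ℝ => (-p.1, p.2)))

theorem hasCompactSupport_orbit (hX : IsGenerator k X) (hφ : φ.IsFlowOf X) (hS : IsHalfLine S)
    {E : Type*} [Zero E] {f : ℝ → ℝ → E} (ξ η : TestFunction S)
    (h1 : ∀ t x, ξ x = 0 → f t x = 0) (h2 : ∀ t x, η (φ (-t) x) = 0 → f t x = 0) :
    HasCompactSupport fun p : ℝ × ℝ => f p.1 p.2 := by
  obtain ⟨x₀, hx₀⟩ := hS.nonempty
  have hc : ContinuousOn (flowTime X x₀) S := fun x hx =>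
    (hasDerivAt_flowTime hX hS hx₀ hx).continuousAt.continuousWithinAt
  -- If `y = φ (-t) x`, then `t` is the difference of the time coordinates of `x` and `y`. So
  -- compactness in `x` and `y` gives compactness in `(t, x)`.
  have hK : IsCompact ((fun p : ℝ × ℝ => (flowTime X x₀ p.1 - flowTime X x₀ p.2, p.1)) ''
      (tsupport ξ ×ˢ tsupport η)) := by
    refine (ξ.hasCompactSupport.isCompact.prod η.hasCompactSupport.isCompact).image_of_continuousOn ?_
    refine ContinuousOn.prodMk (ContinuousOn.sub ?_ ?_) continuousOn_fst
    · exact (hc.mono ξ.tsupport_subset).comp continuousOn_fst fun p hp => hp.1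
    · exact (hc.mono η.tsupport_subset).comp continuousOn_snd fun p hp => hp.2
  refine HasCompactSupport.intro hK fun p hp => ?_
  by_contra h
  have h3 : ξ p.2 ≠ 0 := fun h0 => h (h1 _ _ h0)
  have h4 : η (φ (-p.1) p.2) ≠ 0 := fun h0 => h (h2 _ _ h0)
  have h5 := subset_tsupport _ h3
  refine hp ⟨(p.2, φ (-p.1) p.2), ⟨h5, subset_tsupport _ h4⟩, ?_⟩
  ext
  · simp only
    rw [flowTime_flow hX hφ hS hx₀ (ξ.tsupport_subset h5)]
    ring
  · rfl

/-- The element of `C_c(ℝ, C₀(ℝ))` whose integrated form is the operator with kernel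
`ξ(x) η(y)`. -/
def rankOneKernel (hX : IsGenerator k X) (hφ : φ.IsFlowOf X) (hS : IsHalfLine S)
    (ξ η : TestFunction S) : C_c(ℝ, C₀(ℝ, ℂ)) :=
  ofKernel (fun t x => ξ x * η (φ (-t) x) * (weight φ X t x : ℂ))
    (((ξ.continuous.comp continuous_snd).mul (η.continuous.comp (continuous_flow_neg φ))).mul
      (Complex.continuous_ofReal.comp (continuous_weight hX)))
    (hasCompactSupport_orbit hX hφ hS
      (f := fun t x => ξ x * η (φ (-t) x) * (weight φ X t x : ℂ)) ξ η
      (fun t x h => by rw [h, zero_mul, zero_mul]) (fun t x h => by rw [h, mul_zero, zero_mul]))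

theorem rankOneKernel_apply (hX : IsGenerator k X) (hφ : φ.IsFlowOf X) (hS : IsHalfLine S)
    (ξ η : TestFunction S) (t x : ℝ) :
    rankOneKernel hX hφ hS ξ η t x = ξ x * η (φ (-t) x) * (weight φ X t x : ℂ) := rfl

/-- The orbit map `t ↦ φ (-t) x` is a bijection of the line onto `S` with Jacobian `|X (φ (-t) x)|`.
-/
theorem integral_orbit (hX : IsGenerator k X) (hφ : φ.IsFlowOf X) (hS : IsHalfLine S) {x : ℝ}
    (hx : x ∈ S) (g : ℝ → ℂ) :
    ∫ t, ((|X (φ (-t) x)| : ℝ) : ℂ) * g (φ (-t) x) = ∫ y in S, g y := by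
  have himg : (fun t => φ (-t) x) '' univ = S := by
    ext y
    constructor
    · rintro ⟨t, -, rfl⟩
      exact hS.mapsTo φ _ hx
    · intro hy
      refine ⟨-flowTime X x y, mem_univ _, ?_⟩
      simp only [neg_neg]
      exact flow_flowTime hX hφ hS hx hy
  have h1 := integral_image_eq_integral_abs_deriv_smul (s := univ) (f := fun t => φ (-t) x)
    (f' := fun t => -X (φ (-t) x)) MeasurableSet.univ
    (fun t _ => by
      have h2 := (hφ.hasDerivAt_time (-t) x).comp t (hasDerivAt_neg t)
      rw [mul_neg_one] at h2
      exact h2.hasDerivWithinAt)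
    ((flow_injective hX hφ hS hx).comp neg_injective).injOn g
  rw [himg, Measure.restrict_univ] at h1
  rw [h1]
  refine integral_congr_ae (ae_of_all _ fun t => ?_)
  simp only [abs_neg, Complex.real_smul]

open InnerProductSpace in
-- The weight cancels the square root in `U t` and supplies the Jacobian of the orbit map. Tested
-- against functions of compact support, the time integral therefore becomes `∫ η ζ` over `S`,
-- independent of `x`. The conjugate of `η` appears because `rankOne` is conjugate linear in its
-- second vector.
theorem integratedForm_rankOneKernel (hX : IsGenerator k X) (hφ : φ.IsFlowOf X)
    (hS : IsHalfLine S) (ξ η : TestFunction S) :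
    (halfLinePair φ hS).integratedForm (rankOneKernel hX hφ hS ξ η) =
      rankOne ℂ ξ.toLp η.conj.toLp := by
  refine ContinuousLinearMap.ext_on (TestFunction.dense_span hS.isOpen) ?_
  rintro _ ⟨ζ, rfl⟩
  refine TestFunction.eq_of_inner hS.isOpen fun v => ?_
  rw [CovariantPair.integratedForm_apply, ← integral_inner (CovariantPair.integrable _ _ _),
    rankOne_apply, inner_smul_right, TestFunction.inner_toLp, TestFunction.inner_toLp]
  have h1 : ∀ t, inner ℂ v.toLp ((halfLinePair φ hS).rep (rankOneKernel hX hφ hS ξ η t)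
      ((halfLinePair φ hS).U t ζ.toLp)) = ∫ x in S, (starRingEnd ℂ (v x) * ξ x) *
        (((|X (φ (-t) x)| : ℝ) : ℂ) * (η (φ (-t) x) * ζ (φ (-t) x))) := fun t => by
    rw [TestFunction.inner_toLp]
    refine integral_congr_ae ?_
    filter_upwards [coeFn_halfLinePair (φ := φ) hS (rankOneKernel hX hφ hS ξ η t) t ζ.toLp,
      OriginFlow.transport_ae_congr hS.measurableSet (hS.mapsTo φ) (-t) ζ.coeFn_toLp] with x hx1 hx2
    rw [hx1, hx2, rankOneKernel_apply, weight, OriginFlow.transport]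
    have hd : (Real.sqrt (deriv (φ (-t)) x) : ℂ) ≠ 0 :=
      Complex.ofReal_ne_zero.2 (Real.sqrt_pos.2 (φ.deriv_pos _ _)).ne'
    push_cast
    field_simp
  have hcont : Continuous fun p : ℝ × ℝ => (starRingEnd ℂ (v p.2) * ξ p.2) *
      (((|X (φ (-p.1) p.2)| : ℝ) : ℂ) * (η (φ (-p.1) p.2) * ζ (φ (-p.1) p.2))) := by
    have hf := continuous_flow_neg φ
    exact ((Complex.continuous_conj.comp (v.continuous.comp continuous_snd)).mul
      (ξ.continuous.comp continuous_snd)).mul ((Complex.continuous_ofReal.comp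
        (hX.1.continuous.comp hf).abs).mul ((η.continuous.comp hf).mul (ζ.continuous.comp hf)))
  have hsupp : HasCompactSupport fun p : ℝ × ℝ => (starRingEnd ℂ (v p.2) * ξ p.2) *
      (((|X (φ (-p.1) p.2)| : ℝ) : ℂ) * (η (φ (-p.1) p.2) * ζ (φ (-p.1) p.2))) :=
    hasCompactSupport_orbit hX hφ hS (f := fun t x => (starRingEnd ℂ (v x) * ξ x) *
      (((|X (φ (-t) x)| : ℝ) : ℂ) * (η (φ (-t) x) * ζ (φ (-t) x)))) ξ η
      (fun t x h => by simp [h]) (fun t x h => by simp [h])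
  have hswap : ∫ t, ∫ x in S, (starRingEnd ℂ (v x) * ξ x) *
      (((|X (φ (-t) x)| : ℝ) : ℂ) * (η (φ (-t) x) * ζ (φ (-t) x))) =
      ∫ x in S, ∫ t, (starRingEnd ℂ (v x) * ξ x) *
      (((|X (φ (-t) x)| : ℝ) : ℂ) * (η (φ (-t) x) * ζ (φ (-t) x))) :=
    integral_integral_swap_of_hasCompactSupport (f := fun t x => (starRingEnd ℂ (v x) * ξ x) *
      (((|X (φ (-t) x)| : ℝ) : ℂ) * (η (φ (-t) x) * ζ (φ (-t) x)))) hcont hsupp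
  rw [integral_congr_ae (ae_of_all _ h1), hswap]
  have h2 : ∀ᵐ x ∂volume.restrict S, ∫ t, (starRingEnd ℂ (v x) * ξ x) *
      (((|X (φ (-t) x)| : ℝ) : ℂ) * (η (φ (-t) x) * ζ (φ (-t) x))) =
      (starRingEnd ℂ (v x) * ξ x) * ∫ y in S, η y * ζ y := by
    filter_upwards [ae_restrict_mem hS.measurableSet] with x hx
    rw [integral_const_mul, integral_orbit hX hφ hS hx fun y => η y * ζ y]
  rw [integral_congr_ae h2, integral_mul_const, mul_comm]
  congr 1
  · refine integral_congr_ae ?_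
    filter_upwards [ζ.coeFn_toLp] with x hx
    rw [hx, TestFunction.conj_apply, Complex.conj_conj, mul_comm]
  · refine integral_congr_ae ?_
    filter_upwards [ξ.coeFn_toLp] with x hx
    rw [hx, mul_comm]

end RankOne

/-! ### The compact operators lie in the image algebra -/

theorem CovariantPair.integratedForm_directSum {H₁ H₂ : Type} [NormedAddCommGroup H₁]
    [InnerProductSpace ℂ H₁] [NormedAddCommGroup H₂] [InnerProductSpace ℂ H₂] [CompleteSpace H₁]
    [CompleteSpace H₂] (π₁ : CovariantPair φ H₁) (π₂ : CovariantPair φ H₂)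
    (F : C_c(ℝ, C₀(ℝ, ℂ))) : (π₁.directSum π₂).integratedForm F =
      opSum (π₁.integratedForm F) (π₂.integratedForm F) := by
  ext1 ξ
  have hint := (π₁.directSum π₂).integrable F ξ
  apply WithLp.ofLp_injective
  apply Prod.ext
  · exact ((WithLp.fstL 2 ℂ H₁ H₂).integral_comp_comm hint).symm
  · exact ((WithLp.sndL 2 ℂ H₁ H₂).integral_comp_comm hint).symm

theorem isHalfLine_Iio : IsHalfLine (Iio 0) := Or.inl rfl

theorem isHalfLine_Ioi : IsHalfLine (Ioi 0) := Or.inr rfl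

theorem canonicalPair_integratedForm (F : C_c(ℝ, C₀(ℝ, ℂ))) :
    (canonicalPair φ).integratedForm F =
      opSum ((halfLinePair φ isHalfLine_Iio).integratedForm F)
        ((halfLinePair φ isHalfLine_Ioi).integratedForm F) :=
  CovariantPair.integratedForm_directSum _ _ F

/-- A rank one kernel supported over one half line acts as `0` on the other, so each summand can be
treated separately; rank one operators given by test functions generate all compact ones. -/
theorem compactSum_subset_imageAlgebra (hX : IsGenerator k X) (hφ : φ.IsFlowOf X) :
    compactSum ⊆ (imageAlgebra φ : Set (HalfLines →L[ℂ] HalfLines)) := by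
  have hcl : IsClosed (imageAlgebra φ : Set (HalfLines →L[ℂ] HalfLines)) := by
    rw [coe_imageAlgebra]
    exact isClosed_closure
  have hF : ∀ F, (canonicalPair φ).integratedForm F ∈ imageAlgebra φ := fun F => by
    rw [← SetLike.mem_coe, coe_imageAlgebra]
    exact subset_closure ⟨F, rfl⟩
  let A : Submodule ℂ (HalfLines →L[ℂ] HalfLines) := (imageAlgebra φ).toSubmodule
  let L := opSumL (Lp ℂ 2 (volume.restrict (Iio (0 : ℝ)))) (Lp ℂ 2 (volume.restrict (Ioi (0 : ℝ))))
  rintro _ ⟨P, Q, hP, hQ, rfl⟩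
  have h1 : opSum P (0 : Lp ℂ 2 (volume.restrict (Ioi (0 : ℝ))) →L[ℂ] _) ∈ A := by
    let L₁ := L.comp (ContinuousLinearMap.inl ℂ _ _)
    refine mem_of_isCompactOperator (TestFunction.dense_span isHalfLine_Iio.isOpen)
      (A.comap L₁.toLinearMap) (hcl.preimage L₁.continuous) ?_ hP
    rintro _ ⟨ξ, rfl⟩ _ ⟨η, rfl⟩
    have h2 := hF (rankOneKernel hX hφ isHalfLine_Iio ξ η.conj)
    rw [canonicalPair_integratedForm, integratedForm_rankOneKernel,
      halfLinePair_integratedForm_eq_zero isHalfLine_Ioi fun t x hx => by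
        rw [rankOneKernel_apply, ξ.apply_eq_zero (fun h => lt_asymm (mem_Ioi.1 hx) (mem_Iio.1 h)), zero_mul, zero_mul]] at h2
    have h3 : η.conj.conj = η := by
      cases η
      simp [TestFunction.conj]
    rw [h3] at h2
    exact h2
  have h2 : opSum (0 : Lp ℂ 2 (volume.restrict (Iio (0 : ℝ))) →L[ℂ] _) Q ∈ A := by
    let L₂ := L.comp (ContinuousLinearMap.inr ℂ _ _)
    refine mem_of_isCompactOperator (TestFunction.dense_span isHalfLine_Ioi.isOpen)
      (A.comap L₂.toLinearMap) (hcl.preimage L₂.continuous) ?_ hQ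
    rintro _ ⟨ξ, rfl⟩ _ ⟨η, rfl⟩
    have h2 := hF (rankOneKernel hX hφ isHalfLine_Ioi ξ η.conj)
    rw [canonicalPair_integratedForm, integratedForm_rankOneKernel,
      halfLinePair_integratedForm_eq_zero isHalfLine_Iio fun t x hx => by
        rw [rankOneKernel_apply, ξ.apply_eq_zero (fun h => lt_asymm (mem_Iio.1 hx) (mem_Ioi.1 h)), zero_mul, zero_mul]] at h2
    have h3 : η.conj.conj = η := by
      cases η
      simp [TestFunction.conj]
    rw [h3] at h2
    exact h2
  have h3 : opSum P Q = opSum P 0 + opSum 0 Q := by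
    have := map_add L (P, 0) (0, Q)
    simpa [L, opSumL_apply] using this
  rw [h3]
  exact A.add_mem h1 h2

end

/-! ### Compactness of integrated forms that vanish at the origin -/

section

variable {φ : OriginFlow} {X : ℝ → ℝ} {k : ℕ} {S : Set ℝ}

theorem norm_mulOp_le (hS : IsHalfLine S) {f : C₀(ℝ, ℂ)} {c : ℝ} (hc : 0 ≤ c)
    (h : ∀ x ∈ S, ‖f x‖ ≤ c) : ‖mulOp S f‖ ≤ c := by
  refine ContinuousLinearMap.opNorm_le_bound _ hc fun ξ => ?_
  refine Lp.norm_le_mul_norm_of_ae_le_mul ?_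
  filter_upwards [coeFn_mulOp S f ξ, ae_restrict_mem hS.measurableSet] with x hx hxS
  rw [hx, norm_mul]
  exact mul_le_mul_of_nonneg_right (h x hxS) (norm_nonneg _)

theorem norm_halfLinePair_integratedForm_le (hS : IsHalfLine S) {F : C_c(ℝ, C₀(ℝ, ℂ))} {T : Set ℝ}
    (hT : IsCompact T) (hFT : ∀ t ∉ T, ∀ x ∈ S, F t x = 0) {c : ℝ} (hc : 0 ≤ c)
    (h : ∀ t, ∀ x ∈ S, ‖F t x‖ ≤ c) :
    ‖(halfLinePair φ hS).integratedForm F‖ ≤ c * volume.real T := by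
  refine ContinuousLinearMap.opNorm_le_bound _ (by positivity) fun ξ => ?_
  rw [CovariantPair.integratedForm_apply, ← setIntegral_eq_integral_of_forall_compl_eq_zero (s := T)]
  · have hb : ∀ t ∈ T, ‖(halfLinePair φ hS).rep (F t) ((halfLinePair φ hS).U t ξ)‖ ≤ c * ‖ξ‖ := by
      intro t _
      refine (ContinuousLinearMap.le_opNorm _ _).trans ?_
      rw [LinearIsometryEquiv.norm_map]
      gcongr
      exact norm_mulOp_le hS hc (h t)
    refine (norm_setIntegral_le_of_norm_le_const hT.measure_lt_top hb).trans (le_of_eq ?_)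
    ring
  · intro t ht
    have h1 : (halfLinePair φ hS).rep (F t) = 0 := by
      rw [← map_zero (halfLinePair φ hS).rep]
      exact halfLinePair_rep_congr hS (hFT t ht)
    rw [h1, _root_.zero_apply]

theorem TestFunction.exists_eq_one {K : Set ℝ} (hS : IsOpen S) (hK : IsCompact K) (hKS : K ⊆ S) :
    ∃ u : TestFunction S, (∀ x ∈ K, u x = 1) ∧ ∀ x, ‖u x‖ ≤ 1 ∧ ‖1 - u x‖ ≤ 1 := by
  obtain ⟨L, hL, hKL, hLS⟩ := exists_compact_between hK hS hKS
  obtain ⟨f, hf1, hf0, hfc, hf⟩ := exists_continuous_one_zero_of_isCompact hK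
    (isOpen_interior (s := L)).isClosed_compl (disjoint_compl_right_iff_subset.2 hKL)
  refine ⟨⟨fun x => (f x : ℂ), Complex.continuous_ofReal.comp f.continuous,
    hfc.comp_left Complex.ofReal_zero, ?_⟩, fun x hx => ?_, fun x => ⟨?_, ?_⟩⟩
  · refine (closure_minimal (fun x hx => ?_) hL.isClosed).trans hLS
    by_contra hxL
    refine hx ?_
    have h1 : f x = 0 := hf0 fun h => hxL (interior_subset h)
    change ((f x : ℝ) : ℂ) = 0
    rw [h1, Complex.ofReal_zero]
  · change ((f x : ℝ) : ℂ) = 1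
    rw [hf1 hx]
    simp
  · change ‖((f x : ℝ) : ℂ)‖ ≤ 1
    rw [Complex.norm_real, Real.norm_of_nonneg (hf x).1]
    exact (hf x).2
  · change ‖1 - ((f x : ℝ) : ℂ)‖ ≤ 1
    rw [← Complex.ofReal_one, ← Complex.ofReal_sub, Complex.norm_real,
      Real.norm_of_nonneg (by linarith [(hf x).2])]
    linarith [(hf x).1]

theorem weight_pos (hX : IsGenerator k X) (hS : IsHalfLine S) (t : ℝ) {x : ℝ} (hx : x ∈ S) :
    0 < weight φ X t x :=
  div_pos (abs_pos.2 (hX.ne_zero (hS.ne_zero (hS.mapsTo φ _ hx))))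
    (Real.sqrt_pos.2 (φ.deriv_pos _ _))

/-! ### Approximation of kernels by finite rank kernels -/

section StoneWeierstrass

/-- The products `u(x) v(φ_{-t}(x))`, as functions of `(t, x)`. -/
def orbitProducts (φ : OriginFlow) : Submonoid C(ℝ × ℝ, ℝ) where
  carrier := {g | ∃ u v : C(ℝ, ℝ), ∀ p, g p = u p.2 * v (φ (-p.1) p.2)}
  one_mem' := ⟨1, 1, fun p => by simp⟩
  mul_mem' := by
    rintro g h ⟨u, v, hg⟩ ⟨u', v', hh⟩
    refine ⟨u * u', v * v', fun p => ?_⟩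
    simp only [ContinuousMap.mul_apply, hg, hh]
    ring

/-- The algebra of functions of `(t, x)` spanned by the products `u(x) v(φ_{-t}(x))`. -/
def orbitAlgebra (φ : OriginFlow) : Subalgebra ℝ C(ℝ × ℝ, ℝ) :=
  Algebra.adjoin ℝ (orbitProducts φ : Set C(ℝ × ℝ, ℝ))

/-- The restriction of functions to `ℝ × S`. -/
def restrictHalf (S : Set ℝ) : C(ℝ × ℝ, ℝ) →⋆ₐ[ℝ] C(ℝ × S, ℝ) :=
  ContinuousMap.compStarAlgHom' ℝ ℝ ⟨fun p : ℝ × S => (p.1, (p.2 : ℝ)), by fun_prop⟩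

theorem restrictHalf_apply (g : C(ℝ × ℝ, ℝ)) (p : ℝ × S) :
    restrictHalf S g p = g (p.1, (p.2 : ℝ)) := rfl

/-- The coordinate `x` separates different positions; at equal positions `φ (-t) x` separates the
times, because the orbit is free. -/
theorem separatesPoints_orbitAlgebra (hX : IsGenerator k X) (hφ : φ.IsFlowOf X)
    (hS : IsHalfLine S) :
    ((orbitAlgebra φ).map (restrictHalf S : C(ℝ × ℝ, ℝ) →ₐ[ℝ] C(ℝ × S, ℝ))).SeparatesPoints := by
  rintro ⟨t, x⟩ ⟨s, y⟩ hne
  by_cases hxy : (x : ℝ) = y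
  · refine ⟨restrictHalf S ⟨fun p => φ (-p.1) p.2, continuous_flow_neg φ⟩, ⟨_, ⟨_, ?_, rfl⟩, rfl⟩, ?_⟩
    · exact Algebra.subset_adjoin ⟨1, ContinuousMap.id ℝ, fun p => by simp⟩
    · rw [restrictHalf_apply, restrictHalf_apply]
      simp only [ContinuousMap.coe_mk]
      rw [← hxy]
      intro h
      have h1 := flow_injective hX hφ hS x.2 h
      exact hne (Prod.ext (neg_injective h1) (Subtype.ext hxy))
  · refine ⟨restrictHalf S ⟨fun p => p.2, continuous_snd⟩, ⟨_, ⟨_, ?_, rfl⟩, rfl⟩, hxy⟩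
    exact Algebra.subset_adjoin ⟨ContinuousMap.id ℝ, 1, fun p => by simp⟩

/-- The function `ξ(x) η(φ_{-t}(x)) w(t, x) g(t, x)`, where `w` is the weight. -/
def orbitKernel (hX : IsGenerator k X) (hφ : φ.IsFlowOf X) (hS : IsHalfLine S)
    (ξ η : TestFunction S) (g : C(ℝ × ℝ, ℝ)) : C_c(ℝ, C₀(ℝ, ℂ)) :=
  ofKernel (fun t x => ξ x * η (φ (-t) x) * (weight φ X t x : ℂ) * (g (t, x) : ℂ))
    ((((ξ.continuous.comp continuous_snd).mul (η.continuous.comp (continuous_flow_neg φ))).mul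
      (Complex.continuous_ofReal.comp (continuous_weight hX))).mul
        (Complex.continuous_ofReal.comp g.continuous))
    (hasCompactSupport_orbit hX hφ hS
      (f := fun t x => ξ x * η (φ (-t) x) * (weight φ X t x : ℂ) * (g (t, x) : ℂ)) ξ η
      (fun t x h => by rw [h, zero_mul, zero_mul, zero_mul])
      (fun t x h => by rw [h, mul_zero, zero_mul, zero_mul]))

theorem orbitKernel_apply (hX : IsGenerator k X) (hφ : φ.IsFlowOf X) (hS : IsHalfLine S)
    (ξ η : TestFunction S) (g : C(ℝ × ℝ, ℝ)) (t x : ℝ) : orbitKernel hX hφ hS ξ η g t x =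
      ξ x * η (φ (-t) x) * (weight φ X t x : ℂ) * (g (t, x) : ℂ) := rfl

/-- The products form a monoid, so the algebra they generate is their linear span. The factors of a
product are absorbed into `ξ` and `η`, which gives a rank one operator. -/
theorem isCompactOperator_orbitKernel (hX : IsGenerator k X) (hφ : φ.IsFlowOf X)
    (hS : IsHalfLine S) (ξ η : TestFunction S) {g : C(ℝ × ℝ, ℝ)} (hg : g ∈ orbitAlgebra φ) :
    IsCompactOperator ((halfLinePair φ hS).integratedForm (orbitKernel hX hφ hS ξ η g)) := by
  have hg' : g ∈ Submodule.span ℝ (orbitProducts φ : Set C(ℝ × ℝ, ℝ)) := by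
    have h1 : g ∈ Subalgebra.toSubmodule (orbitAlgebra φ) := hg
    rwa [orbitAlgebra, Algebra.adjoin_eq_span, Submonoid.closure_eq] at h1
  clear hg
  induction hg' using Submodule.span_induction with
  | mem g hg =>
    obtain ⟨u, v, huv⟩ := hg
    have h1 : (halfLinePair φ hS).integratedForm (orbitKernel hX hφ hS ξ η g) =
        (halfLinePair φ hS).integratedForm (rankOneKernel hX hφ hS
          (ξ.mul (fun x => (u x : ℂ)) (Complex.continuous_ofReal.comp u.continuous))
          (η.mul (fun x => (v x : ℂ)) (Complex.continuous_ofReal.comp v.continuous))) := by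
      refine halfLinePair_integratedForm_congr hS fun t x _ => ?_
      rw [orbitKernel_apply, rankOneKernel_apply, huv]
      simp only [TestFunction.mul]
      push_cast
      ring
    rw [h1, integratedForm_rankOneKernel]
    exact isCompactOperator_rankOne _ _
  | zero =>
    rw [halfLinePair_integratedForm_eq_zero hS fun t x _ => by
      rw [orbitKernel_apply, ContinuousMap.zero_apply, Complex.ofReal_zero, mul_zero]]
    exact isCompactOperator_zero
  | add g h _ _ ihg ihh =>
    have h1 : (halfLinePair φ hS).integratedForm (orbitKernel hX hφ hS ξ η (g + h)) =
        (halfLinePair φ hS).integratedForm (orbitKernel hX hφ hS ξ η g) +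
          (halfLinePair φ hS).integratedForm (orbitKernel hX hφ hS ξ η h) := by
      rw [← CovariantPair.integratedForm_add]
      refine halfLinePair_integratedForm_congr hS fun t x _ => ?_
      change orbitKernel hX hφ hS ξ η (g + h) t x =
        orbitKernel hX hφ hS ξ η g t x + orbitKernel hX hφ hS ξ η h t x
      rw [orbitKernel_apply, orbitKernel_apply, orbitKernel_apply, ContinuousMap.add_apply]
      push_cast
      ring
    rw [h1]
    exact ihg.add ihh
  | smul c g _ ih =>
    have h1 : (halfLinePair φ hS).integratedForm (orbitKernel hX hφ hS ξ η (c • g)) =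
        (c : ℂ) • (halfLinePair φ hS).integratedForm (orbitKernel hX hφ hS ξ η g) := by
      rw [← CovariantPair.integratedForm_smul]
      refine halfLinePair_integratedForm_congr hS fun t x _ => ?_
      change orbitKernel hX hφ hS ξ η (c • g) t x = (c : ℂ) * orbitKernel hX hφ hS ξ η g t x
      rw [orbitKernel_apply, orbitKernel_apply, ContinuousMap.smul_apply, smul_eq_mul]
      push_cast
      ring
    rw [h1]
    exact ih.smul (c : ℂ)

/-- The quotient of the kernel by the positive weight is approximated uniformly on a compact set by
the orbit algebra. The cut-offs `ξ` and `η` confine the error to that set, and compact operators are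
closed in norm. -/
theorem isCompactOperator_of_kernel_real (hX : IsGenerator k X) (hφ : φ.IsFlowOf X)
    (hS : IsHalfLine S) {r : ℝ → ℝ → ℝ} (hr : Continuous fun p : ℝ × ℝ => r p.1 p.2)
    {Q : Set (ℝ × ℝ)} (hQ : IsCompact Q) (hQS : ∀ p ∈ Q, p.2 ∈ S)
    (hrQ : ∀ t x, (t, x) ∉ Q → r t x = 0) {F : C_c(ℝ, C₀(ℝ, ℂ))}
    (hF : ∀ t, ∀ x ∈ S, F t x = (r t x : ℂ)) :
    IsCompactOperator ((halfLinePair φ hS).integratedForm F) := by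
  obtain ⟨ξ, hξ1, hξ⟩ := TestFunction.exists_eq_one hS.isOpen (hQ.image continuous_snd)
    (by rintro _ ⟨p, hp, rfl⟩; exact hQS p hp)
  obtain ⟨η, hη1, hη⟩ := TestFunction.exists_eq_one hS.isOpen (hQ.image (continuous_flow_neg φ))
    (by rintro _ ⟨p, hp, rfl⟩; exact hS.mapsTo φ _ (hQS p hp))
  set P : Set (ℝ × ℝ) := tsupport fun p : ℝ × ℝ => ξ p.2 * η (φ (-p.1) p.2) with hP
  have hPc : IsCompact P := (hasCompactSupport_orbit hX hφ hS
    (f := fun t x => ξ x * η (φ (-t) x)) ξ η (fun t x h => by rw [h, zero_mul])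
    (fun t x h => by rw [h, mul_zero])).isCompact
  have hPS : ∀ p ∈ P, p.2 ∈ S := by
    intro p hp
    have h1 : P ⊆ Prod.snd ⁻¹' tsupport ξ := by
      refine closure_minimal (fun q hq => ?_) ((isClosed_tsupport _).preimage continuous_snd)
      exact subset_tsupport _ fun h => hq (by simp [h])
    exact ξ.tsupport_subset (h1 hp)
  have hQP : ∀ p ∈ Q, ξ p.2 * η (φ (-p.1) p.2) = 1 := fun p hp => by
    rw [hξ1 p.2 ⟨p, hp, rfl⟩, hη1 _ ⟨p, hp, rfl⟩, mul_one]
  obtain ⟨C, hC⟩ := hPc.exists_bound_of_continuousOn (continuous_weight (φ := φ) hX).continuousOn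
  let f : C(ℝ × S, ℝ) := ⟨fun p => r p.1 p.2 / weight φ X p.1 p.2, by
    refine Continuous.div ?_ ?_ fun p => (weight_pos hX hS _ p.2.2).ne'
    · exact hr.comp (by fun_prop : Continuous fun p : ℝ × S => (p.1, (p.2 : ℝ)))
    · exact (continuous_weight hX).comp (by fun_prop : Continuous fun p : ℝ × S => (p.1, (p.2 : ℝ)))⟩
  let ι : ℝ × S → ℝ × ℝ := fun p => (p.1, (p.2 : ℝ))
  have hι : IsCompact (ι ⁻¹' P) := by
    have he : IsInducing ι := IsInducing.id.prodMap IsInducing.subtypeVal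
    refine he.isCompact_preimage' hPc fun p hp => ?_
    exact ⟨(p.1, ⟨p.2, hPS p hp⟩), rfl⟩
  have hcl := isClosed_setOfPred_isCompactOperator (𝕜₁ := ℂ) (𝕜₂ := ℂ) (σ₁₂ := RingHom.id ℂ)
    (M₁ := Lp ℂ 2 (volume.restrict S)) (M₂ := Lp ℂ 2 (volume.restrict S))
  refine hcl.closure_subset (Metric.mem_closure_iff.2 fun ε hε => ?_)
  -- The error of the quotient is multiplied by the weight, at most `|C| + 1` on `P`, and integrated
  -- over the times occurring in `P`.
  set δ : ℝ := ε / ((|C| + 1) * (volume.real (Prod.fst '' P) + 1)) with hδ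
  have hδ0 : 0 < δ := by positivity
  obtain ⟨_, ⟨g, hg, rfl⟩, hgf⟩ :=
    ContinuousMap.exists_mem_subalgebra_near_continuous_of_isCompact_of_separatesPoints
      (separatesPoints_orbitAlgebra hX hφ hS) f hι hδ0
  refine ⟨_, isCompactOperator_orbitKernel hX hφ hS ξ η hg, ?_⟩
  rw [dist_eq_norm, ← CovariantPair.integratedForm_sub]
  have hdiff : ∀ t, ∀ x ∈ S, (t, x) ∈ P →
      ‖(F - orbitKernel hX hφ hS ξ η g) t x‖ ≤ (|C| + 1) * δ := by
    intro t x hx hp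
    change ‖F t x - orbitKernel hX hφ hS ξ η g t x‖ ≤ _
    have hw := weight_pos (φ := φ) hX hS t hx
    have h1 : F t x - orbitKernel hX hφ hS ξ η g t x =
        ξ x * η (φ (-t) x) * (weight φ X t x : ℂ) * ((r t x / weight φ X t x - g (t, x) : ℝ) : ℂ) := by
      rw [hF t x hx, orbitKernel_apply]
      have hw' : (weight φ X t x : ℂ) ≠ 0 := Complex.ofReal_ne_zero.2 hw.ne'
      have h2 : (r t x : ℂ) = ξ x * η (φ (-t) x) * (r t x : ℂ) := by
        by_cases hq : (t, x) ∈ Q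
        · rw [hQP _ hq, one_mul]
        · rw [hrQ t x hq, Complex.ofReal_zero, mul_zero]
      rw [h2]
      push_cast
      field_simp
    rw [h1, norm_mul, norm_mul, norm_mul, Complex.norm_real, Complex.norm_real]
    have h3 : ‖r t x / weight φ X t x - g (t, x)‖ < δ := by
      rw [norm_sub_rev]
      exact hgf (t, ⟨x, hx⟩) hp
    have h4 : ‖weight φ X t x‖ ≤ |C| + 1 := by
      have := hC (t, x) hp
      linarith [le_abs_self C]
    calc ‖ξ x‖ * ‖η (φ (-t) x)‖ * ‖weight φ X t x‖ * ‖r t x / weight φ X t x - g (t, x)‖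
        ≤ 1 * 1 * (|C| + 1) * δ := by
          gcongr
          exacts [(hξ x).1, (hη _).1]
      _ = (|C| + 1) * δ := by ring
  have hout : ∀ t x, x ∈ S → (t, x) ∉ P → (F - orbitKernel hX hφ hS ξ η g) t x = 0 := by
    intro t x hx hp
    change F t x - orbitKernel hX hφ hS ξ η g t x = 0
    have h1 : ξ x * η (φ (-t) x) = 0 :=
      image_eq_zero_of_notMem_tsupport (f := fun p : ℝ × ℝ => ξ p.2 * η (φ (-p.1) p.2)) hp
    have h2 : (t, x) ∉ Q := fun hq => one_ne_zero ((hQP _ hq).symm.trans h1)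
    rw [hF t x hx, hrQ t x h2, orbitKernel_apply, h1, zero_mul, zero_mul, Complex.ofReal_zero,
      sub_zero]
  refine lt_of_le_of_lt (norm_halfLinePair_integratedForm_le hS (hPc.image continuous_fst)
    (fun t ht x hx => hout t x hx fun hp => ht ⟨_, hp, rfl⟩) (c := (|C| + 1) * δ) (by positivity)
    fun t x hx => ?_) ?_
  · by_cases hp : (t, x) ∈ P
    · exact hdiff t x hx hp
    · rw [hout t x hx hp, norm_zero]
      positivity
  · have hv : (0 : ℝ) ≤ volume.real (Prod.fst '' P) := measureReal_nonneg
    rw [hδ]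
    field_simp
    linarith

end StoneWeierstrass

theorem isCompactOperator_of_kernel (hX : IsGenerator k X) (hφ : φ.IsFlowOf X)
    (hS : IsHalfLine S) {f : ℝ → ℝ → ℂ} (hf : Continuous fun p : ℝ × ℝ => f p.1 p.2)
    {Q : Set (ℝ × ℝ)} (hQ : IsCompact Q) (hQS : ∀ p ∈ Q, p.2 ∈ S)
    (hfQ : ∀ t x, (t, x) ∉ Q → f t x = 0) {F : C_c(ℝ, C₀(ℝ, ℂ))}
    (hF : ∀ t, ∀ x ∈ S, F t x = f t x) :
    IsCompactOperator ((halfLinePair φ hS).integratedForm F) := by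
  have hsupp : ∀ u : ℂ → ℝ, u 0 = 0 →
      HasCompactSupport fun p : ℝ × ℝ => ((u (f p.1 p.2) : ℝ) : ℂ) := fun u hu =>
    HasCompactSupport.intro hQ fun p hp => by rw [hfQ _ _ hp, hu, Complex.ofReal_zero]
  let R := ofKernel (fun t x => ((f t x).re : ℂ))
    (Complex.continuous_ofReal.comp (Complex.continuous_re.comp hf)) (hsupp Complex.re rfl)
  let I := ofKernel (fun t x => ((f t x).im : ℂ))
    (Complex.continuous_ofReal.comp (Complex.continuous_im.comp hf)) (hsupp Complex.im rfl)
  have h1 : (halfLinePair φ hS).integratedForm F = (halfLinePair φ hS).integratedForm R +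
      Complex.I • (halfLinePair φ hS).integratedForm I := by
    rw [← CovariantPair.integratedForm_smul, ← CovariantPair.integratedForm_add]
    refine halfLinePair_integratedForm_congr hS fun t x hx => ?_
    change F t x = ((f t x).re : ℂ) + Complex.I * ((f t x).im : ℂ)
    rw [hF t x hx, mul_comm, Complex.re_add_im]
  rw [h1]
  refine IsCompactOperator.add ?_ (IsCompactOperator.smul ?_ Complex.I)
  · exact isCompactOperator_of_kernel_real hX hφ hS (Complex.continuous_re.comp hf) hQ hQS
      (fun t x h => by rw [hfQ t x h, Complex.zero_re]) fun t x _ => rfl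
  · exact isCompactOperator_of_kernel_real hX hφ hS (Complex.continuous_im.comp hf) hQ hQS
      (fun t x h => by rw [hfQ t x h, Complex.zero_im]) fun t x _ => rfl

theorem IsHalfLine.isClosed_insert (hS : IsHalfLine S) : IsClosed (insert 0 S) := by
  rcases hS with rfl | rfl
  · rw [Iio_insert]
    exact isClosed_Iic
  · rw [Ioi_insert]
    exact isClosed_Ici

/-- If the values of `F` vanish at the origin, they are uniformly small outside a compact subset of
the half line. -/
theorem exists_compact_subset_norm_le (hS : IsHalfLine S) {F : C_c(ℝ, C₀(ℝ, ℂ))}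
    (h0 : ∀ t, F t 0 = 0) {ε : ℝ} (hε : 0 < ε) :
    ∃ K ⊆ S, IsCompact K ∧ ∀ t, ∀ x ∈ S, x ∉ K → ‖F t x‖ ≤ ε := by
  suffices h : ∃ K ⊆ S, IsCompact K ∧ ∀ t ∈ tsupport F, ∀ x ∈ S, x ∉ K → ‖F t x‖ ≤ ε by
    obtain ⟨K, hKS, hK, hKF⟩ := h
    refine ⟨K, hKS, hK, fun t x hx hxK => ?_⟩
    by_cases ht : t ∈ tsupport F
    · exact hKF t ht x hx hxK
    · rw [image_eq_zero_of_notMem_tsupport ht, ZeroAtInftyContinuousMap.zero_apply, norm_zero]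
      exact hε.le
  refine F.hasCompactSupport.isCompact.induction_on
    (p := fun T => ∃ K ⊆ S, IsCompact K ∧ ∀ t ∈ T, ∀ x ∈ S, x ∉ K → ‖F t x‖ ≤ ε)
    ⟨∅, empty_subset _, isCompact_empty, fun t ht => ht.elim⟩ ?_ ?_ ?_
  · rintro T T' hTT ⟨K, hKS, hK, h⟩
    exact ⟨K, hKS, hK, fun t ht => h t (hTT ht)⟩
  · rintro T T' ⟨K, hKS, hK, h⟩ ⟨K', hKS', hK', h'⟩
    refine ⟨K ∪ K', union_subset hKS hKS', hK.union hK', fun t ht x hx hxK => ?_⟩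
    rcases ht with ht | ht
    · exact h t ht x hx fun hk => hxK (Or.inl hk)
    · exact h' t ht x hx fun hk => hxK (Or.inr hk)
  · intro t₀ _
    obtain ⟨K, hK, hKe⟩ := exists_compact_norm_le (F t₀) (half_pos hε)
    have h1 : ∀ᶠ x in 𝓝 (0 : ℝ), ‖F t₀ x‖ < ε / 2 := by
      refine ((F t₀).continuous.norm.tendsto 0).eventually_lt_const ?_
      change ‖F t₀ 0‖ < ε / 2
      rw [h0, norm_zero]
      exact half_pos hε
    obtain ⟨U, hU, hUo, hU0⟩ := eventually_nhds_iff.1 h1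
    have h2 : ∀ᶠ t in 𝓝 t₀, ‖F t - F t₀‖ < ε / 2 := by
      have h3 := ((F.continuous.sub continuous_const).norm.tendsto t₀ :
        Tendsto (fun t => ‖F t - F t₀‖) (𝓝 t₀) (𝓝 ‖F t₀ - F t₀‖))
      refine h3.eventually_lt_const ?_
      change ‖F t₀ - F t₀‖ < ε / 2
      rw [sub_self, norm_zero]
      exact half_pos hε
    refine ⟨{t | ‖F t - F t₀‖ < ε / 2}, mem_nhdsWithin_of_mem_nhds h2,
      -- Adjoining `0` makes the half line closed, and removing the neighbourhood `U` of `0` brings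
      -- the set back into `S`.
      K ∩ (insert 0 S ∩ Uᶜ), ?_, hK.inter_right (hS.isClosed_insert.inter hUo.isClosed_compl), ?_⟩
    · rintro x ⟨-, rfl | hx, hxU⟩
      · exact absurd hU0 hxU
      · exact hx
    · intro t ht x hx hxK
      have h4 : ‖F t₀ x‖ ≤ ε / 2 := by
        by_cases hxK' : x ∈ K
        · by_cases hxU : x ∈ U
          · exact (hU x hxU).le
          · exact absurd ⟨hxK', Or.inr hx, hxU⟩ hxK
        · exact hKe x hxK'
      have h5 := norm_apply_le (F t - F t₀) x
      have h6 : F t x = (F t - F t₀) x + F t₀ x := by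
        rw [ZeroAtInftyContinuousMap.sub_apply, sub_add_cancel]
      rw [h6]
      have ht' : ‖F t - F t₀‖ < ε / 2 := ht
      linarith [norm_add_le ((F t - F t₀) x) (F t₀ x)]

/-- The operator `∫ M(F(t)) U_t dt` is compact if the values of `F` vanish at the origin. -/
theorem isCompactOperator_integratedForm (hX : IsGenerator k X) (hφ : φ.IsFlowOf X)
    (hS : IsHalfLine S) {F : C_c(ℝ, C₀(ℝ, ℂ))} (h0 : ∀ t, F t 0 = 0) :
    IsCompactOperator ((halfLinePair φ hS).integratedForm F) := by
  have hcl := isClosed_setOfPred_isCompactOperator (𝕜₁ := ℂ) (𝕜₂ := ℂ) (σ₁₂ := RingHom.id ℂ)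
    (M₁ := Lp ℂ 2 (volume.restrict S)) (M₂ := Lp ℂ 2 (volume.restrict S))
  refine hcl.closure_subset (Metric.mem_closure_iff.2 fun ε hε => ?_)
  have hT := F.hasCompactSupport.isCompact
  have hv : (0 : ℝ) ≤ volume.real (tsupport F) := measureReal_nonneg
  set δ : ℝ := ε / (volume.real (tsupport F) + 1) with hδ
  have hδ0 : 0 < δ := by positivity
  obtain ⟨K, hKS, hK, hKF⟩ := exists_compact_subset_norm_le hS h0 hδ0
  -- Multiplication by `ρ` gives a kernel of compact support over `S`; the remainder `(1 - ρ) F` is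
  -- at most `δ` because `F` is small off `K`.
  obtain ⟨ρ, hρ1, hρ⟩ := TestFunction.exists_eq_one hS.isOpen hK hKS
  have hcont : Continuous fun p : ℝ × ℝ => ρ p.2 * F p.1 p.2 :=
    (ρ.continuous.comp continuous_snd).mul (continuous_uncurry_apply F)
  have hQ : IsCompact (tsupport F ×ˢ tsupport ρ) := hT.prod ρ.hasCompactSupport.isCompact
  have hFQ : ∀ t x, (t, x) ∉ tsupport F ×ˢ tsupport ρ → ρ x * F t x = 0 := by
    intro t x h
    by_cases ht : t ∈ tsupport F
    · rw [image_eq_zero_of_notMem_tsupport fun hx => h ⟨ht, hx⟩, zero_mul]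
    · rw [image_eq_zero_of_notMem_tsupport ht, ZeroAtInftyContinuousMap.zero_apply, mul_zero]
  let G := ofKernel (fun t x => ρ x * F t x) hcont (HasCompactSupport.intro hQ fun p hp => hFQ _ _ hp)
  refine ⟨_, isCompactOperator_of_kernel hX hφ hS (F := G) hcont hQ
    (fun p hp => ρ.tsupport_subset hp.2) hFQ fun t x _ => rfl, ?_⟩
  rw [dist_eq_norm, ← CovariantPair.integratedForm_sub]
  have hsub : ∀ t x, (F - G) t x = (1 - ρ x) * F t x := fun t x => by
    change F t x - ρ x * F t x = _
    ring
  refine lt_of_le_of_lt (norm_halfLinePair_integratedForm_le hS hT (fun t ht x _ => ?_)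
    hδ0.le fun t x hx => ?_) ?_
  · rw [hsub, image_eq_zero_of_notMem_tsupport ht, ZeroAtInftyContinuousMap.zero_apply, mul_zero]
  · rw [hsub]
    by_cases hxK : x ∈ K
    · rw [hρ1 x hxK, sub_self, zero_mul, norm_zero]
      exact hδ0.le
    · rw [norm_mul]
      calc ‖1 - ρ x‖ * ‖F t x‖ ≤ 1 * δ := by
            gcongr
            exacts [(hρ x).2, hKF t x hx hxK]
        _ = δ := one_mul δ
  · rw [hδ, div_mul_eq_mul_div, div_lt_iff₀ (by positivity)]
    linarith [mul_add ε (volume.real (tsupport F)) 1]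

theorem canonicalPair_integratedForm_mem_compactSum (hX : IsGenerator k X) (hφ : φ.IsFlowOf X)
    {F : C_c(ℝ, C₀(ℝ, ℂ))} (h0 : ∀ t, F t 0 = 0) :
    (canonicalPair φ).integratedForm F ∈ compactSum :=
  ⟨_, _, isCompactOperator_integratedForm hX hφ isHalfLine_Iio h0,
    isCompactOperator_integratedForm hX hφ isHalfLine_Ioi h0, canonicalPair_integratedForm F⟩

end

section

variable {φ ψ : OriginFlow} {X Y : ℝ → ℝ} {k l : ℕ} {S : Set ℝ}

/-! ### Translation operators -/

section Translation

variable {H : Type} [NormedAddCommGroup H] [InnerProductSpace ℂ H] [CompleteSpace H]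

theorem CovariantPair.integrable_smul_U (π : CovariantPair φ H) (h : C_c(ℝ, ℂ)) (ξ : H) :
    Integrable fun s => h s • π.U s ξ :=
  (h.continuous.smul (π.U_cont ξ)).integrable_of_hasCompactSupport h.hasCompactSupport.smul_right

theorem integrable_norm_compactlySupported (h : C_c(ℝ, ℂ)) : Integrable fun s => ‖h s‖ :=
  (h.continuous.integrable_of_hasCompactSupport h.hasCompactSupport).norm

/-- The operator `∫ h(s) U_s ds`. -/
def CovariantPair.translation (π : CovariantPair φ H) (h : C_c(ℝ, ℂ)) : H →L[ℂ] H :=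
  LinearMap.mkContinuous
    { toFun := fun ξ => ∫ s, h s • π.U s ξ
      map_add' := fun ξ η => by
        simp only [map_add, smul_add]
        exact integral_add (π.integrable_smul_U h ξ) (π.integrable_smul_U h η)
      map_smul' := fun c ξ => by
        simp only [map_smul, RingHom.id_apply]
        rw [← integral_smul]
        exact integral_congr_ae (ae_of_all _ fun s => smul_comm _ _ _) }
    (∫ s, ‖h s‖) (fun ξ => by
      change ‖∫ s, h s • π.U s ξ‖ ≤ _
      rw [← integral_mul_const]
      refine norm_integral_le_of_norm_le ((integrable_norm_compactlySupported h).mul_const _)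
        (ae_of_all _ fun s => ?_)
      rw [norm_smul, LinearIsometryEquiv.norm_map])

theorem CovariantPair.translation_apply (π : CovariantPair φ H) (h : C_c(ℝ, ℂ)) (ξ : H) :
    π.translation h ξ = ∫ s, h s • π.U s ξ := rfl

theorem CovariantPair.integratedForm_tensor (π : CovariantPair φ H) (h : C_c(ℝ, ℂ))
    (f : C₀(ℝ, ℂ)) : π.integratedForm (tensor h f) = π.rep f ∘L π.translation h := by
  ext ξ
  rw [ContinuousLinearMap.comp_apply, CovariantPair.translation_apply,
    CovariantPair.integratedForm_apply,
    ← (π.rep f).integral_comp_comm (π.integrable_smul_U h ξ)]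
  refine integral_congr_ae (ae_of_all _ fun s => ?_)
  change π.rep (h s • f) _ = π.rep f _
  rw [map_smul, map_smul]
  rfl

theorem tendsto_integral_norm_translate_sub (h : C_c(ℝ, ℂ)) :
    Tendsto (fun s => ∫ r, ‖h (r - s) - h r‖) (𝓝 0) (𝓝 0) := by
  set K : Set ℝ := (fun p : ℝ × ℝ => p.1 + p.2) '' (tsupport h ×ˢ Icc (-1) 1) with hK
  have hKc : IsCompact K :=
    (h.hasCompactSupport.isCompact.prod isCompact_Icc).image (by fun_prop)
  have hc : Continuous fun p : ℝ × ℝ => ‖h (p.2 - p.1) - h p.2‖ :=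
    ((h.continuous.comp (continuous_snd.sub continuous_fst)).sub
      (h.continuous.comp continuous_snd)).norm
  have h1 : Continuous fun s => ∫ r in K, ‖h (r - s) - h r‖ :=
    continuous_parametric_integral_of_continuous hc hKc
  have h2 := h1.tendsto 0
  simp only [sub_zero, sub_self, norm_zero, integral_zero] at h2
  refine h2.congr' ?_
  filter_upwards [Icc_mem_nhds (by norm_num : (-1 : ℝ) < 0) (by norm_num : (0 : ℝ) < 1)] with s hs
  refine setIntegral_eq_integral_of_forall_compl_eq_zero fun r hr => ?_
  have h3 : h (r - s) = 0 := image_eq_zero_of_notMem_tsupport fun hm =>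
    hr ⟨(r - s, s), ⟨hm, hs⟩, by simp⟩
  have h4 : h r = 0 := image_eq_zero_of_notMem_tsupport fun hm =>
    hr ⟨(r, 0), ⟨hm, by simp⟩, by simp⟩
  rw [h3, h4, sub_zero, norm_zero]

/-- Applying `U s` only shifts the density `h`, so translation operators are nearly invariant under
small times. The unitaries themselves need not be norm continuous. -/
theorem CovariantPair.norm_U_translation_sub_le (π : CovariantPair φ H) (h : C_c(ℝ, ℂ)) (s : ℝ)
    (ξ : H) : ‖π.U s (π.translation h ξ) - π.translation h ξ‖ ≤
      (∫ r, ‖h (r - s) - h r‖) * ‖ξ‖ := by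
  have h1 : π.U s (π.translation h ξ) = ∫ r, h (r - s) • π.U r ξ := by
    rw [← integral_add_right_eq_self _ s, CovariantPair.translation_apply]
    have h2 := (π.U s).toContinuousLinearEquiv.toContinuousLinearMap.integral_comp_comm
      (π.integrable_smul_U h ξ)
    refine Eq.trans h2.symm (integral_congr_ae (ae_of_all _ fun r => ?_))
    simp only [add_sub_cancel_right]
    rw [add_comm r s, π.U_add]
    exact map_smul (π.U s) _ _
  have hint : Integrable fun r => h (r - s) • π.U r ξ :=
    ((h.continuous.comp (continuous_id.sub continuous_const)).smul
      (π.U_cont ξ)).integrable_of_hasCompactSupport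
        ((h.hasCompactSupport.comp_homeomorph (Homeomorph.subRight s)).smul_right)
  rw [h1, CovariantPair.translation_apply, ← integral_sub hint (π.integrable_smul_U h ξ),
    ← integral_mul_const]
  have hint2 : Integrable fun r => ‖h (r - s) - h r‖ :=
    (((h.continuous.comp (continuous_id.sub continuous_const)).integrable_of_hasCompactSupport
      (h.hasCompactSupport.comp_homeomorph (Homeomorph.subRight s))).sub
        (h.continuous.integrable_of_hasCompactSupport h.hasCompactSupport)).norm
  refine norm_integral_le_of_norm_le (hint2.mul_const _) (ae_of_all _ fun r => ?_)
  rw [← sub_smul, norm_smul, LinearIsometryEquiv.norm_map]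

end Translation

/-! ### Limits of conjugates towards the origin -/

section Limits

/-- Dominated convergence, with dominating function the square of `(C + ‖c‖) * ‖ξ x‖`. -/
theorem tendsto_mulOp (hS : IsHalfLine S) {g : ℕ → C₀(ℝ, ℂ)} {C : ℝ} (hg : ∀ n, ‖g n‖ ≤ C) {c : ℂ}
    (h : ∀ x ∈ S, Tendsto (fun n => g n x) atTop (𝓝 c)) (ξ : Lp ℂ 2 (volume.restrict S)) :
    Tendsto (fun n => mulOp S (g n) ξ) atTop (𝓝 (c • ξ)) := by
  rw [Lp.tendsto_Lp_iff_tendsto_eLpNorm']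
  have hfin : ∫⁻ x in S, ‖((C + ‖c‖ : ℝ) : ℂ) * ξ x‖ₑ ^ (2 : ℝ) ≠ ⊤ := by
    have h1 : MemLp (fun x => ((C + ‖c‖ : ℝ) : ℂ) * ξ x) 2 (volume.restrict S) :=
      (Lp.memLp ξ).const_mul _
    have h2 := lintegral_rpow_enorm_lt_top_of_eLpNorm_lt_top (by simp) (by simp) h1.2
    simpa using h2.ne
  have hm : Measurable ξ := (Lp.stronglyMeasurable ξ).measurable
  have hmain : Tendsto (fun n => ∫⁻ x in S, ‖(g n x - c) * ξ x‖ₑ ^ (2 : ℝ)) atTop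
      (𝓝 (∫⁻ _ in S, 0)) := by
    refine tendsto_lintegral_of_dominated_convergence
      (fun x => ‖((C + ‖c‖ : ℝ) : ℂ) * ξ x‖ₑ ^ (2 : ℝ)) ?_ ?_ hfin ?_
    · intro n
      have := (g n).continuous.measurable
      exact (((this.sub_const c).mul hm).enorm).pow_const _
    · intro n
      refine ae_of_all _ fun x => ENNReal.rpow_le_rpow ?_ (by norm_num)
      rw [← ofReal_norm, ← ofReal_norm]
      refine ENNReal.ofReal_le_ofReal ?_
      rw [norm_mul, norm_mul, Complex.norm_real]
      gcongr
      refine (norm_sub_le _ _).trans (le_trans ?_ (le_abs_self _))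
      gcongr
      exact (norm_apply_le _ _).trans (hg n)
    · filter_upwards [ae_restrict_mem hS.measurableSet] with x hx
      have h1 := (((h x hx).sub_const c).mul_const (ξ x)).enorm
      have h2 := (ENNReal.continuous_rpow_const (y := 2)).tendsto _ |>.comp h1
      simpa [Function.comp_def] using h2
  have hroot := (ENNReal.continuous_rpow_const (y := 1 / 2)).tendsto _ |>.comp hmain
  simp only [lintegral_zero] at hroot
  rw [ENNReal.zero_rpow_of_pos (by norm_num)] at hroot
  refine hroot.congr fun n => ?_
  rw [eLpNorm_eq_lintegral_rpow_enorm_toReal (by simp) (by simp)]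
  simp only [Function.comp_apply, ENNReal.toReal_ofNat]
  congr 1
  refine lintegral_congr_ae ?_
  filter_upwards [coeFn_mulOp S (g n) ξ, Lp.coeFn_smul c ξ] with x h1 h2
  rw [Pi.sub_apply, h1, h2, Pi.smul_apply, smul_eq_mul, sub_mul]

theorem halfLinePair_conjugate_rep (hS : IsHalfLine S) (t : ℝ) (f : C₀(ℝ, ℂ))
    (ξ : Lp ℂ 2 (volume.restrict S)) : (halfLinePair φ hS).U (-t) ((halfLinePair ψ hS).rep f ξ) =
      mulOp S (φ.act (-t) f) ((halfLinePair φ hS).U (-t) ξ) :=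
  (halfLinePair φ hS).U_rep (-t) f ξ

/-- The limit of the conjugates of an integrated form by translations that move the half line
towards the origin. -/
theorem tendsto_conjugate_integratedForm (hS : IsHalfLine S) {t : ℕ → ℝ}
    (ht : ∀ x ∈ S, Tendsto (fun n => φ (t n) x) atTop (𝓝 0)) {ξ : Lp ℂ 2 (volume.restrict S)}
    {W : ℝ → Lp ℂ 2 (volume.restrict S)}
    (hW : ∀ s, Tendsto (fun n => (halfLinePair φ hS).U (-t n) ((halfLinePair ψ hS).U s
      ((halfLinePair φ hS).U (t n) ξ))) atTop (𝓝 (W s))) (G : C_c(ℝ, C₀(ℝ, ℂ))) :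
    Tendsto (fun n => (halfLinePair φ hS).U (-t n) ((halfLinePair ψ hS).integratedForm G
      ((halfLinePair φ hS).U (t n) ξ))) atTop (𝓝 (∫ s, evalAt G 0 s • W s)) := by
  set V : ℕ → ℝ → Lp ℂ 2 (volume.restrict S) := fun n s => (halfLinePair φ hS).U (-t n)
    ((halfLinePair ψ hS).U s ((halfLinePair φ hS).U (t n) ξ)) with hV
  have hVn : ∀ n s, ‖V n s‖ = ‖ξ‖ := fun n s => by
    simp only [hV, LinearIsometryEquiv.norm_map]
  have heq : ∀ n, (halfLinePair φ hS).U (-t n) ((halfLinePair ψ hS).integratedForm G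
      ((halfLinePair φ hS).U (t n) ξ)) = ∫ s, mulOp S (φ.act (-t n) (G s)) (V n s) := fun n => by
    have h1 := ((halfLinePair φ hS).U (-t n)).toContinuousLinearEquiv.toContinuousLinearMap.integral_comp_comm
      ((halfLinePair ψ hS).integrable G ((halfLinePair φ hS).U (t n) ξ))
    refine Eq.trans h1.symm (integral_congr_ae (ae_of_all _ fun s => ?_))
    exact halfLinePair_conjugate_rep hS (t n) (G s) _
  simp only [heq]
  have hmul : ∀ f η, ‖mulOp S f η‖ ≤ ‖f‖ * ‖η‖ := fun f η =>
    (ContinuousLinearMap.le_opNorm _ _).trans (by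
      gcongr
      exact norm_mulOp_le hS (norm_nonneg _) fun x _ => norm_apply_le f x)
  refine tendsto_integral_of_dominated_convergence (fun s => ‖G s‖ * ‖ξ‖) ?_ ?_ ?_ ?_
  · intro n
    have hc1 : Continuous fun f => mulOp S f := (halfLinePair φ hS).continuous_rep
    have hc2 : Continuous fun s => mulOp S (φ.act (-t n) (G s)) :=
      hc1.comp (φ.continuous_act.comp (continuous_const.prodMk G.continuous))
    have hc3 : Continuous fun s => V n s :=
      ((halfLinePair φ hS).U (-t n)).continuous.comp ((halfLinePair ψ hS).U_cont _)
    exact (hc2.clm_apply hc3).aestronglyMeasurable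
  · exact (CovariantPair.integrable_norm G).mul_const _
  · intro n
    refine ae_of_all _ fun s => (hmul _ _).trans ?_
    rw [hVn]
    gcongr
    exact φ.norm_act_le _ _
  · refine ae_of_all _ fun s => ?_
    have h1 : Tendsto (fun n => mulOp S (φ.act (-t n) (G s)) (W s)) atTop
        (𝓝 (evalAt G 0 s • W s)) := by
      refine tendsto_mulOp hS (fun n => φ.norm_act_le _ _) (fun x hx => ?_) _
      simp only [OriginFlow.act_apply, neg_neg]
      exact ((G s).continuous.tendsto 0).comp (ht x hx)
    have h2 : Tendsto (fun n => mulOp S (φ.act (-t n) (G s)) (V n s - W s)) atTop (𝓝 0) := by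
      have h3 : Tendsto (fun n => ‖G s‖ * ‖V n s - W s‖) atTop (𝓝 0) := by
        have h4 := (tendsto_iff_norm_sub_tendsto_zero.1 (hW s)).const_mul ‖G s‖
        rwa [mul_zero] at h4
      refine squeeze_zero_norm (fun n => (hmul _ _).trans ?_) h3
      gcongr
      exact φ.norm_act_le _ _
    have h5 := h2.add h1
    rw [zero_add] at h5
    refine h5.congr fun n => ?_
    rw [map_sub, sub_add_cancel]

/-- If `Y d/dx` vanishes to higher order than `X d/dx`, then the conjugates of the flow of `Y d/dx`
by the flow of `X d/dx` towards the origin tend strongly to the identity. -/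
theorem tendsto_conjugate_U (hX : IsGenerator k X) (hφ : φ.IsFlowOf X) (hY : IsGenerator l Y)
    (hψ : ψ.IsFlowOf Y) (hk : 0 < k) (hkl : k < l) (hS : IsHalfLine S) {t : ℕ → ℝ}
    (ht : ∀ x ∈ S, Tendsto (fun n => φ (t n) x) atTop (𝓝 0)) (s : ℝ)
    (ξ : Lp ℂ 2 (volume.restrict S)) :
    Tendsto (fun n => (halfLinePair φ hS).U (-t n) ((halfLinePair ψ hS).U s
      ((halfLinePair φ hS).U (t n) ξ))) atTop (𝓝 ξ) := by
  let V : ℕ → (Lp ℂ 2 (volume.restrict S) →L[ℂ] Lp ℂ 2 (volume.restrict S)) := fun n =>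
    ((((halfLinePair φ hS).U (t n)).trans ((halfLinePair ψ hS).U s)).trans
      ((halfLinePair φ hS).U (-t n))).toContinuousLinearEquiv.toContinuousLinearMap
  have hVn : ∀ n η, ‖V n η‖ = ‖η‖ := fun n η => LinearIsometryEquiv.norm_map _ _
  -- The vectors on which convergence holds form a subspace, closed because every `V n` is
  -- isometric; it is enough that it contains the test functions.
  let E : Submodule ℂ (Lp ℂ 2 (volume.restrict S)) :=
    { carrier := {η | Tendsto (fun n => V n η) atTop (𝓝 η)}
      add_mem' := fun {η ζ} hη hζ => by
        simpa only [mem_ofPred_eq, map_add] using Tendsto.add hη hζ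
      zero_mem' := by simp
      smul_mem' := fun c η hη => by
        simpa only [mem_ofPred_eq, map_smul] using Tendsto.const_smul hη c }
  have hE : IsClosed (E : Set (Lp ℂ 2 (volume.restrict S))) := by
    refine isClosed_of_closure_subset fun η hη => ?_
    change Tendsto (fun n => V n η) atTop (𝓝 η)
    rw [Metric.tendsto_atTop]
    intro ε hε
    obtain ⟨ζ, hζ, hd⟩ := Metric.mem_closure_iff.1 hη (ε / 3) (by positivity)
    obtain ⟨N, hN⟩ := Metric.tendsto_atTop.1 (show Tendsto (fun n => V n ζ) atTop (𝓝 ζ) from hζ)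
      (ε / 3) (by positivity)
    refine ⟨N, fun n hn => ?_⟩
    have h1 : dist (V n η) (V n ζ) = dist η ζ := by
      rw [dist_eq_norm, ← map_sub, hVn, dist_eq_norm]
    calc dist (V n η) η ≤ dist (V n η) (V n ζ) + dist (V n ζ) ζ + dist ζ η := dist_triangle4 _ _ _ _
      _ < ε / 3 + ε / 3 + ε / 3 := by
        rw [h1, dist_comm ζ η]
        gcongr
        exact hN n hn
      _ = ε := by ring
  have htest : ∀ u : TestFunction S, u.toLp ∈ E := by
    intro u
    -- As the operators preserve norms, pointwise convergence suffices and no dominating function is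
    -- needed.
    refine tendsto_of_ae_tendsto_of_norm_eq ?_ fun n => hVn n _
    have h1 : ∀ n, V n u.toLp =ᵐ[volume.restrict S]
        φ.transport (t n) (ψ.transport (-s) (φ.transport (-t n) u)) := by
      intro n
      have h2 := OriginFlow.transport_ae_congr hS.measurableSet (hS.mapsTo φ) (-t n) u.coeFn_toLp
      have h3 := (OriginFlow.coeFn_transportLp hS.measurableSet (hS.mapsTo φ) (-t n) u.toLp).trans h2
      have h4 := OriginFlow.transport_ae_congr hS.measurableSet (hS.mapsTo ψ) (-s) h3
      have h5 := (OriginFlow.coeFn_transportLp hS.measurableSet (hS.mapsTo ψ) (-s) _).trans h4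
      have h6 := OriginFlow.transport_ae_congr hS.measurableSet (hS.mapsTo φ) (- -t n) h5
      have h7 := (OriginFlow.coeFn_transportLp hS.measurableSet (hS.mapsTo φ) (- -t n) _).trans h6
      exact h7.trans (by rw [neg_neg])
    filter_upwards [ae_all_iff.2 h1, u.coeFn_toLp, ae_restrict_mem hS.measurableSet]
      with x hx1 hx2 hxS
    simp only [hx1, hx2]
    exact tendsto_transport_conjugate hX hφ hY hψ hk hkl hS hxS (ht x hxS) (-s) u.continuous
  have h1 : ξ ∈ closure (Submodule.span ℂ (Set.range (TestFunction.toLp (S := S))) :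
      Set (Lp ℂ 2 (volume.restrict S))) := TestFunction.dense_span hS.isOpen ξ
  have h2 : Submodule.span ℂ (Set.range (TestFunction.toLp (S := S))) ≤ E := by
    rw [Submodule.span_le]
    rintro _ ⟨u, rfl⟩
    exact htest u
  exact hE.closure_subset_iff.2 (show (Submodule.span ℂ (Set.range (TestFunction.toLp (S := S))) :
    Set (Lp ℂ 2 (volume.restrict S))) ⊆ E from h2) h1

/-- Conjugation by unitaries does not change the norm of the difference of the two forms. In the
limit the unitaries of `φ` persist and give a translation operator, while those of `ψ` become the
identity and leave a scalar. -/
theorem norm_translation_sub_le (hX : IsGenerator k X) (hφ : φ.IsFlowOf X) (hY : IsGenerator l Y)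
    (hψ : ψ.IsFlowOf Y) (hk : 0 < k) (hkl : k < l) (hS : IsHalfLine S) (F G : C_c(ℝ, C₀(ℝ, ℂ)))
    (ξ : Lp ℂ 2 (volume.restrict S)) :
    ‖(halfLinePair φ hS).translation (evalAt F 0) ξ - (∫ s, evalAt G 0 s) • ξ‖ ≤
      ‖(halfLinePair φ hS).integratedForm F - (halfLinePair ψ hS).integratedForm G‖ * ‖ξ‖ := by
  obtain ⟨t, ht⟩ := exists_seq_tendsto_zero hX hφ hS
  have h1 := tendsto_conjugate_integratedForm (φ := φ) (ψ := φ) hS ht (ξ := ξ)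
    (W := fun s => (halfLinePair φ hS).U s ξ) (fun s => by
      have h2 : ∀ n, (halfLinePair φ hS).U (-t n) ((halfLinePair φ hS).U s
          ((halfLinePair φ hS).U (t n) ξ)) = (halfLinePair φ hS).U s ξ := fun n => by
        rw [← CovariantPair.U_add, ← CovariantPair.U_add]
        congr 2
        ring
      simp only [h2]
      exact tendsto_const_nhds) F
  have h3 := tendsto_conjugate_integratedForm (φ := φ) (ψ := ψ) hS ht (ξ := ξ) (W := fun _ => ξ)
    (fun s => tendsto_conjugate_U hX hφ hY hψ hk hkl hS ht s ξ) G
  rw [integral_smul_const] at h3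
  refine le_of_tendsto (h1.sub h3).norm (Eventually.of_forall fun n => ?_)
  rw [← map_sub, LinearIsometryEquiv.norm_map, ← _root_.sub_apply]
  refine (ContinuousLinearMap.le_opNorm _ _).trans ?_
  rw [LinearIsometryEquiv.norm_map]

/-- No point of the half line is fixed by a nonzero time, so a bump with small support is moved off
itself. -/
theorem exists_inner_U_eq_zero (hX : IsGenerator k X) (hφ : φ.IsFlowOf X) (hS : IsHalfLine S)
    {s : ℝ} (hs : s ≠ 0) : ∃ ξ : Lp ℂ 2 (volume.restrict S), ξ ≠ 0 ∧
      inner ℂ ξ ((halfLinePair φ hS).U s ξ) = 0 := by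
  obtain ⟨x₀, hx₀⟩ := hS.nonempty
  have hne : x₀ ≠ φ (-s) x₀ := fun h => by
    have h1 := flow_injective hX hφ hS hx₀ (a₁ := 0) (a₂ := -s) (by
      simp only [φ.toFlow.map_zero_apply]
      exact h)
    exact hs (by linarith)
  obtain ⟨U, V, hU, hV, hxU, hxV, hUV⟩ := t2_separation hne
  set B : Set ℝ := S ∩ (U ∩ φ (-s) ⁻¹' V) with hB
  have hBo : IsOpen B := hS.isOpen.inter (hU.inter (hV.preimage (φ.continuous_apply (-s))))
  obtain ⟨u, hu1, -⟩ := TestFunction.exists_eq_one hBo (isCompact_singleton (x := x₀))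
    (singleton_subset_iff.2 ⟨hx₀, hxU, hxV⟩)
  let v : TestFunction S := ⟨u, u.continuous, u.hasCompactSupport,
    u.tsupport_subset.trans inter_subset_left⟩
  refine ⟨v.toLp, fun h => ?_, ?_⟩
  · have h1 : (v : ℝ → ℂ) =ᵐ[volume.restrict S] fun _ => 0 := by
      refine v.coeFn_toLp.symm.trans ?_
      rw [h]
      exact Lp.coeFn_zero _ _ _
    have h2 := Measure.eqOn_open_of_ae_eq h1 hS.isOpen v.continuous.continuousOn continuousOn_const
    exact one_ne_zero ((hu1 x₀ rfl).symm.trans (h2 hx₀))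
  · rw [TestFunction.inner_toLp]
    refine integral_eq_zero_of_ae ?_
    filter_upwards [OriginFlow.coeFn_leafU hS.measurableSet (hS.mapsTo φ) s v.toLp,
      OriginFlow.transport_ae_congr hS.measurableSet (hS.mapsTo φ) (-s) v.coeFn_toLp] with x h1 h2
    change (OriginFlow.leafU hS.measurableSet (hS.mapsTo φ) s v.toLp : ℝ → ℂ) x *
      starRingEnd ℂ (u x) = 0
    by_cases hx : x ∈ B
    · have h3 : φ (-s) x ∉ B := fun h => disjoint_left.1 hUV h.2.1 hx.2.2
      have h4 : φ.transport (-s) v x = 0 := by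
        change _ * u (φ (-s) x) = 0
        rw [u.apply_eq_zero h3, mul_zero]
      rw [h1]
      change φ.transport (-s) v.toLp x * _ = 0
      rw [h2, h4, zero_mul]
    · rw [u.apply_eq_zero hx, map_zero, mul_zero]

/-- Evaluate `c • (U s ξ - ξ)` for a vector `ξ` orthogonal to `U s ξ`. Its norm is at least `‖c‖ *
‖ξ‖`. Replacing the scalar by the translation operator costs `2 * r * ‖ξ‖`, and the translation
operator contributes an amount that tends to `0` with `s`. -/
theorem norm_le_of_translation_sub_le (hX : IsGenerator k X) (hφ : φ.IsFlowOf X)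
    (hS : IsHalfLine S) {h : C_c(ℝ, ℂ)} {c : ℂ} {r : ℝ}
    (hr : ∀ ξ, ‖(halfLinePair φ hS).translation h ξ - c • ξ‖ ≤ r * ‖ξ‖) : ‖c‖ ≤ 2 * r := by
  set π := halfLinePair φ hS with hπ
  have key : ∀ s ≠ 0, ‖c‖ ≤ 2 * r + ∫ x, ‖h (x - s) - h x‖ := by
    intro s hs
    obtain ⟨ξ, hξ, hinner⟩ := exists_inner_U_eq_zero hX hφ hS hs
    have hpos : 0 < ‖ξ‖ := norm_pos_iff.2 hξ
    have h1 : ‖ξ‖ ≤ ‖π.U s ξ - ξ‖ := by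
      have h2 := norm_sub_sq (𝕜 := ℂ) ξ (π.U s ξ)
      rw [hinner, LinearIsometryEquiv.norm_map] at h2
      simp only [map_zero, mul_zero, sub_zero] at h2
      rw [norm_sub_rev]
      refine le_of_sq_le_sq ?_ (norm_nonneg _)
      rw [h2]
      nlinarith [sq_nonneg ‖ξ‖]
    -- The first bracket is small by near invariance under `U s`; the second holds the error vector
    -- and its image under `U s`, each of norm at most `r * ‖ξ‖`.
    have h3 : c • (π.U s ξ - ξ) = (π.U s (π.translation h ξ) - π.translation h ξ) -
        (π.U s (π.translation h ξ - c • ξ) - (π.translation h ξ - c • ξ)) := by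
      rw [map_sub, map_smul, smul_sub]
      abel
    have h4 := norm_sub_le (π.U s (π.translation h ξ) - π.translation h ξ)
      (π.U s (π.translation h ξ - c • ξ) - (π.translation h ξ - c • ξ))
    have h5 := norm_sub_le (π.U s (π.translation h ξ - c • ξ)) (π.translation h ξ - c • ξ)
    rw [LinearIsometryEquiv.norm_map] at h5
    have h6 := π.norm_U_translation_sub_le h s ξ
    have h7 := hr ξ
    rw [← h3, norm_smul] at h4
    have h8 : ‖c‖ * ‖ξ‖ ≤ ‖c‖ * ‖π.U s ξ - ξ‖ := by gcongr
    refine le_of_mul_le_mul_right ?_ hpos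
    linarith [add_mul (2 * r) (∫ x, ‖h (x - s) - h x‖) ‖ξ‖]
  have h1 : Tendsto (fun s => 2 * r + ∫ x, ‖h (x - s) - h x‖) (𝓝[≠] 0) (𝓝 (2 * r + 0)) :=
    ((tendsto_integral_norm_translate_sub h).mono_left nhdsWithin_le_nhds).const_add _
  rw [add_zero] at h1
  exact ge_of_tendsto h1 (eventually_mem_nhdsWithin.mono fun s hs => key s hs)

/-- The comparison of the crossed products of two flows that vanish to different orders: the
operator at the origin of an element of the first is bounded by the distance of that element to
the second. -/
theorem norm_translation_le (hX : IsGenerator k X) (hφ : φ.IsFlowOf X) (hY : IsGenerator l Y)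
    (hψ : ψ.IsFlowOf Y) (hk : 0 < k) (hkl : k < l) (hS : IsHalfLine S) (F G : C_c(ℝ, C₀(ℝ, ℂ))) :
    ‖(halfLinePair φ hS).translation (evalAt F 0)‖ ≤
      3 * ‖(halfLinePair φ hS).integratedForm F - (halfLinePair ψ hS).integratedForm G‖ := by
  have h1 := norm_translation_sub_le hX hφ hY hψ hk hkl hS F G
  have h2 := norm_le_of_translation_sub_le hX hφ hS h1
  refine ContinuousLinearMap.opNorm_le_bound _ (by positivity) fun ξ => ?_
  have h3 := norm_le_norm_sub_add ((halfLinePair φ hS).translation (evalAt F 0) ξ)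
    ((∫ s, evalAt G 0 s) • ξ)
  rw [norm_smul] at h3
  have h4 := mul_le_mul_of_nonneg_right h2 (norm_nonneg ξ)
  linarith [h1 ξ]

end Limits

end

/-! ### The intersection and the inequality of the image algebras -/

section

variable {φ ψ : OriginFlow} {X Y : ℝ → ℝ} {k l : ℕ} {S : Set ℝ}

theorem exists_zeroAtInfty_eq_one : ∃ f : C₀(ℝ, ℂ), f 0 = 1 ∧ ‖f‖ ≤ 1 := by
  obtain ⟨u, hu, hu'⟩ := TestFunction.exists_eq_one isOpen_univ (isCompact_singleton (x := (0 : ℝ)))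
    (subset_univ _)
  let f : C₀(ℝ, ℂ) := ⟨⟨u, u.continuous⟩, u.hasCompactSupport.is_zero_at_infty⟩
  exact ⟨f, hu 0 rfl, zeroAtInfty_norm_le zero_le_one fun x => (hu' x).1⟩

theorem evalAt_tensor (h : C_c(ℝ, ℂ)) {f : C₀(ℝ, ℂ)} (hf : f 0 = 1) :
    evalAt (tensor h f) 0 = h := by
  ext t
  change h t * f 0 = h t
  rw [hf, mul_one]

theorem norm_translation_le_canonicalPair (hX : IsGenerator k X) (hφ : φ.IsFlowOf X)
    (hY : IsGenerator l Y) (hψ : ψ.IsFlowOf Y) (hk : 0 < k) (hkl : k < l)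
    (F G : C_c(ℝ, C₀(ℝ, ℂ))) :
    ‖(halfLinePair φ isHalfLine_Iio).translation (evalAt F 0)‖ ≤
        3 * ‖(canonicalPair φ).integratedForm F - (canonicalPair ψ).integratedForm G‖ ∧
      ‖(halfLinePair φ isHalfLine_Ioi).translation (evalAt F 0)‖ ≤
        3 * ‖(canonicalPair φ).integratedForm F - (canonicalPair ψ).integratedForm G‖ := by
  have h : (canonicalPair φ).integratedForm F - (canonicalPair ψ).integratedForm G =
      opSum ((halfLinePair φ isHalfLine_Iio).integratedForm F -
          (halfLinePair ψ isHalfLine_Iio).integratedForm G)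
        ((halfLinePair φ isHalfLine_Ioi).integratedForm F -
          (halfLinePair ψ isHalfLine_Ioi).integratedForm G) := by
    rw [canonicalPair_integratedForm, canonicalPair_integratedForm, opSum_sub_opSum]
  rw [h]
  refine ⟨(norm_translation_le hX hφ hY hψ hk hkl isHalfLine_Iio F G).trans ?_,
    (norm_translation_le hX hφ hY hψ hk hkl isHalfLine_Ioi F G).trans ?_⟩
  · gcongr
    exact norm_le_opSum_left _ _
  · gcongr
    exact norm_le_opSum_right _ _

theorem norm_halfLinePair_integratedForm_tensor_le (hS : IsHalfLine S) (h : C_c(ℝ, ℂ))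
    {f : C₀(ℝ, ℂ)} (hf : ‖f‖ ≤ 1) :
    ‖(halfLinePair φ hS).integratedForm (tensor h f)‖ ≤ ‖(halfLinePair φ hS).translation h‖ := by
  rw [CovariantPair.integratedForm_tensor]
  refine (ContinuousLinearMap.opNorm_comp_le _ _).trans ?_
  refine mul_le_of_le_one_left (norm_nonneg _) (le_trans ?_ hf)
  exact NonUnitalStarAlgHom.norm_apply_le _ _

theorem exists_integratedForm_dist_lt {T : HalfLines →L[ℂ] HalfLines} (hT : T ∈ imageAlgebra φ)
    {ε : ℝ} (hε : 0 < ε) :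
    ∃ F : C_c(ℝ, C₀(ℝ, ℂ)), ‖T - (canonicalPair φ).integratedForm F‖ < ε := by
  have h : T ∈ closure (Set.range (canonicalPair φ).integratedForm) := by
    rw [← coe_imageAlgebra]
    exact hT
  obtain ⟨_, ⟨F, rfl⟩, hF⟩ := Metric.mem_closure_iff.1 h ε hε
  exact ⟨F, by rwa [← dist_eq_norm]⟩

theorem inter_subset_compactSum (hX : IsGenerator k X) (hφ : φ.IsFlowOf X) (hY : IsGenerator l Y)
    (hψ : ψ.IsFlowOf Y) (hk : 0 < k) (hkl : k < l) :
    (imageAlgebra φ : Set (HalfLines →L[ℂ] HalfLines)) ∩ imageAlgebra ψ ⊆ compactSum := by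
  rintro T ⟨hT₁, hT₂⟩
  obtain ⟨f, hf, hf'⟩ := exists_zeroAtInfty_eq_one
  rw [← isClosed_compactSum.closure_eq, Metric.mem_closure_iff]
  intro ε hε
  -- The two forms are within `2 * (ε / 13)`. Hence the part at the origin is less than `6 * (ε /
  -- 13)` on each half line, that is `12 * (ε / 13)` in all, and the distance from `T` adds the last
  -- `ε / 13`.
  obtain ⟨F, hF⟩ := exists_integratedForm_dist_lt hT₁ (ε := ε / 13) (by positivity)
  obtain ⟨G, hG⟩ := exists_integratedForm_dist_lt hT₂ (ε := ε / 13) (by positivity)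
  obtain ⟨h₁, h₂⟩ := norm_translation_le_canonicalPair hX hφ hY hψ hk hkl F G
  have hFG : ‖(canonicalPair φ).integratedForm F - (canonicalPair ψ).integratedForm G‖ <
      2 * (ε / 13) := by
    have h := norm_sub_le (T - (canonicalPair ψ).integratedForm G)
      (T - (canonicalPair φ).integratedForm F)
    rw [sub_sub_sub_cancel_left] at h
    linarith
  set h := evalAt F 0 with hh
  have hE : ‖(canonicalPair φ).integratedForm (tensor h f)‖ ≤
      ‖(halfLinePair φ isHalfLine_Iio).translation h‖ +
        ‖(halfLinePair φ isHalfLine_Ioi).translation h‖ := by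
    rw [canonicalPair_integratedForm]
    exact (norm_opSum_le _ _).trans (add_le_add
      (norm_halfLinePair_integratedForm_tensor_le _ h hf')
      (norm_halfLinePair_integratedForm_tensor_le _ h hf'))
  -- As `f 0 = 1`, subtracting `tensor h f` removes exactly the values of `F` at the origin.
  refine ⟨(canonicalPair φ).integratedForm (F - tensor h f),
    canonicalPair_integratedForm_mem_compactSum hX hφ fun t => ?_, ?_⟩
  · change F t 0 - h t * f 0 = 0
    rw [hf, mul_one]
    exact sub_self _
  · rw [CovariantPair.integratedForm_sub, dist_eq_norm]
    calc _ = ‖(T - (canonicalPair φ).integratedForm F) +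
          (canonicalPair φ).integratedForm (tensor h f)‖ := by
            congr 1
            abel
      _ ≤ _ := norm_add_le _ _
      _ < ε := by linarith

theorem inter_eq_compactSum (hX : IsGenerator k X) (hφ : φ.IsFlowOf X) (hY : IsGenerator l Y)
    (hψ : ψ.IsFlowOf Y) (hk : 0 < k) (hkl : k < l) :
    (imageAlgebra φ : Set (HalfLines →L[ℂ] HalfLines)) ∩ imageAlgebra ψ = compactSum :=
  (inter_subset_compactSum hX hφ hY hψ hk hkl).antisymm
    (subset_inter (compactSum_subset_imageAlgebra hX hφ) (compactSum_subset_imageAlgebra hY hψ))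

theorem CovariantPair.exists_translation_ne_zero {H : Type} [NormedAddCommGroup H]
    [InnerProductSpace ℂ H] [CompleteSpace H] (π : CovariantPair φ H) {ξ : H} (hξ : ξ ≠ 0) :
    ∃ h : C_c(ℝ, ℂ), π.translation h ≠ 0 := by
  obtain ⟨b, hb, -⟩ := TestFunction.exists_eq_one isOpen_univ
    (isCompact_singleton (x := (0 : ℝ))) (subset_univ _)
  have hU : Continuous fun s => inner ℂ ξ (π.U s ξ) := continuous_const.inner (π.U_cont ξ)
  -- With this density the matrix coefficient of the translation operator at `ξ` is the integral of
  -- `‖b s‖ * ‖inner ℂ ξ (π.U s ξ)‖ ^ 2`, which is positive because the integrand is nonzero at `s =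
  -- 0`.
  let h : C_c(ℝ, ℂ) :=
    ⟨⟨fun s => (‖b s‖ : ℂ) * starRingEnd ℂ (inner ℂ ξ (π.U s ξ)),
      (Complex.continuous_ofReal.comp b.continuous.norm).mul (Complex.continuous_conj.comp hU)⟩,
      (b.hasCompactSupport.norm.comp_left (g := fun r : ℝ => (r : ℂ)) rfl).mul_right⟩
  refine ⟨h, fun h0 => ?_⟩
  set g : ℝ → ℝ := fun s => ‖b s‖ * ‖inner ℂ ξ (π.U s ξ)‖ ^ 2 with hg
  have hgc : Continuous g := b.continuous.norm.mul (hU.norm.pow 2)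
  have hpos : 0 < ∫ s, g s := by
    refine hgc.integral_pos_of_hasCompactSupport_nonneg_nonzero
      b.hasCompactSupport.norm.mul_right (fun s => by positivity) (x := 0) ?_
    have : ‖b 0‖ = 1 := by rw [hb 0 rfl, norm_one]
    simp only [hg, this, π.U_zero, one_mul]
    simpa using hξ
  have hint : inner ℂ ξ (π.translation h ξ) = ((∫ s, g s : ℝ) : ℂ) := by
    rw [π.translation_apply, ← integral_inner (π.integrable_smul_U h ξ), ← integral_complex_ofReal]
    refine integral_congr_ae (ae_of_all _ fun s => ?_)
    simp only [inner_smul_right]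
    change (‖b s‖ : ℂ) * starRingEnd ℂ (inner ℂ ξ (π.U s ξ)) * inner ℂ ξ (π.U s ξ) = _
    rw [mul_assoc, Complex.conj_mul', hg]
    push_cast
    rfl
  rw [h0] at hint
  simp only [_root_.zero_apply, inner_zero_right] at hint
  exact hpos.ne (by exact_mod_cast hint)

theorem imageAlgebra_ne (hX : IsGenerator k X) (hφ : φ.IsFlowOf X) (hY : IsGenerator l Y)
    (hψ : ψ.IsFlowOf Y) (hk : 0 < k) (hkl : k < l) : imageAlgebra φ ≠ imageAlgebra ψ := by
  intro heq
  obtain ⟨f, hf, -⟩ := exists_zeroAtInfty_eq_one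
  obtain ⟨ξ, hξ, -⟩ := exists_inner_U_eq_zero hX hφ isHalfLine_Ioi one_ne_zero
  obtain ⟨h, hh⟩ := (halfLinePair φ isHalfLine_Ioi).exists_translation_ne_zero hξ
  have hT : (canonicalPair φ).integratedForm (tensor h f) ∈ imageAlgebra ψ := by
    rw [← heq, ← SetLike.mem_coe, coe_imageAlgebra]
    exact subset_closure (mem_range_self _)
  have hpos : 0 < ‖(halfLinePair φ isHalfLine_Ioi).translation h‖ := norm_pos_iff.2 hh
  -- Membership in the second algebra would allow an approximation to within a third of the
  -- translation norm, contradicting the factor `3` in the comparison.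
  obtain ⟨G, hG⟩ := exists_integratedForm_dist_lt hT
    (ε := ‖(halfLinePair φ isHalfLine_Ioi).translation h‖ / 3) (by positivity)
  have h1 := (norm_translation_le_canonicalPair hX hφ hY hψ hk hkl (tensor h f) G).2
  rw [evalAt_tensor h hf] at h1
  linarith

end

end OrderFoliation
end

theorem mainTheorem7 (k l : ℕ) (hk : 0 < k) (hl : 0 < l) (hkl : k ≠ l)
    (X Y : ℝ → ℝ) (hX : IsGenerator k X) (hY : IsGenerator l Y)
    (φ ψ : OriginFlow) (hφ : φ.IsFlowOf X) (hψ : ψ.IsFlowOf Y) :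
    imageAlgebra φ ≠ imageAlgebra ψ ∧
      (imageAlgebra φ : Set (HalfLines →L[ℂ] HalfLines)) ∩ imageAlgebra ψ = compactSum := by
  -- The comparison is asymmetric: conjugation must be by the flow of lower order.
  rcases lt_or_gt_of_ne hkl with h | h
  · exact ⟨imageAlgebra_ne hX hφ hY hψ hk h, inter_eq_compactSum hX hφ hY hψ hk h⟩
  · refine ⟨(imageAlgebra_ne hY hψ hX hφ hl h).symm, ?_⟩
    rw [inter_comm]
    exact inter_eq_compactSum hY hψ hX hφ hl h
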